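/- **Theorem 3.1.** *Setting.* Let $1\le N\le\infty$, let the coordinates $1,\dots,N$ be partitioned into consecutive finite nonempty blocks $[j]=(k_{j-1},k_j]$, with sizes $n_j=k_j-k_{j-1}$, let $\varepsilon>0$ and $\beta=(\beta_k)_{k\le N}$ be real, and let $y_k\sim N(\beta_k,\varepsilon^2)$, $k\le N$, be independent. For an estimator $\hat\beta=\hat\beta(y)$ put $R^{(\varepsilon)}(\hat\beta,\beta)=\sum_{k=1}^N E_\beta^{(\varepsilon)}(\hat\beta_k-\beta_k)^2\in[0,\infty]$, and let the ideal risk $R^{(\varepsilon,*)}(\beta)$ be the infimum of $R^{(\varepsilon)}(\hat\beta,\beta)$ over all separable $\hat\beta$, i.e. $\hat\beta_k=h_j(y_k)$ for all $k\in[j]$, with Borel functions $h_j$. *Estimator.* Fix tuning constants: an integer $n_*>2$, reals $\rho_0,b_0>0$, and a real sequence $\eta_n\to0$ with $1+\eta_n>0$ for $n\ge n_*$; put $$\rho(n)=(1+\eta_n)\rho_0\sqrt{2(\log n)/n},\qquad b(n)=b_0(\log n)/\sqrt n .$$ For a block $[j]$ of size $n=n_j$ let $X_k=y_k/\varepsilon$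 $(k\in[j])$, $a=\sqrt{2\log n}$, $K(x)=\sin(x)/(\pi x)$ (with $K(0)=1/\pi$), $$\hat\varphi_{[j]}(x)=\frac1n\sum_{k\in[j]}aK(a(x-X_k)),\qquad \hat\kappa_{[j]}=1-\frac{\sqrt2}{n}\sum_{k\in[j]}e^{-X_k^2/2},$$ and, if $n\ge n_*$, $$\hat t_{[j]}(x)=\begin{cases}x+\hat\varphi_{[j]}'(x)/\max\{\rho(n),\hat\varphi_{[j]}(x)\},&\hat\kappa_{[j]}>b(n),\\ \operatorname{sgn}(x)(|x|-a)^+,&\hat\kappa_{[j]}\le b(n).\end{cases}$$ In blocks of size $n<n_*$ one uses (the same choice in all of them) either the maximum likelihood estimator $\hat t_{[j]}(x)=x$, or the James–Stein estimator $\hat t_{[j]}(x)=\{1-(n-2)/\sum_{k\in[j]}X_k^2\}x$, the latter being replaced by $\hat t_{[j]}(x)=x$ if $n\le2$. The block hybrid GEB estimator is $\hat\beta^{(\varepsilon)}_k=\varepsilon\,\hat t_{[j]}(y_k/\varepsilon)$, $k\in[j]$. *Claim.* There is a finite constant $M$, depending only on the tuning constants and on the choice of the rule for small blocks, such that for all $N$,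 all block partitions, all $\varepsilon>0$, all $\beta$ and all $0<p<\infty$, $$R^{(\varepsilon)}(\hat\beta^{(\varepsilon)},\beta)\le R^{(\varepsilon,*)}(\beta)+M\varepsilon^2\sum_j\left\{n_j\,r_{p\wedge2}\!\left(n_j,\frac{(\sum_{k\in[j]}|\beta_k|^p)^{1/p}}{\varepsilon n_j^{1/p}}\right)+\frac1{(\log n_j+1)^{3/2}}\right\}$$ in $[0,\infty]$, where $$r_p(n,C)=\min\left(1,\frac{C^p}{(\log n)^{p/2-1}},\max\left[\frac{(\log n)^2}{\sqrt n},\left\{\frac{C(\log n)^{3/2}}{\sqrt n}\right\}^{p/(p+1)}\right]\right),\qquad r_p(1,C)=0 .$$ -/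

import Mathlib

open MeasureTheory ProbabilityTheory Filter Topology
open scoped ENNReal NNReal

namespace GEB

noncomputable section

/-! ### The sequence of coordinates and its partition into consecutive blocks -/

/-- The coordinates `k = 1, …, N` of a sequence of length `N ≤ ∞`. -/
abbrev Coord (N : ℕ∞) : Type := {k : ℕ // 1 ≤ k ∧ (k : ℕ∞) ≤ N}

/-- A partition of the coordinates `1, …, N` into consecutive, finite, nonempty blocks
`(endpoint j, endpoint (j + 1)]`, `0 ≤ j < numBlocks ≤ ∞`.
(The values of `endpoint` beyond the last block play no role.) -/
structure BlockPartition (N : ℕ∞) where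
  numBlocks : ℕ∞
  endpoint : ℕ → ℕ
  endpoint_zero : endpoint 0 = 0
  endpoint_lt : ∀ j : ℕ, (j : ℕ∞) < numBlocks → endpoint j < endpoint (j + 1)
  endpoint_le : ∀ j : ℕ, (j : ℕ∞) < numBlocks → (endpoint (j + 1) : ℕ∞) ≤ N
  cover : ∀ k : Coord N, ∃ j : ℕ, (j : ℕ∞) < numBlocks ∧
    endpoint j < (k : ℕ) ∧ (k : ℕ) ≤ endpoint (j + 1)

namespace BlockPartition

variable {N : ℕ∞} (P : BlockPartition N)

/-- The indices `j` of the blocks. -/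
abbrev Index : Type := {j : ℕ // (j : ℕ∞) < P.numBlocks}

open Classical in
/-- The block `[j]`, as a finite set of coordinates. -/
def block (j : P.Index) : Finset (Coord N) :=
  (Finset.Ioc (P.endpoint j) (P.endpoint (j + 1))).subtype _

/-- The size `n_j` of block `[j]`. -/
def size (j : P.Index) : ℕ := (P.block j).card

/-- The index of the block that contains the coordinate `k`. -/
def blockOf (k : Coord N) : P.Index :=
  ⟨(P.cover k).choose, (P.cover k).choose_spec.1⟩

theorem mem_block {j : P.Index} {k : Coord N} :
    k ∈ P.block j ↔ P.endpoint j < (k : ℕ) ∧ (k : ℕ) ≤ P.endpoint (j + 1) := by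
  simp [block]

theorem size_eq (j : P.Index) : P.size j = P.endpoint (j + 1) - P.endpoint j := by
  classical
  have h : ∀ k ∈ Finset.Ioc (P.endpoint j) (P.endpoint (j + 1)), 1 ≤ k ∧ (k : ℕ∞) ≤ N := by
    intro k hk
    rw [Finset.mem_Ioc] at hk
    exact ⟨by omega, le_trans (by exact_mod_cast hk.2) (P.endpoint_le j j.2)⟩
  rw [size, block, Finset.card_subtype, Finset.filter_true_of_mem h, Nat.card_Ioc]

theorem endpoint_mono {i j : ℕ} (hij : i ≤ j) (hj : (j : ℕ∞) ≤ P.numBlocks) :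
    P.endpoint i ≤ P.endpoint j := by
  induction j, hij using Nat.le_induction with
  | base => exact le_rfl
  | succ m _ ih =>
    have hm : (m : ℕ∞) < P.numBlocks := lt_of_lt_of_le (by exact_mod_cast Nat.lt_succ_self m) hj
    exact (ih hm.le).trans (P.endpoint_lt m hm).le

/-- The blocks are the fibres of `blockOf`. -/
theorem mem_block_iff {j : P.Index} {k : Coord N} : k ∈ P.block j ↔ P.blockOf k = j := by
  have hs := (P.cover k).choose_spec.2
  change P.endpoint (P.blockOf k) < (k : ℕ) ∧ (k : ℕ) ≤ P.endpoint (P.blockOf k + 1) at hs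
  rw [mem_block]
  constructor
  · rintro ⟨h1, h2⟩
    apply Subtype.ext
    rcases lt_trichotomy (P.blockOf k : ℕ) (j : ℕ) with h | h | h
    · have := P.endpoint_mono (Nat.succ_le_of_lt h) j.2.le
      simp only [Nat.succ_eq_add_one] at this
      omega
    · exact h
    · have := P.endpoint_mono (Nat.succ_le_of_lt h) (P.blockOf k).2.le
      simp only [Nat.succ_eq_add_one] at this
      omega
  · rintro rfl
    exact hs

end BlockPartition

/-! ### The hybrid general empirical Bayes rule in one block

`s` is the block, `n = s.card` its size, and `X` the standardised sample. -/

section OneBlock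

variable {ι : Type*} (s : Finset ι) (X : ι → ℝ)

/-- The kernel `K(x) = sin x / (π x)`, with `K(0) = 1 / π`. -/
def kernel (x : ℝ) : ℝ := Real.sinc x / Real.pi

/-- `√(2 log n)`: the inverse bandwidth and the threshold level. -/
def level (n : ℕ) : ℝ := √(2 * Real.log n)

/-- The kernel estimate `φ̂(x)` of the mixture density. -/
def phiHat (x : ℝ) : ℝ :=
  (1 / (s.card : ℝ)) * ∑ k ∈ s, level s.card * kernel (level s.card * (x - X k))

/-- The estimate `κ̂ = 1 - (√2 / n) ∑ exp (-X_k² / 2)`. -/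
def kappaHat : ℝ :=
  1 - (√2 / (s.card : ℝ)) * ∑ k ∈ s, Real.exp (-(X k) ^ 2 / 2)

/-- Soft thresholding `sgn(x) (|x| - l)⁺`. -/
def softThreshold (l x : ℝ) : ℝ := Real.sign x * max (|x| - l) 0

/-- The two rules that may be used in blocks that are too small for the hybrid rule. -/
inductive SmallBlockRule
  | mle
  | jamesStein

/-- The rule for small blocks: the maximum likelihood estimator `x`, or the James-Stein estimator
`(1 - (n - 2) / ∑ X_k²) x`.  The subtraction `n - 2` is truncated, so that for `n ≤ 2`, where the
James-Stein estimator is not available, the maximum likelihood estimator is used. -/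
def SmallBlockRule.apply : SmallBlockRule → ℝ → ℝ
  | .mle, x => x
  | .jamesStein, x => (1 - ((s.card - 2 : ℕ) : ℝ) / ∑ k ∈ s, (X k) ^ 2) * x

/-- The tuning constants `n_* > 2`, `ρ₀ > 0`, `b₀ > 0`, a sequence `η_n → 0` (with `1 + η_n > 0`
for `n ≥ n_*`, i.e. `ρ(n) > 0`), and the choice of the rule for blocks of size `n < n_*`. -/
structure Tuning where
  nStar : ℕ
  two_lt_nStar : 2 < nStar
  rho0 : ℝ
  rho0_pos : 0 < rho0
  b0 : ℝ
  b0_pos : 0 < b0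
  eta : ℕ → ℝ
  eta_tendsto : Tendsto eta atTop (𝓝 0)
  one_add_eta_pos : ∀ n, nStar ≤ n → 0 < 1 + eta n
  smallRule : SmallBlockRule

/-- `ρ(n) = (1 + η_n) ρ₀ √(2 (log n) / n)`. -/
def Tuning.rho (τ : Tuning) (n : ℕ) : ℝ :=
  (1 + τ.eta n) * τ.rho0 * √(2 * Real.log n / n)

/-- `b(n) = b₀ (log n) / √n`. -/
def Tuning.b (τ : Tuning) (n : ℕ) : ℝ := τ.b0 * Real.log n / √n

open Classical in
/-- The rule `t̂(x)` for one block. -/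
def tHat (τ : Tuning) (x : ℝ) : ℝ :=
  if τ.nStar ≤ s.card then
    if τ.b s.card < kappaHat s X then
      x + deriv (phiHat s X) x / max (τ.rho s.card) (phiHat s X x)
    else softThreshold (level s.card) x
  else τ.smallRule.apply s X x

end OneBlock

/-! ### The normal means model, the estimator and the risks -/

/-- The law of `y = (y_k)`, `k ≤ N`, with independent `y_k ∼ N(β_k, ε²)`. -/
def law {N : ℕ∞} (ε : ℝ) (β : Coord N → ℝ) : Measure (Coord N → ℝ) :=
  Measure.infinitePi fun k => gaussianReal (β k) (Real.toNNReal (ε ^ 2))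

/-- The risk `∑_{k ≤ N} E (β̂_k - β_k)²`, a number in `[0, ∞]`, of an estimator `β̂`. -/
def risk {N : ℕ∞} (ε : ℝ) (est : (Coord N → ℝ) → Coord N → ℝ) (β : Coord N → ℝ) : ℝ≥0∞ :=
  ∑' k, ∫⁻ y, ENNReal.ofReal ((est y k - β k) ^ 2) ∂(law ε β)

/-- The block hybrid GEB estimator `β̂_k = ε t̂_{[j]}(y_k / ε)` for `k ∈ [j]`, where `t̂_{[j]}` is
computed from the sample `X_i = y_i / ε`, `i ∈ [j]`. -/
def estimator {N : ℕ∞} (P : BlockPartition N) (τ : Tuning) (ε : ℝ)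
    (y : Coord N → ℝ) (k : Coord N) : ℝ :=
  ε * tHat (P.block (P.blockOf k)) (fun i => y i / ε) τ (y k / ε)

/-- The ideal risk: the infimum of the risk over all separable estimators `β̂_k = h_j(y_k)`
for `k ∈ [j]`, with Borel functions `h_j`. -/
def idealRisk {N : ℕ∞} (P : BlockPartition N) (ε : ℝ) (β : Coord N → ℝ) : ℝ≥0∞ :=
  ⨅ (h : P.Index → ℝ → ℝ) (_ : ∀ j, Measurable (h j)),
    risk ε (fun y k => h (P.blockOf k) (y k)) β

/-- The rate `r_p(n, C)`. -/
def rate (p : ℝ) (n : ℕ) (C : ℝ) : ℝ :=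
  min 1 (min (C ^ p / Real.log n ^ (p / 2 - 1))
    (max (Real.log n ^ 2 / √n)
      ((C * Real.log n ^ (3 / 2 : ℝ) / √n) ^ (p / (p + 1)))))

/-- The standardised `ℓ_p` moment `(∑_{k ∈ [j]} |β_k|^p)^{1/p} / (ε n_j^{1/p})`. -/
def blockMoment {N : ℕ∞} (P : BlockPartition N) (p ε : ℝ) (β : Coord N → ℝ) (j : P.Index) : ℝ :=
  (∑ k ∈ P.block j, |β k| ^ p) ^ (1 / p) / (ε * (P.size j : ℝ) ^ (1 / p))

end

end GEB

namespace GEB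

noncomputable section

open scoped Real

/-! ### The sinc kernel -/

/-! Everything happens inside one block. Fix a separable competitor. After division by ε a block of
size n holds independent `X_i ∼ N(θ_i, 1)`, and it is enough to bound the risk of the hybrid rule
there by that of the competitor plus M times the summand of the block (`exists_block_risk_le`).
Summing over blocks and taking the infimum over competitors gives the claim; the power mean
inequality replaces p by p ∧ 2.

Empirical Bayes rule. The summed risk of a fixed rule is governed at each x by the posterior weights
`npdf (θ i) x`; with f the mixture density, `x + f'/f` is the posterior mean, so it beats every
separable rule, and `x + g` exceeds it by `n ∫ (g - f'/f)² f`. Replacing `f'/f` by `f'/max(ρ, f)`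
costs `regBias`, the Fisher information of f on `{f < ρ}` (`sum_lintegral_rule_le`). The sinc kernel
cuts frequencies off at `a = √(2 log n)`, and the Gaussian characteristic function makes the bias at
most `exp (-a²/2) = 1/n`; the variance has Lebesgue integral of order a/n. Second and fourth moments
then give a weighted integrated squared error of order `log n / √n` (`lintegral_score_error`,
`IsLarge.scoreErr_le`). The score is evaluated at the data it is built from; exchanging X_i with an
independent copy moves it by at most `δ (a + |score|)` with `δ = a/(nρ) = O(1/√n)`, which is
affordable (`sum_lintegral_score_rule_le`).

Regularisation bias. Cauchy-Schwarz and Jensen for the entropy function give `f'² ≤ 2 f² log(1/f)`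
(`mixD_sq_le_log`), so the integrand is of order `ρ log(1/ρ)` where `f < ρ`. Far out, the Fisher
information of the mixture is dominated by that of its components. Optimising the truncation point
gives the power `q/(q+1)` in the rate. If most means are near 0, f is at least about half a standard
normal density, `{f < ρ}` lies far out, and the bias is of order `log n / √n + D`, where D bounds
the mean of `|θ_i|^q`.

Hybrid choice. `kappaHat` estimates the mean κ of `1 - exp (-θ_i²/4)`, comparable with the mean of
`min(1, θ_i²)`. By Hoeffding a deviation of order b has probability at most `n⁻⁴`, so wrong choices
cost O(1/n) (`IsLarge.sum_lintegral_rare_le`). If soft thresholding is a plausible choice, κ ≤ 2b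
and it costs at most of order `n log² n / √n + (log n)^(-3/2)`. If the Bayes rule is plausible, κ ≥
b/2, so D ≥ b/2 and D absorbs `log n / √n`. These facts cover the three terms of the rate
(`IsLarge.hybrid_le_rate`).

Only finitely many sizes are not large for the asymptotic relations. For each of them the risk is
bounded uniformly in θ (`exists_sum_lintegral_tHat_le`) and is absorbed by the summand `(log n +
1)^(-3/2)`. -/

/-- The derivative of `kernel`. -/
def kernelDeriv (x : ℝ) : ℝ := (∫ u in (0 : ℝ)..1, -u * Real.sin (u * x)) / π

theorem hasDerivAt_integral_cos (a x : ℝ) :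
    HasDerivAt (fun y => ∫ u in (0 : ℝ)..a, Real.cos (u * y))
      (∫ u in (0 : ℝ)..a, -u * Real.sin (u * x)) x := by
  refine (intervalIntegral.hasDerivAt_integral_of_dominated_loc_of_deriv_le (μ := volume)
    (bound := fun u => |u|) (F' := fun y u => -u * Real.sin (u * y)) (s := Set.univ) univ_mem
    ?_ ?_ ?_ ?_ ?_ ?_).2
  · exact Eventually.of_forall fun y =>
      (by fun_prop : Continuous fun u => Real.cos (u * y)).aestronglyMeasurable
  · exact (by fun_prop : Continuous fun u => Real.cos (u * x)).intervalIntegrable _ _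
  · exact (by fun_prop : Continuous fun u => -u * Real.sin (u * x)).aestronglyMeasurable
  · refine Eventually.of_forall fun u _ y _ => ?_
    rw [norm_mul, norm_neg, Real.norm_eq_abs, Real.norm_eq_abs]
    exact mul_le_of_le_one_right (abs_nonneg _) (Real.abs_sin_le_one _)
  · exact continuous_abs.intervalIntegrable _ _
  · refine Eventually.of_forall fun u _ y _ => ?_
    have := ((hasDerivAt_id y).const_mul u).cos
    simpa [mul_comm, mul_left_comm] using this

theorem integral_cos_mul_eq_sin_div (a : ℝ) {x : ℝ} (hx : x ≠ 0) :
    ∫ u in (0 : ℝ)..a, Real.cos (u * x) = Real.sin (a * x) / x := by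
  rw [intervalIntegral.integral_comp_mul_right (f := Real.cos) hx, integral_cos]
  simp [div_eq_inv_mul]

/-- For a > 0 the scaled kernel is the inverse Fourier transform of the indicator of `[-a, a]`,
folded to the half line. Averaging over a Gaussian multiplies the integrand by `exp (-u²/2)`, which
turns the bias into a frequency tail. -/
theorem mul_kernel_mul (a x : ℝ) :
    a * kernel (a * x) = (∫ u in (0 : ℝ)..a, Real.cos (u * x)) / π := by
  unfold kernel
  rcases eq_or_ne x 0 with rfl | hx
  · simp [div_eq_mul_inv]
  rcases eq_or_ne a 0 with rfl | ha
  · simp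
  rw [integral_cos_mul_eq_sin_div a hx, Real.sinc_of_ne_zero (mul_ne_zero ha hx)]
  field_simp

theorem kernel_eq_integral (x : ℝ) :
    kernel x = (∫ u in (0 : ℝ)..1, Real.cos (u * x)) / π := by
  simpa using mul_kernel_mul 1 x

theorem hasDerivAt_kernel (x : ℝ) : HasDerivAt kernel (kernelDeriv x) x := by
  have h := (hasDerivAt_integral_cos 1 x).div_const π
  exact h.congr_of_eventuallyEq (Eventually.of_forall kernel_eq_integral)

/-- Both sides are the derivative in x of the identity `mul_kernel_mul`. -/
theorem sq_mul_kernelDeriv_mul (a x : ℝ) :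
    a ^ 2 * kernelDeriv (a * x) = (∫ u in (0 : ℝ)..a, -u * Real.sin (u * x)) / π := by
  have h1 := (hasDerivAt_integral_cos a x).div_const π
  have h2 : HasDerivAt (fun y => a * kernel (a * y)) (a * (kernelDeriv (a * x) * (a * 1))) x :=
    ((hasDerivAt_kernel (a * x)).comp x ((hasDerivAt_id x).const_mul a)).const_mul a
  have h3 := h2.congr_of_eventuallyEq
    (Eventually.of_forall fun y => (mul_kernel_mul a y).symm)
  rw [h1.unique h3]
  ring

theorem continuous_kernel : Continuous kernel := Real.continuous_sinc.div_const _

theorem continuous_kernelDeriv : Continuous kernelDeriv := by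
  refine Continuous.div_const ?_ _
  exact intervalIntegral.continuous_parametric_intervalIntegral_of_continuous'
    (f := fun x u => -u * Real.sin (u * x)) (by fun_prop) 0 1

theorem abs_kernel_le (x : ℝ) : |kernel x| ≤ 1 / π := by
  rw [kernel, abs_div, abs_of_pos Real.pi_pos]
  gcongr
  exact Real.abs_sinc_le_one x

theorem abs_kernelDeriv_le (x : ℝ) : |kernelDeriv x| ≤ 1 / π := by
  rw [kernelDeriv, abs_div, abs_of_pos Real.pi_pos]
  gcongr
  have := intervalIntegral.norm_integral_le_of_norm_le_const (a := (0 : ℝ)) (b := 1) (C := 1)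
    (f := fun u => -u * Real.sin (u * x)) ?_
  · simpa using this
  · intro u hu
    rw [Set.uIoc_of_le zero_le_one] at hu
    rw [norm_mul, norm_neg, Real.norm_eq_abs, Real.norm_eq_abs, abs_of_pos hu.1]
    exact mul_le_one₀ hu.2 (abs_nonneg _) (Real.abs_sin_le_one _)

theorem one_div_pi_le : 1 / π ≤ 1 / 3 := by
  have := Real.pi_gt_three
  gcongr

/-- The integrable majorant `1 / (1 + x²)` of the squared kernels. -/
def cauchyWeight (x : ℝ) : ℝ := (1 + x ^ 2)⁻¹

theorem cauchyWeight_nonneg (x : ℝ) : 0 ≤ cauchyWeight x := by unfold cauchyWeight; positivity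

theorem cauchyWeight_le_one (x : ℝ) : cauchyWeight x ≤ 1 :=
  inv_le_one_of_one_le₀ (by nlinarith [sq_nonneg x])

theorem continuous_cauchyWeight : Continuous cauchyWeight := by
  unfold cauchyWeight
  exact Continuous.inv₀ (by fun_prop) fun x => by positivity

/-- The hypotheses give `k² ≤ 1/9` and `x² k² ≤ 4/9`, so `(1 + x²) k² ≤ 1`. The kernels decay only
like 1/|x| and are not absolutely integrable, but the variance sees only their squares. -/
theorem sq_le_cauchyWeight {k x : ℝ} (h1 : |k| ≤ 1 / 3) (h2 : |x| * |k| ≤ 2 / 3) :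
    k ^ 2 ≤ cauchyWeight x := by
  unfold cauchyWeight
  rw [← one_div, le_div_iff₀ (by positivity)]
  have a1 : k ^ 2 ≤ (1 / 3) ^ 2 := by
    rw [← sq_abs k]; gcongr
  have a2 : x ^ 2 * k ^ 2 ≤ (2 / 3) ^ 2 := by
    rw [← sq_abs k, ← sq_abs x, ← mul_pow]; gcongr
  nlinarith

theorem kernel_sq_le (x : ℝ) : kernel x ^ 2 ≤ cauchyWeight x := by
  refine sq_le_cauchyWeight ((abs_kernel_le x).trans one_div_pi_le) ?_
  rcases eq_or_ne x 0 with rfl | hx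
  · norm_num
  have := Real.pi_gt_three
  rw [← abs_mul, kernel, Real.sinc_of_ne_zero hx]
  have : x * (Real.sin x / x / π) = Real.sin x / π := by field_simp
  rw [this, abs_div, abs_of_pos Real.pi_pos, div_le_iff₀ Real.pi_pos]
  nlinarith [Real.abs_sin_le_one x]

theorem kernelDeriv_of_ne_zero {x : ℝ} (hx : x ≠ 0) :
    kernelDeriv x = (Real.cos x / x - Real.sin x / x ^ 2) / π := by
  have h1 : HasDerivAt (fun y => Real.sin y / y / π)
      ((Real.cos x * x - Real.sin x * 1) / x ^ 2 / π) x :=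
    ((Real.hasDerivAt_sin x).div (hasDerivAt_id x) hx).div_const π
  have h2 : HasDerivAt kernel ((Real.cos x * x - Real.sin x * 1) / x ^ 2 / π) x := by
    refine h1.congr_of_eventuallyEq ?_
    filter_upwards [isOpen_ne.mem_nhds hx] with y hy
    rw [kernel, Real.sinc_of_ne_zero hy]
  rw [(hasDerivAt_kernel x).unique h2]
  field_simp

theorem kernelDeriv_sq_le (x : ℝ) : kernelDeriv x ^ 2 ≤ cauchyWeight x := by
  refine sq_le_cauchyWeight ((abs_kernelDeriv_le x).trans one_div_pi_le) ?_
  have hp := Real.pi_gt_three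
  rcases eq_or_ne x 0 with rfl | hx
  · norm_num
  rw [← abs_mul, kernelDeriv_of_ne_zero hx]
  have : x * ((Real.cos x / x - Real.sin x / x ^ 2) / π) =
      (Real.cos x - Real.sinc x) / π := by
    rw [Real.sinc_of_ne_zero hx]; field_simp
  rw [this, abs_div, abs_of_pos Real.pi_pos, div_le_iff₀ Real.pi_pos]
  have h := abs_sub (Real.cos x) (Real.sinc x)
  nlinarith [Real.abs_cos_le_one x, Real.abs_sinc_le_one x]

theorem integrable_cauchyWeight : Integrable cauchyWeight := integrable_inv_one_add_sq

theorem lintegral_cauchyWeight_comp {a : ℝ} (ha : 0 < a) (c : ℝ) :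
    ∫⁻ x, ENNReal.ofReal (a * cauchyWeight (a * (x - c))) = ENNReal.ofReal π := by
  have h0 : Integrable fun x => cauchyWeight (a * x) :=
    integrable_cauchyWeight.comp_mul_left' ha.ne'
  have h1 : Integrable fun x => a * cauchyWeight (a * (x - c)) :=
    (h0.comp_sub_right c).const_mul a
  rw [← ofReal_integral_eq_lintegral_ofReal h1
    (Eventually.of_forall fun x => mul_nonneg ha.le (cauchyWeight_nonneg _))]
  congr 1
  rw [integral_const_mul, integral_sub_right_eq_self (fun x => cauchyWeight (a * x)) c,
    Measure.integral_comp_mul_left, abs_of_pos (inv_pos.2 ha)]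
  simp only [cauchyWeight, integral_univ_inv_one_add_sq, smul_eq_mul]
  field_simp

/-! ### The normal density -/

/-- The density of `N(θ, 1)`. -/
def npdf (θ x : ℝ) : ℝ := (√(2 * π))⁻¹ * Real.exp (-(x - θ) ^ 2 / 2)

theorem npdf_eq (θ x : ℝ) : npdf θ x = gaussianPDFReal θ 1 x := by
  simp [npdf, gaussianPDFReal_def]

theorem npdf_pos (θ x : ℝ) : 0 < npdf θ x := by
  unfold npdf; positivity

theorem one_le_sqrt_two_pi : 1 ≤ √(2 * π) := by
  rw [Real.one_le_sqrt]
  nlinarith [Real.pi_gt_three]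

theorem npdf_le_one (θ x : ℝ) : npdf θ x ≤ 1 := by
  unfold npdf
  refine mul_le_one₀ (inv_le_one_of_one_le₀ one_le_sqrt_two_pi) (Real.exp_pos _).le ?_
  rw [Real.exp_le_one_iff]
  nlinarith [sq_nonneg (x - θ)]

theorem continuous_npdf (θ : ℝ) : Continuous (npdf θ) := by
  unfold npdf; fun_prop

theorem lintegral_gaussian (θ : ℝ) (F : ℝ → ℝ≥0∞) :
    ∫⁻ x, F x ∂(gaussianReal θ 1) = ∫⁻ x, ENNReal.ofReal (npdf θ x) * F x := by
  rw [gaussianReal_of_var_ne_zero _ one_ne_zero,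
    lintegral_withDensity_eq_lintegral_mul_non_measurable _ (measurable_gaussianPDF _ _)
      (Eventually.of_forall fun _ => gaussianPDF_lt_top)]
  simp [gaussianPDF, npdf_eq]

theorem integral_gaussian_eq (θ : ℝ) (F : ℝ → ℝ) :
    ∫ x, F x ∂(gaussianReal θ 1) = ∫ x, npdf θ x * F x := by
  rw [integral_gaussianReal_eq_integral_smul one_ne_zero]
  simp [npdf_eq]

theorem lintegral_npdf (θ : ℝ) : ∫⁻ x, ENNReal.ofReal (npdf θ x) = 1 := by
  simp_rw [npdf_eq]
  exact lintegral_gaussianPDFReal_eq_one θ one_ne_zero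

theorem integrable_of_bounded {μ : Measure ℝ} [IsFiniteMeasure μ] {F : ℝ → ℝ}
    (hF : Continuous F) {C : ℝ} (h : ∀ x, |F x| ≤ C) : Integrable F μ :=
  Integrable.of_bound hF.aestronglyMeasurable C (Eventually.of_forall h)

/-! ### Trigonometric moments and Fourier inversion for the normal density. -/

theorem integral_cexp_gaussian (θ t : ℝ) :
    ∫ x, Complex.exp (t * x * Complex.I) ∂(gaussianReal θ 1) =
      Complex.exp (t * θ * Complex.I - t ^ 2 / 2) := by
  have := charFun_gaussianReal (μ := θ) (v := 1) t
  rw [charFun_apply_real] at this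
  simpa using this

theorem integrable_cexp_gaussian (θ t : ℝ) :
    Integrable (fun x : ℝ => Complex.exp (t * x * Complex.I)) (gaussianReal θ 1) := by
  refine Integrable.of_bound (by fun_prop) 1 (Eventually.of_forall fun x => ?_)
  have := Complex.norm_exp_ofReal_mul_I (t * x)
  push_cast at this
  exact this.le

theorem integral_cos_gaussian (θ t : ℝ) :
    ∫ x, Real.cos (t * x) ∂(gaussianReal θ 1) = Real.cos (t * θ) * Real.exp (-t ^ 2 / 2) := by
  have h := integral_re (integrable_cexp_gaussian θ t)
  rw [integral_cexp_gaussian] at h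
  simp only [RCLike.re_to_complex, Complex.exp_re] at h
  simpa [← Complex.ofReal_pow, ← Complex.ofReal_mul, neg_div, mul_comm] using h

theorem integral_sin_gaussian (θ t : ℝ) :
    ∫ x, Real.sin (t * x) ∂(gaussianReal θ 1) = Real.sin (t * θ) * Real.exp (-t ^ 2 / 2) := by
  have h := integral_im (integrable_cexp_gaussian θ t)
  rw [integral_cexp_gaussian] at h
  simp only [RCLike.im_to_complex, Complex.exp_im] at h
  simpa [← Complex.ofReal_pow, ← Complex.ofReal_mul, neg_div, mul_comm] using h

theorem integral_cos_sub_gaussian (θ t x : ℝ) :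
    ∫ y, Real.cos (t * (x - y)) ∂(gaussianReal θ 1) =
      Real.cos (t * (x - θ)) * Real.exp (-t ^ 2 / 2) := by
  have h : ∀ y, Real.cos (t * (x - y)) = Real.cos (t * x) * Real.cos (t * y) +
      Real.sin (t * x) * Real.sin (t * y) := fun y => by rw [mul_sub, Real.cos_sub]
  simp_rw [h]
  rw [integral_add, integral_const_mul, integral_const_mul, integral_cos_gaussian,
    integral_sin_gaussian]
  · ring
  · exact (integrable_of_bounded (by fun_prop) fun y => Real.abs_cos_le_one (t * y)).const_mul _
  · exact (integrable_of_bounded (by fun_prop) fun y => Real.abs_sin_le_one (t * y)).const_mul _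

theorem integral_sin_sub_gaussian (θ t x : ℝ) :
    ∫ y, Real.sin (t * (x - y)) ∂(gaussianReal θ 1) =
      Real.sin (t * (x - θ)) * Real.exp (-t ^ 2 / 2) := by
  have h : ∀ y, Real.sin (t * (x - y)) = Real.sin (t * x) * Real.cos (t * y) -
      Real.cos (t * x) * Real.sin (t * y) := fun y => by rw [mul_sub, Real.sin_sub]
  simp_rw [h]
  rw [integral_sub, integral_const_mul, integral_const_mul, integral_cos_gaussian,
    integral_sin_gaussian]
  · ring
  · exact (integrable_of_bounded (by fun_prop) fun y => Real.abs_cos_le_one (t * y)).const_mul _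
  · exact (integrable_of_bounded (by fun_prop) fun y => Real.abs_sin_le_one (t * y)).const_mul _

theorem integrable_exp_neg_sq_div_two : Integrable fun u : ℝ => Real.exp (-u ^ 2 / 2) := by
  have := integrable_exp_neg_mul_sq (b := 1 / 2) (by norm_num)
  refine this.congr (Eventually.of_forall fun u => ?_)
  simp only []; congr 1; ring

theorem integrable_mul_exp_neg_sq_div_two :
    Integrable fun u : ℝ => u * Real.exp (-u ^ 2 / 2) := by
  have := integrable_mul_exp_neg_mul_sq (b := 1 / 2) (by norm_num)
  refine this.congr (Eventually.of_forall fun u => ?_)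
  simp only []; congr 2; ring

theorem integrable_bdd_mul {f g : ℝ → ℝ} (hf : Integrable f) (hg : Continuous g)
    (h : ∀ x, |g x| ≤ 1) : Integrable fun x => g x * f x :=
  hf.bdd_mul (c := 1) hg.aestronglyMeasurable (Eventually.of_forall h)

/-- Inversion without an inversion theorem: `exp (-u²/2)` is itself a multiple of the N(0, 1)
density, so the integral over the line is a characteristic function, and evenness halves it. -/
theorem integral_Ioi_cos_mul_exp (y : ℝ) :
    (∫ u in Set.Ioi (0 : ℝ), Real.cos (u * y) * Real.exp (-u ^ 2 / 2)) / π =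
      (√(2 * π))⁻¹ * Real.exp (-y ^ 2 / 2) := by
  have h1 := integral_cos_gaussian 0 y
  rw [integral_gaussian_eq] at h1
  have h2 := integral_comp_abs (f := fun u => Real.cos (u * y) * Real.exp (-u ^ 2 / 2))
  have h3 : ∀ u : ℝ, Real.cos (|u| * y) = Real.cos (y * u) := fun u => by
    rcases abs_choice u with h | h <;> rw [h]
    · rw [mul_comm]
    · rw [← Real.cos_neg]; congr 1; ring
  simp only [h3, sq_abs] at h2
  have h4 : ∀ x : ℝ, npdf 0 x * Real.cos (y * x) =
      (√(2 * π))⁻¹ * (Real.cos (y * x) * Real.exp (-x ^ 2 / 2)) := fun x => by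
    unfold npdf; rw [sub_zero]; ring
  simp_rw [h4] at h1
  rw [integral_const_mul, h2] at h1
  simp only [mul_zero, Real.cos_zero, one_mul] at h1
  rw [← h1]
  have hs : √(2 * π) * √(2 * π) = 2 * π := Real.mul_self_sqrt (by positivity)
  have hs' : (√(2 * π))⁻¹ * (√(2 * π))⁻¹ = (2 * π)⁻¹ := by rw [← mul_inv, hs]
  rw [← mul_assoc, hs']
  set J := ∫ u in Set.Ioi (0 : ℝ), Real.cos (u * y) * Real.exp (-u ^ 2 / 2)
  field_simp

/-- Integrate the derivative of `sin (u y) exp (-u²/2)` over the half line: both boundary values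
vanish. -/
theorem integral_Ioi_mul_sin_mul_exp (y : ℝ) :
    ∫ u in Set.Ioi (0 : ℝ), u * Real.sin (u * y) * Real.exp (-u ^ 2 / 2) =
      y * ∫ u in Set.Ioi (0 : ℝ), Real.cos (u * y) * Real.exp (-u ^ 2 / 2) := by
  have i1 : Integrable fun u : ℝ => Real.cos (u * y) * Real.exp (-u ^ 2 / 2) :=
    integrable_bdd_mul integrable_exp_neg_sq_div_two (by fun_prop) fun u => Real.abs_cos_le_one _
  have i2 : Integrable fun u : ℝ => u * Real.sin (u * y) * Real.exp (-u ^ 2 / 2) := by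
    have := integrable_bdd_mul integrable_mul_exp_neg_sq_div_two
      (g := fun u => Real.sin (u * y)) (by fun_prop) fun u => Real.abs_sin_le_one _
    refine this.congr (Eventually.of_forall fun u => ?_)
    simp only []; ring
  have key := integral_Ioi_of_hasDerivAt_of_tendsto' (a := (0 : ℝ)) (m := 0)
    (f := fun u => Real.sin (u * y) * Real.exp (-u ^ 2 / 2))
    (f' := fun u => y * (Real.cos (u * y) * Real.exp (-u ^ 2 / 2)) -
      u * Real.sin (u * y) * Real.exp (-u ^ 2 / 2)) ?_ ?_ ?_
  · rw [integral_sub (i1.const_mul y).integrableOn i2.integrableOn, integral_const_mul] at key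
    simp only [zero_mul, Real.sin_zero, sub_zero] at key
    linarith
  · intro u _
    have h1 := ((hasDerivAt_id u).mul_const y).sin
    have h2 : HasDerivAt (fun u : ℝ => Real.exp (-u ^ 2 / 2))
        (Real.exp (-u ^ 2 / 2) * (-(2 * u) / 2)) u := by
      have := (((hasDerivAt_pow 2 u).neg).div_const 2).exp
      simpa using this
    refine (h1.mul h2).congr_deriv ?_
    simp only [id]; ring
  · exact ((i1.const_mul y).sub i2).integrableOn
  · refine squeeze_zero_norm' (a := fun u => Real.exp (-u)) ?_
      Real.tendsto_exp_neg_atTop_nhds_zero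
    filter_upwards [eventually_ge_atTop 2] with u hu
    rw [norm_mul, Real.norm_eq_abs, Real.norm_eq_abs, abs_of_pos (Real.exp_pos _)]
    calc _ ≤ 1 * Real.exp (-u) := by
          gcongr
          · exact Real.abs_sin_le_one _
          · nlinarith
      _ = _ := one_mul _

theorem integral_Ioi_mul_exp_neg_sq (a : ℝ) :
    ∫ u in Set.Ioi a, u * Real.exp (-u ^ 2 / 2) = Real.exp (-a ^ 2 / 2) := by
  have key := integral_Ioi_of_hasDerivAt_of_tendsto' (a := a) (m := 0)
    (f := fun u => -Real.exp (-u ^ 2 / 2)) (f' := fun u => u * Real.exp (-u ^ 2 / 2)) ?_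
    integrable_mul_exp_neg_sq_div_two.integrableOn ?_
  · rw [key]; ring
  · intro u _
    have := (((hasDerivAt_pow 2 u).neg).div_const 2).exp.neg
    refine this.congr_deriv ?_
    simp; ring
  · rw [← neg_zero]
    refine Tendsto.neg (Real.tendsto_exp_atBot.comp ?_)
    simp_rw [neg_div]
    exact tendsto_neg_atTop_atBot.comp
      ((tendsto_pow_atTop (two_ne_zero)).atTop_div_const two_pos)

/-! ### Frequency cut-off: bias of the kernel estimates of a normal density and its derivative. -/

theorem npdf_eq_integral (θ x : ℝ) :
    npdf θ x = (∫ u in Set.Ioi (0 : ℝ), Real.cos (u * (x - θ)) * Real.exp (-u ^ 2 / 2)) / π := by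
  rw [integral_Ioi_cos_mul_exp, npdf]

theorem mul_npdf_eq_integral (θ x : ℝ) :
    (θ - x) * npdf θ x =
      (∫ u in Set.Ioi (0 : ℝ), -(u * Real.sin (u * (x - θ)) * Real.exp (-u ^ 2 / 2))) / π := by
  rw [integral_neg, integral_Ioi_mul_sin_mul_exp, npdf_eq_integral]
  ring

theorem integral_Ioi_sub_intervalIntegral {f : ℝ → ℝ} (hf : Integrable f) {a : ℝ} (ha : 0 ≤ a) :
    (∫ u in (0 : ℝ)..a, f u) - ∫ u in Set.Ioi (0 : ℝ), f u = -∫ u in Set.Ioi a, f u := by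
  rw [intervalIntegral.integral_of_le ha, ← Set.Ioc_union_Ioi_eq_Ioi ha,
    setIntegral_union Set.Ioc_disjoint_Ioi_same measurableSet_Ioi hf.integrableOn hf.integrableOn]
  ring

/-- By Fubini the mean of the kernel estimate is the inversion integral of the density, stopped at
frequency a. -/
theorem integral_mul_kernel_gaussian (a θ x : ℝ) :
    ∫ y, a * kernel (a * (x - y)) ∂(gaussianReal θ 1) =
      (∫ u in (0 : ℝ)..a, Real.cos (u * (x - θ)) * Real.exp (-u ^ 2 / 2)) / π := by
  simp_rw [mul_kernel_mul]
  rw [integral_div, ← intervalIntegral_integral_swap]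
  · simp_rw [integral_cos_sub_gaussian]
  · have : IsFiniteMeasure (volume.restrict (Set.uIoc 0 a)) := ⟨by simp [Set.uIoc]⟩
    exact Integrable.of_bound
      (by fun_prop : Continuous fun p : ℝ × ℝ => Real.cos (p.1 * (x - p.2))).aestronglyMeasurable 1
      (Eventually.of_forall fun p => Real.abs_cos_le_one _)

theorem integral_sq_mul_kernelDeriv_gaussian (a θ x : ℝ) :
    ∫ y, a ^ 2 * kernelDeriv (a * (x - y)) ∂(gaussianReal θ 1) =
      (∫ u in (0 : ℝ)..a, -(u * Real.sin (u * (x - θ)) * Real.exp (-u ^ 2 / 2))) / π := by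
  simp_rw [sq_mul_kernelDeriv_mul]
  rw [integral_div, ← intervalIntegral_integral_swap]
  · simp_rw [integral_const_mul, integral_sin_sub_gaussian]
    congr 2; ext u; ring
  · have : IsFiniteMeasure (volume.restrict (Set.uIoc 0 a)) := ⟨by simp [Set.uIoc]⟩
    refine Integrable.of_bound (C := |a|)
      (by fun_prop : Continuous fun p : ℝ × ℝ =>
        -p.1 * Real.sin (p.1 * (x - p.2))).aestronglyMeasurable ?_
    have hm : ∀ᵐ p ∂((volume.restrict (Set.uIoc 0 a)).prod (gaussianReal θ 1)),
        p.1 ∈ Set.uIoc 0 a :=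
      (Measure.quasiMeasurePreserving_fst).ae (ae_restrict_mem measurableSet_uIoc)
    filter_upwards [hm] with p hp
    have : |p.1| ≤ |a| := by
      rcases Set.mem_uIoc.1 hp with h | h
      · exact abs_le_abs_of_nonneg h.1.le h.2
      · exact abs_le_abs_of_nonpos h.2 h.1.le
    simp only [Function.uncurry]
    rw [norm_mul, norm_neg, Real.norm_eq_abs, Real.norm_eq_abs]
    exact (mul_le_of_le_one_right (abs_nonneg _) (Real.abs_sin_le_one _)).trans this

/-- The bias is the inversion integral beyond a. There `|cos| ≤ 1 ≤ u`, and `u exp (-u²/2)`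
integrates exactly to `exp (-a²/2)`. -/
theorem abs_integral_kernel_sub_npdf_le {a : ℝ} (ha : 1 ≤ a) (θ x : ℝ) :
    |∫ y, a * kernel (a * (x - y)) ∂(gaussianReal θ 1) - npdf θ x| ≤ Real.exp (-a ^ 2 / 2) := by
  have i1 : Integrable fun u : ℝ => Real.cos (u * (x - θ)) * Real.exp (-u ^ 2 / 2) :=
    integrable_bdd_mul integrable_exp_neg_sq_div_two (by fun_prop) fun u => Real.abs_cos_le_one _
  rw [integral_mul_kernel_gaussian, npdf_eq_integral, ← sub_div,
    integral_Ioi_sub_intervalIntegral i1 (by linarith), abs_div, abs_neg, abs_of_pos Real.pi_pos]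
  have h : |∫ u in Set.Ioi a, Real.cos (u * (x - θ)) * Real.exp (-u ^ 2 / 2)| ≤
      Real.exp (-a ^ 2 / 2) := by
    rw [← integral_Ioi_mul_exp_neg_sq a]
    rw [← Real.norm_eq_abs]
    refine norm_integral_le_of_norm_le integrable_mul_exp_neg_sq_div_two.integrableOn
      ((ae_restrict_mem measurableSet_Ioi).mono fun u hu => ?_)
    rw [norm_mul, Real.norm_eq_abs, Real.norm_eq_abs, abs_of_pos (Real.exp_pos _)]
    have : |Real.cos (u * (x - θ))| ≤ u := (Real.abs_cos_le_one _).trans (ha.trans (le_of_lt hu))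
    gcongr
  exact (div_le_self (abs_nonneg _) (by linarith [Real.pi_gt_three])).trans h

theorem abs_integral_kernelDeriv_sub_npdf_le {a : ℝ} (ha : 1 ≤ a) (θ x : ℝ) :
    |∫ y, a ^ 2 * kernelDeriv (a * (x - y)) ∂(gaussianReal θ 1) - (θ - x) * npdf θ x| ≤
      Real.exp (-a ^ 2 / 2) := by
  have i1 : Integrable fun u : ℝ => -(u * Real.sin (u * (x - θ)) * Real.exp (-u ^ 2 / 2)) := by
    have := integrable_bdd_mul integrable_mul_exp_neg_sq_div_two
      (g := fun u => Real.sin (u * (x - θ))) (by fun_prop) fun u => Real.abs_sin_le_one _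
    refine this.neg.congr (Eventually.of_forall fun u => ?_)
    simp only [Pi.neg_apply]; ring
  rw [integral_sq_mul_kernelDeriv_gaussian, mul_npdf_eq_integral, ← sub_div,
    integral_Ioi_sub_intervalIntegral i1 (by linarith), abs_div, abs_neg, abs_of_pos Real.pi_pos]
  have h : |∫ u in Set.Ioi a, -(u * Real.sin (u * (x - θ)) * Real.exp (-u ^ 2 / 2))| ≤
      Real.exp (-a ^ 2 / 2) := by
    rw [← integral_Ioi_mul_exp_neg_sq a]
    rw [← Real.norm_eq_abs]
    refine norm_integral_le_of_norm_le integrable_mul_exp_neg_sq_div_two.integrableOn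
      ((ae_restrict_mem measurableSet_Ioi).mono fun u hu => ?_)
    have hu' : 0 < u := by have := Set.mem_Ioi.1 hu; linarith
    rw [norm_neg, norm_mul, norm_mul, Real.norm_eq_abs, Real.norm_eq_abs, Real.norm_eq_abs,
      abs_of_pos (Real.exp_pos _), abs_of_pos hu']
    gcongr
    exact mul_le_of_le_one_right hu'.le (Real.abs_sin_le_one _)
  exact (div_le_self (abs_nonneg _) (by linarith [Real.pi_gt_three])).trans h

/-! ### Moments of sums of independent bounded variables -/

section Moments

variable {Ω κ : Type*} [MeasurableSpace Ω] {μ : Measure Ω} [IsProbabilityMeasure μ]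
  {ξ : κ → Ω → ℝ}

theorem integrable_of_measurable_bounded {g : Ω → ℝ} (hg : Measurable g) {C : ℝ}
    (h : ∀ ω, |g ω| ≤ C) : Integrable g μ :=
  Integrable.of_bound hg.aestronglyMeasurable C (Eventually.of_forall h)

theorem abs_pow_mul_pow_le {x y A B : ℝ} (hx : |x| ≤ A) (hy : |y| ≤ B) (p q : ℕ) :
    |x ^ p * y ^ q| ≤ A ^ p * B ^ q := by
  rw [abs_mul, abs_pow, abs_pow]
  have := abs_nonneg x
  gcongr
  exact pow_nonneg (this.trans hx) _

/-- Induction on the number of summands. Independence and centring kill the mixed terms with an odd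
power; the surviving `6 E S² E ξ²` is the cross term in the expansion of `3 (V + v)²`, where V and v
are the second moments of S and ξ. -/
theorem moments_sum_of_iIndepFun (hm : ∀ i, Measurable (ξ i)) (hind : iIndepFun ξ μ) {C : ℝ}
    (hb : ∀ i ω, |ξ i ω| ≤ C) (h0 : ∀ i, ∫ ω, ξ i ω ∂μ = 0) (s : Finset κ) :
    ∫ ω, (∑ i ∈ s, ξ i ω) ^ 2 ∂μ = ∑ i ∈ s, ∫ ω, ξ i ω ^ 2 ∂μ ∧
    ∫ ω, (∑ i ∈ s, ξ i ω) ^ 4 ∂μ ≤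
      3 * (∑ i ∈ s, ∫ ω, ξ i ω ^ 2 ∂μ) ^ 2 + ∑ i ∈ s, ∫ ω, ξ i ω ^ 4 ∂μ := by
  classical
  induction s using Finset.induction_on with
  | empty => simp
  | insert i s hi ih =>
    obtain ⟨ih2, ih4⟩ := ih
    set S : Ω → ℝ := fun ω => ∑ i ∈ s, ξ i ω with hS
    have hSm : Measurable S := by fun_prop
    have hSb : ∀ ω, |S ω| ≤ s.card * C := fun ω =>
      (Finset.abs_sum_le_sum_abs _ _).trans (by
        simpa using Finset.sum_le_sum fun i (_ : i ∈ s) => hb i ω)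
    have hI : IndepFun S (ξ i) μ := by
      have := hind.indepFun_finsetSum_of_notMem hm hi
      convert this using 1
      ext ω; simp [hS]
    have hint : ∀ p q : ℕ, Integrable (fun ω => S ω ^ p * ξ i ω ^ q) μ := fun p q =>
      integrable_of_measurable_bounded (by have := hm i; fun_prop) fun ω =>
        abs_pow_mul_pow_le (hSb ω) (hb i ω) p q
    have hmul : ∀ p q : ℕ, ∫ ω, S ω ^ p * ξ i ω ^ q ∂μ =
        (∫ ω, S ω ^ p ∂μ) * ∫ ω, ξ i ω ^ q ∂μ := fun p q => by
      have hI' := hI.comp (φ := fun x => x ^ p) (ψ := fun x => x ^ q)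
        (by fun_prop) (by fun_prop)
      exact hI'.integral_fun_mul_eq_mul_integral
        ((hSm.pow_const p).aestronglyMeasurable) (((hm i).pow_const q).aestronglyMeasurable)
    have hS0 : ∫ ω, S ω ∂μ = 0 := by
      rw [hS, integral_finsetSum _ fun j _ => integrable_of_measurable_bounded (hm j) (hb j)]
      simp [h0]
    have e1 := hmul 1 1
    have e2 := hmul 2 2
    have e3 := hmul 3 1
    have e4 := hmul 1 3
    have i20 := hint 2 0
    have i02 := hint 0 2
    have i40 := hint 4 0
    have i04 := hint 0 4
    simp only [pow_one, pow_zero, mul_one, one_mul, h0, hS0, mul_zero, zero_mul]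
      at e1 e2 e3 e4 i20 i02 i40 i04
    have i11 := hint 1 1
    have i22 := hint 2 2
    have i31 := hint 3 1
    have i13 := hint 1 3
    simp only [pow_one] at i11 i31 i13
    have hsum : ∀ ω, ∑ j ∈ insert i s, ξ j ω = S ω + ξ i ω := fun ω => by
      rw [Finset.sum_insert hi, add_comm]
    simp_rw [hsum, Finset.sum_insert hi]
    constructor
    · have : ∀ ω, (S ω + ξ i ω) ^ 2 = S ω ^ 2 + (ξ i ω ^ 2 + 2 * (S ω * ξ i ω)) :=
        fun ω => by ring
      simp_rw [this]
      have j1 : Integrable (fun ω => ξ i ω ^ 2 + 2 * (S ω * ξ i ω)) μ :=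
        i02.add (i11.const_mul 2)
      rw [integral_add i20 j1, integral_add i02 (i11.const_mul 2),
        integral_const_mul, e1, ih2]
      ring
    · have : ∀ ω, (S ω + ξ i ω) ^ 4 = S ω ^ 4 + (ξ i ω ^ 4 + (6 * (S ω ^ 2 * ξ i ω ^ 2) +
          (4 * (S ω ^ 3 * ξ i ω) + 4 * (S ω * ξ i ω ^ 3)))) := fun ω => by ring
      simp_rw [this]
      have j1 : Integrable (fun ω => 4 * (S ω ^ 3 * ξ i ω) + 4 * (S ω * ξ i ω ^ 3)) μ :=
        (i31.const_mul 4).add (i13.const_mul 4)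
      have j2 : Integrable (fun ω => 6 * (S ω ^ 2 * ξ i ω ^ 2) +
          (4 * (S ω ^ 3 * ξ i ω) + 4 * (S ω * ξ i ω ^ 3))) μ := (i22.const_mul 6).add j1
      have j3 : Integrable (fun ω => ξ i ω ^ 4 + (6 * (S ω ^ 2 * ξ i ω ^ 2) +
          (4 * (S ω ^ 3 * ξ i ω) + 4 * (S ω * ξ i ω ^ 3)))) μ := i04.add j2
      rw [integral_add i40 j3, integral_add i04 j2, integral_add (i22.const_mul 6) j1,
        integral_add (i31.const_mul 4) (i13.const_mul 4), integral_const_mul, integral_const_mul,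
        integral_const_mul, e2, e3, e4, ih2]
      nlinarith [sq_nonneg (∫ ω, ξ i ω ^ 2 ∂μ)]

end Moments

/-! ### The fluctuation of a kernel estimate -/

section Noise

variable {ι : Type*} [Fintype ι]

/-- The joint law of independent `X_i ∼ N(θ_i, 1)`. -/
abbrev gaussProd (θ : ι → ℝ) : Measure (ι → ℝ) := Measure.pi fun i => gaussianReal (θ i) 1

theorem integral_eval_gaussProd (θ : ι → ℝ) (i : ι) {g : ℝ → ℝ} (hg : Measurable g) :
    ∫ X, g (X i) ∂(gaussProd θ) = ∫ y, g y ∂(gaussianReal (θ i) 1) :=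
  integral_comp_eval (μ := fun i => gaussianReal (θ i) 1) hg.aestronglyMeasurable

theorem lintegral_eval_gaussProd (θ : ι → ℝ) (i : ι) {g : ℝ → ℝ≥0∞} (hg : Measurable g) :
    ∫⁻ X, g (X i) ∂(gaussProd θ) = ∫⁻ y, g y ∂(gaussianReal (θ i) 1) :=
  (measurePreserving_eval (fun i => gaussianReal (θ i) 1) i).lintegral_comp hg

/-- The mean of the kernel estimate with kernel `F`. -/
def kernelMean (F : ℝ → ℝ) (a θ x : ℝ) : ℝ :=
  ∫ y, a * F (a * (x - y)) ∂(gaussianReal θ 1)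

/-- The centred kernel estimate with kernel `F`. -/
def noise (F : ℝ → ℝ) (a : ℝ) (θ : ι → ℝ) (x : ℝ) (X : ι → ℝ) : ℝ :=
  (1 / (Fintype.card ι : ℝ)) * ∑ i, (a * F (a * (x - X i)) - kernelMean F a (θ i) x)

/-- A bound for the variance of `noise F a θ x`. -/
def noiseVar (a : ℝ) (θ : ι → ℝ) (x : ℝ) : ℝ :=
  (1 / (Fintype.card ι : ℝ) ^ 2) *
    ∑ i, ∫ y, a ^ 2 * cauchyWeight (a * (x - y)) ∂(gaussianReal (θ i) 1)

variable {F : ℝ → ℝ} (hF : Continuous F) (hF1 : ∀ x, |F x| ≤ 1)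
  (hFw : ∀ x, F x ^ 2 ≤ cauchyWeight x) {a : ℝ} (ha : 0 < a) (θ : ι → ℝ) (x : ℝ)

include hF in
theorem measurable_noise : Measurable (noise F a θ x) := by
  unfold noise
  have : Measurable F := hF.measurable
  fun_prop

include hF1 ha in
theorem abs_kernel_term_le (y : ℝ) : |a * F (a * (x - y))| ≤ a := by
  rw [abs_mul, abs_of_pos ha]
  exact mul_le_of_le_one_right ha.le (hF1 _)

include hF1 ha in
theorem abs_kernelMean_le (t : ℝ) : |kernelMean F a t x| ≤ a := by
  have := norm_integral_le_of_norm_le_const (μ := gaussianReal t 1) (C := a)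
    (f := fun y => a * F (a * (x - y)))
    (Eventually.of_forall fun y => abs_kernel_term_le hF1 ha x y)
  simpa [kernelMean] using this

include hF1 ha in
theorem abs_noise_term_le (t y : ℝ) : |a * F (a * (x - y)) - kernelMean F a t x| ≤ 2 * a := by
  have h1 := abs_kernel_term_le hF1 ha x y
  have h2 := abs_kernelMean_le hF1 ha x t
  have := abs_sub (a * F (a * (x - y))) (kernelMean F a t x)
  linarith

theorem noiseVar_nonneg (a : ℝ) (x : ℝ) : 0 ≤ noiseVar a θ x :=
  mul_nonneg (by positivity) (Finset.sum_nonneg fun _ _ => integral_nonneg fun _ =>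
    mul_nonneg (sq_nonneg _) (cauchyWeight_nonneg _))

theorem integrable_weight (a x t : ℝ) :
    Integrable (fun y => a ^ 2 * cauchyWeight (a * (x - y))) (gaussianReal t 1) :=
  (integrable_of_bounded (C := 1) (by have := continuous_cauchyWeight; fun_prop) fun y => by
    rw [abs_of_nonneg (cauchyWeight_nonneg _)]; exact cauchyWeight_le_one _).const_mul _

include hF hF1 hFw ha in
theorem integral_noise_term_sq_le (t : ℝ) :
    ∫ y, (a * F (a * (x - y)) - kernelMean F a t x) ^ 2 ∂(gaussianReal t 1) ≤
      ∫ y, a ^ 2 * cauchyWeight (a * (x - y)) ∂(gaussianReal t 1) := by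
  have i1 : Integrable (fun y => a * F (a * (x - y))) (gaussianReal t 1) :=
    integrable_of_bounded (by fun_prop) (abs_kernel_term_le hF1 ha x)
  have i2 : Integrable (fun y => (a * F (a * (x - y))) ^ 2) (gaussianReal t 1) :=
    integrable_of_bounded (C := a ^ 2) (by fun_prop) fun y => by
      rw [abs_pow]
      have := abs_kernel_term_le hF1 ha x y
      gcongr
  have e : ∀ y, (a * F (a * (x - y)) - kernelMean F a t x) ^ 2 =
      ((a * F (a * (x - y))) ^ 2 - 2 * kernelMean F a t x * (a * F (a * (x - y)))) +
        kernelMean F a t x ^ 2 := fun y => by ring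
  simp_rw [e]
  have i3 : Integrable (fun y => (a * F (a * (x - y))) ^ 2 -
      2 * kernelMean F a t x * (a * F (a * (x - y)))) (gaussianReal t 1) :=
    i2.sub (i1.const_mul _)
  rw [integral_add i3 (integrable_const _),
    integral_sub i2 (i1.const_mul _), integral_const_mul]
  have hmean : ∫ y, a * F (a * (x - y)) ∂(gaussianReal t 1) = kernelMean F a t x := rfl
  rw [hmean]
  have hle : ∫ y, (a * F (a * (x - y))) ^ 2 ∂(gaussianReal t 1) ≤
      ∫ y, a ^ 2 * cauchyWeight (a * (x - y)) ∂(gaussianReal t 1) := by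
    refine integral_mono i2 (integrable_weight _ _ _) fun y => ?_
    simp only [mul_pow]
    exact mul_le_mul_of_nonneg_left (hFw _) (sq_nonneg _)
  simp only [integral_const, probReal_univ, smul_eq_mul, one_mul]
  nlinarith [sq_nonneg (kernelMean F a t x)]

include hF hF1 hFw ha in
-- Centred terms are bounded by 2a, so their fourth moments are at most `4 a²` times their second
-- moments. The weight `cauchyWeight` lets one variance bound serve both `kernel` and `kernelDeriv`.
theorem noise_moments [Nonempty ι] :
    ∫ X, noise F a θ x X ^ 2 ∂(gaussProd θ) ≤ noiseVar a θ x ∧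
    ∫ X, noise F a θ x X ^ 4 ∂(gaussProd θ) ≤
      3 * noiseVar a θ x ^ 2 + 4 * a ^ 2 / (Fintype.card ι : ℝ) ^ 2 * noiseVar a θ x := by
  set n : ℝ := (Fintype.card ι : ℝ) with hn
  have hn0 : 0 < n := by rw [hn]; exact_mod_cast Fintype.card_pos
  set g : ι → ℝ → ℝ := fun i y => a * F (a * (x - y)) - kernelMean F a (θ i) x with hg
  have hgm : ∀ i, Measurable (g i) := fun i => by
    have := hF.measurable
    simp only [hg]; fun_prop
  have hind : iIndepFun (fun i (X : ι → ℝ) => g i (X i)) (gaussProd θ) :=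
    iIndepFun_pi fun i => (hgm i).aemeasurable
  have hgb : ∀ i y, |g i y| ≤ 2 * a := fun i y => abs_noise_term_le hF1 ha x (θ i) y
  have h0 : ∀ i, ∫ X, g i (X i) ∂(gaussProd θ) = 0 := fun i => by
    rw [integral_eval_gaussProd θ i (hgm i)]
    simp only [hg]
    rw [integral_sub (integrable_of_bounded (by fun_prop) (abs_kernel_term_le hF1 ha x))
      (integrable_const _)]
    simp [kernelMean]
  obtain ⟨m2, m4⟩ := moments_sum_of_iIndepFun (fun i => (hgm i).comp (measurable_pi_apply i)) hind
    (fun i X => hgb i (X i)) h0 Finset.univ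
  simp only [Function.comp_apply] at m2 m4
  have s2 : ∀ i, ∫ X, g i (X i) ^ 2 ∂(gaussProd θ) ≤
      ∫ y, a ^ 2 * cauchyWeight (a * (x - y)) ∂(gaussianReal (θ i) 1) := fun i => by
    rw [integral_eval_gaussProd θ i ((hgm i).pow_const 2)]
    exact integral_noise_term_sq_le hF hF1 hFw ha x (θ i)
  have s4 : ∀ i, ∫ X, g i (X i) ^ 4 ∂(gaussProd θ) ≤
      4 * a ^ 2 * ∫ y, a ^ 2 * cauchyWeight (a * (x - y)) ∂(gaussianReal (θ i) 1) := fun i => by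
    refine le_trans ?_ (mul_le_mul_of_nonneg_left (s2 i) (by positivity))
    rw [← integral_const_mul]
    refine integral_mono ?_ ?_ fun X => ?_
    · exact integrable_of_measurable_bounded (C := (2 * a) ^ 4)
        (by have := hgm i; fun_prop) fun X => by
          rw [abs_pow]; exact pow_le_pow_left₀ (abs_nonneg _) (hgb i _) 4
    · exact (integrable_of_measurable_bounded (C := (2 * a) ^ 2)
        (by have := hgm i; fun_prop) fun X => by
          rw [abs_pow]; exact pow_le_pow_left₀ (abs_nonneg _) (hgb i _) 2).const_mul _
    · have h1 : g i (X i) ^ 2 ≤ (2 * a) ^ 2 := by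
        rw [← sq_abs]; exact pow_le_pow_left₀ (abs_nonneg _) (hgb i _) 2
      simp only []
      nlinarith [sq_nonneg (g i (X i))]
  set W := ∑ i, ∫ y, a ^ 2 * cauchyWeight (a * (x - y)) ∂(gaussianReal (θ i) 1) with hW
  have hV : noiseVar a θ x = 1 / n ^ 2 * W := rfl
  have t2 : ∑ i, ∫ X, g i (X i) ^ 2 ∂(gaussProd θ) ≤ W := Finset.sum_le_sum fun i _ => s2 i
  have t4 : ∑ i, ∫ X, g i (X i) ^ 4 ∂(gaussProd θ) ≤ 4 * a ^ 2 * W := by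
    rw [hW, Finset.mul_sum]; exact Finset.sum_le_sum fun i _ => s4 i
  have t0 : 0 ≤ ∑ i, ∫ X, g i (X i) ^ 2 ∂(gaussProd θ) :=
    Finset.sum_nonneg fun i _ => integral_nonneg fun X => sq_nonneg _
  have hN : ∀ X, noise F a θ x X = 1 / n * ∑ i, g i (X i) := fun X => rfl
  constructor
  · simp_rw [hN, mul_pow]
    rw [integral_const_mul, m2, hV, one_div_pow]
    gcongr
  · simp_rw [hN, mul_pow]
    rw [integral_const_mul, hV]
    have : 3 * (1 / n ^ 2 * W) ^ 2 + 4 * a ^ 2 / n ^ 2 * (1 / n ^ 2 * W) =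
        (1 / n) ^ 4 * (3 * W ^ 2 + 4 * a ^ 2 * W) := by field_simp
    rw [this]
    refine mul_le_mul_of_nonneg_left ?_ (by positivity)
    have := pow_le_pow_left₀ t0 t2 2
    linarith

/-- The normal density is at most 1, so the Gaussian average is dominated by the Lebesgue integral,
which is π a. -/
theorem lintegral_weight_le (t : ℝ) (ha : 0 < a) :
    ∫ y, a ^ 2 * cauchyWeight (a * (x - y)) ∂(gaussianReal t 1) ≤ π * a := by
  have h := lintegral_cauchyWeight_comp ha x
  rw [← ENNReal.ofReal_le_ofReal_iff (by positivity), ofReal_integral_eq_lintegral_ofReal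
    (integrable_weight _ _ _) (Eventually.of_forall fun y =>
      mul_nonneg (sq_nonneg _) (cauchyWeight_nonneg _)), lintegral_gaussian]
  calc _ ≤ ∫⁻ y, ENNReal.ofReal a * ENNReal.ofReal (a * cauchyWeight (a * (y - x))) := by
        refine lintegral_mono fun y => ?_
        have e : cauchyWeight (a * (x - y)) = cauchyWeight (a * (y - x)) := by
          unfold cauchyWeight; congr 2; ring
        simp only []
        rw [← ENNReal.ofReal_mul (npdf_pos _ _).le, ← ENNReal.ofReal_mul ha.le, e]
        refine ENNReal.ofReal_le_ofReal ?_
        have h1 := cauchyWeight_nonneg (a * (y - x))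
        have h2 := npdf_le_one t y
        have : 0 ≤ a ^ 2 * cauchyWeight (a * (y - x)) := by positivity
        nlinarith
    _ = _ := by
        rw [lintegral_const_mul', h, ← ENNReal.ofReal_mul ha.le, mul_comm]
        exact ENNReal.ofReal_ne_top

include ha in
theorem noiseVar_le [Nonempty ι] : noiseVar a θ x ≤ π * a / Fintype.card ι := by
  have hn0 : (0 : ℝ) < Fintype.card ι := by exact_mod_cast Fintype.card_pos
  have : ∑ i, ∫ y, a ^ 2 * cauchyWeight (a * (x - y)) ∂(gaussianReal (θ i) 1) ≤
      Fintype.card ι * (π * a) := by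
    have := Finset.sum_le_sum fun i (_ : i ∈ Finset.univ) => lintegral_weight_le x (θ i) ha
    simpa using this
  calc noiseVar a θ x ≤ 1 / (Fintype.card ι : ℝ) ^ 2 * (Fintype.card ι * (π * a)) := by
        unfold noiseVar; gcongr
    _ = _ := by field_simp

theorem ofReal_noiseVar : ENNReal.ofReal (noiseVar a θ x) =
    ENNReal.ofReal (1 / (Fintype.card ι : ℝ) ^ 2) * ∑ i,
      ∫⁻ y, ENNReal.ofReal (a ^ 2 * cauchyWeight (a * (x - y))) ∂(gaussianReal (θ i) 1) := by
  unfold noiseVar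
  rw [ENNReal.ofReal_mul (by positivity), ENNReal.ofReal_sum_of_nonneg]
  · congr 1
    refine Finset.sum_congr rfl fun i _ => ?_
    rw [ofReal_integral_eq_lintegral_ofReal (integrable_weight _ _ _)
      (Eventually.of_forall fun y => mul_nonneg (sq_nonneg _) (cauchyWeight_nonneg _))]
  · exact fun i _ => integral_nonneg fun y => mul_nonneg (sq_nonneg _) (cauchyWeight_nonneg _)

theorem measurable_weight_integrand :
    Measurable fun p : ℝ × ℝ => ENNReal.ofReal (a ^ 2 * cauchyWeight (a * (p.1 - p.2))) := by
  have := continuous_cauchyWeight.measurable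
  fun_prop

include ha in
-- By Tonelli the variance bound has a finite total over the whole line. Hence the integrated
-- squared error needs no truncation in x.
theorem lintegral_noiseVar [Nonempty ι] :
    ∫⁻ x, ENNReal.ofReal (noiseVar a θ x) = ENNReal.ofReal (π * a / Fintype.card ι) := by
  have hn0 : (0 : ℝ) < Fintype.card ι := by exact_mod_cast Fintype.card_pos
  simp_rw [ofReal_noiseVar]
  rw [lintegral_const_mul' _ _ ENNReal.ofReal_ne_top, lintegral_finsetSum]
  · have : ∀ i : ι, ∫⁻ x, ∫⁻ y, ENNReal.ofReal (a ^ 2 * cauchyWeight (a * (x - y)))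
        ∂(gaussianReal (θ i) 1) = ENNReal.ofReal (π * a) := fun i => by
      rw [lintegral_lintegral_swap measurable_weight_integrand.aemeasurable]
      have e : ∀ y x : ℝ, ENNReal.ofReal (a ^ 2 * cauchyWeight (a * (x - y))) =
          ENNReal.ofReal a * ENNReal.ofReal (a * cauchyWeight (a * (x - y))) := fun y x => by
        rw [← ENNReal.ofReal_mul ha.le]; congr 1; ring
      simp_rw [e]
      have e2 : ∀ y : ℝ, ∫⁻ x, ENNReal.ofReal a * ENNReal.ofReal (a * cauchyWeight (a * (x - y))) =
          ENNReal.ofReal (π * a) := fun y => by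
        rw [lintegral_const_mul' _ _ ENNReal.ofReal_ne_top, lintegral_cauchyWeight_comp ha y,
          ← ENNReal.ofReal_mul ha.le, mul_comm]
      simp [e2]
    simp_rw [this]
    rw [Finset.sum_const, nsmul_eq_mul, Finset.card_univ, ← ENNReal.ofReal_natCast,
      ← ENNReal.ofReal_mul (by positivity), ← ENNReal.ofReal_mul (by positivity)]
    congr 1
    field_simp
  · intro i _
    exact measurable_weight_integrand.lintegral_prod_right'

end Noise

/-! ### The mixture density -/

section Mixture

variable {ι : Type*} [Fintype ι]

/-- The mixture density `n⁻¹ ∑ N(θ_i, 1)`. -/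
def mix (θ : ι → ℝ) (x : ℝ) : ℝ := (1 / (Fintype.card ι : ℝ)) * ∑ i, npdf (θ i) x

/-- The derivative of the mixture density. -/
def mixD (θ : ι → ℝ) (x : ℝ) : ℝ := (1 / (Fintype.card ι : ℝ)) * ∑ i, (θ i - x) * npdf (θ i) x

/-- The regularised score. -/
def regScore (ρ : ℝ) (θ : ι → ℝ) (x : ℝ) : ℝ := mixD θ x / max ρ (mix θ x)

/-- The part of the Fisher information of the mixture from the region where its density is
below `ρ`. -/
def regBias (ρ : ℝ) (θ : ι → ℝ) : ℝ≥0∞ :=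
  ∫⁻ x, if mix θ x < ρ then ENNReal.ofReal (mixD θ x ^ 2 / mix θ x) else 0

variable (θ : ι → ℝ) (x : ℝ)

theorem continuous_mix : Continuous (mix θ) := by
  unfold mix npdf; fun_prop

theorem continuous_mixD : Continuous (mixD θ) := by
  unfold mixD npdf; fun_prop

theorem mix_nonneg : 0 ≤ mix θ x :=
  mul_nonneg (by positivity) (Finset.sum_nonneg fun _ _ => (npdf_pos _ _).le)

variable [Nonempty ι]

theorem card_pos_real : (0 : ℝ) < Fintype.card ι := by exact_mod_cast Fintype.card_pos

theorem mix_pos : 0 < mix θ x :=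
  mul_pos (one_div_pos.2 card_pos_real)
    (Finset.sum_pos (fun _ _ => npdf_pos _ _) Finset.univ_nonempty)

theorem avg_le_of_le {g : ι → ℝ} {C : ℝ} (h : ∀ i, g i ≤ C) :
    (1 / (Fintype.card ι : ℝ)) * ∑ i, g i ≤ C := by
  have hn := card_pos_real (ι := ι)
  have := Finset.sum_le_sum fun i (_ : i ∈ Finset.univ) => h i
  rw [one_div, inv_mul_le_iff₀ hn]
  simpa using this

theorem le_avg_of_le {g : ι → ℝ} {C : ℝ} (h : ∀ i, C ≤ g i) :
    C ≤ (1 / (Fintype.card ι : ℝ)) * ∑ i, g i := by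
  have hn := card_pos_real (ι := ι)
  have := Finset.sum_le_sum fun i (_ : i ∈ Finset.univ) => h i
  rw [one_div, le_inv_mul_iff₀ hn]
  simpa using this

theorem abs_avg_le_of_le {g : ι → ℝ} {C : ℝ} (h : ∀ i, |g i| ≤ C) :
    |(1 / (Fintype.card ι : ℝ)) * ∑ i, g i| ≤ C :=
  abs_le.2 ⟨le_avg_of_le fun i => (abs_le.1 (h i)).1, avg_le_of_le fun i => (abs_le.1 (h i)).2⟩

theorem card_mul_mix : (Fintype.card ι : ℝ) * mix θ x = ∑ i, npdf (θ i) x := by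
  have hn := card_pos_real (ι := ι)
  unfold mix; field_simp

theorem card_mul_mixD : (Fintype.card ι : ℝ) * mixD θ x = ∑ i, (θ i - x) * npdf (θ i) x := by
  have hn := card_pos_real (ι := ι)
  unfold mixD; field_simp

theorem ofReal_mix_mul (c : ℝ≥0∞) : (Fintype.card ι : ℝ≥0∞) * (ENNReal.ofReal (mix θ x) * c) =
    ∑ i, ENNReal.ofReal (npdf (θ i) x) * c := by
  rw [← Finset.sum_mul, ← ENNReal.ofReal_sum_of_nonneg fun _ _ => (npdf_pos _ _).le,
    ← card_mul_mix, ENNReal.ofReal_mul card_pos_real.le, ENNReal.ofReal_natCast, mul_assoc]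

theorem sum_lintegral_gaussian {F : ℝ → ℝ≥0∞} (hF : Measurable F) :
    ∑ i, ∫⁻ x, F x ∂(gaussianReal (θ i) 1) =
      (Fintype.card ι : ℝ≥0∞) * ∫⁻ x, ENNReal.ofReal (mix θ x) * F x := by
  simp_rw [lintegral_gaussian]
  rw [← lintegral_finsetSum, ← lintegral_const_mul']
  · simp_rw [ofReal_mix_mul]
  · exact ENNReal.natCast_ne_top _
  · intro i _
    have := (continuous_npdf (θ i)).measurable
    fun_prop

theorem lintegral_mix : ∫⁻ x, ENNReal.ofReal (mix θ x) = 1 := by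
  have h := sum_lintegral_gaussian θ (F := fun _ => 1) measurable_const
  simp only [lintegral_const, measure_univ, mul_one, Finset.sum_const, Finset.card_univ,
    nsmul_eq_mul] at h
  have hn : (Fintype.card ι : ℝ≥0∞) ≠ 0 := by simp
  exact ((ENNReal.mul_right_inj hn (ENNReal.natCast_ne_top _)).1 (by rw [← h, mul_one]))

theorem mixD_sq_le :
    mixD θ x ^ 2 ≤ mix θ x * ((1 / (Fintype.card ι : ℝ)) * ∑ i, (x - θ i) ^ 2 * npdf (θ i) x) := by
  have h := Finset.sum_sq_le_sum_mul_sum_of_sq_le_mul Finset.univ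
    (r := fun i => (θ i - x) * npdf (θ i) x) (f := fun i => npdf (θ i) x)
    (g := fun i => (x - θ i) ^ 2 * npdf (θ i) x) (fun i _ => (npdf_pos _ _).le)
    (fun i _ => mul_nonneg (sq_nonneg _) (npdf_pos _ _).le) (fun i _ => le_of_eq (by ring))
  unfold mixD mix
  calc _ = (1 / (Fintype.card ι : ℝ)) ^ 2 * (∑ i, (θ i - x) * npdf (θ i) x) ^ 2 := by ring
    _ ≤ (1 / (Fintype.card ι : ℝ)) ^ 2 * ((∑ i, npdf (θ i) x) *
        ∑ i, (x - θ i) ^ 2 * npdf (θ i) x) := by gcongr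
    _ = _ := by ring

/-- The exponent of the density is its logarithm up to `-log √(2π)`, a constant of favourable sign.
The right side is concave in the density, ready for Jensen. -/
theorem sq_mul_npdf_le (t : ℝ) : (x - t) ^ 2 * npdf t x ≤ 2 * Real.negMulLog (npdf t x) := by
  have h : Real.log (npdf t x) = -Real.log √(2 * π) + -(x - t) ^ 2 / 2 := by
    have := one_le_sqrt_two_pi
    rw [npdf, Real.log_mul (by positivity) (Real.exp_pos _).ne', Real.log_exp, Real.log_inv]
  have h0 := Real.log_nonneg one_le_sqrt_two_pi
  have hp := npdf_pos t x
  rw [Real.negMulLog, h]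
  nlinarith [mul_nonneg hp.le h0]

/-- Cauchy-Schwarz over the components, then the entropy bound for each component, then concavity of
`-t log t`. The result reads `f'² ≤ 2 f² log(1/f)`: the score is controlled by the size of the
density alone, whatever the means. -/
theorem mixD_sq_le_log : mixD θ x ^ 2 ≤ mix θ x * (2 * Real.negMulLog (mix θ x)) := by
  have hn := card_pos_real (ι := ι)
  refine (mixD_sq_le θ x).trans (mul_le_mul_of_nonneg_left ?_ (mix_nonneg θ x))
  calc _ ≤ (1 / (Fintype.card ι : ℝ)) * ∑ i, 2 * Real.negMulLog (npdf (θ i) x) := by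
        exact mul_le_mul_of_nonneg_left (Finset.sum_le_sum fun i _ => sq_mul_npdf_le _ _)
          (by positivity)
    _ = 2 * ∑ i, (1 / (Fintype.card ι : ℝ)) • Real.negMulLog (npdf (θ i) x) := by
        simp_rw [smul_eq_mul]
        rw [← Finset.mul_sum, ← Finset.mul_sum]; ring
    _ ≤ 2 * Real.negMulLog (∑ i, (1 / (Fintype.card ι : ℝ)) • npdf (θ i) x) := by
        gcongr
        refine Real.concaveOn_negMulLog.le_map_sum (fun _ _ => by positivity) ?_
          fun i _ => (npdf_pos _ _).le
        simp
    _ = _ := by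
        simp_rw [smul_eq_mul]
        rw [← Finset.mul_sum]; rfl

/-- From `log(ρ/f) ≤ ρ/f - 1` one gets `f log(1/f) ≤ f log(1/ρ) + ρ - f`, and f < ρ finishes. -/
theorem mixD_sq_div_le_of_lt {ρ : ℝ} (h : mix θ x < ρ) (h1 : ρ ≤ 1) :
    mixD θ x ^ 2 / mix θ x ≤ 2 * ρ * (Real.log (1 / ρ) + 1) := by
  have hf := mix_pos θ x
  have hρ : 0 < ρ := hf.trans h
  rw [div_le_iff₀ hf]
  refine (mixD_sq_le_log θ x).trans ?_
  rw [mul_comm (mix θ x)]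
  refine mul_le_mul_of_nonneg_right ?_ hf.le
  rw [Real.negMulLog, one_div, Real.log_inv]
  have h2 : Real.log ρ - Real.log (mix θ x) ≤ ρ / mix θ x - 1 := by
    rw [← Real.log_div hρ.ne' hf.ne']
    exact Real.log_le_sub_one_of_pos (by positivity)
  have h3 : mix θ x * (ρ / mix θ x - 1) = ρ - mix θ x := by field_simp
  have h4 := Real.log_nonpos hρ.le h1
  nlinarith [mul_le_mul_of_nonneg_left h2 hf.le]

theorem regScore_sq_le {ρ : ℝ} (hρ : 0 < ρ) (h1 : ρ ≤ 1) :
    regScore ρ θ x ^ 2 ≤ 2 * (Real.log (1 / ρ) + 1) := by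
  have hf := mix_pos θ x
  have h4 := Real.log_nonpos hρ.le h1
  rw [regScore, div_pow, div_le_iff₀ (by positivity)]
  rcases le_or_gt ρ (mix θ x) with h | h
  · rw [max_eq_right h]
    refine (mixD_sq_le_log θ x).trans ?_
    have h2 := Real.log_le_log hρ h
    rw [Real.negMulLog, one_div, Real.log_inv]
    nlinarith [mul_pos hf hf]
  · rw [max_eq_left h.le]
    have := mixD_sq_div_le_of_lt θ x h h1
    rw [div_le_iff₀ hf] at this
    rw [one_div, Real.log_inv] at *
    nlinarith [mul_nonneg hρ.le (sub_nonneg.2 h4)]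

/-- Pythagoras at a fixed x for the weights `npdf (θ i) x`, whose barycentre is `x + f'/f`
(Tweedie's formula). Any competing value h is at best the barycentre, so its own excess can be
dropped. -/
theorem sum_sq_sub_mul_npdf_le (t h : ℝ) :
    ∑ i, (t - θ i) ^ 2 * npdf (θ i) x ≤
      Fintype.card ι * ((t - (x + mixD θ x / mix θ x)) ^ 2 * mix θ x) +
        ∑ i, (h - θ i) ^ 2 * npdf (θ i) x := by
  have hf := mix_pos θ x
  set m := x + mixD θ x / mix θ x with hm
  have key : ∀ s : ℝ, ∑ i, (s - θ i) ^ 2 * npdf (θ i) x =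
      Fintype.card ι * ((s - m) ^ 2 * mix θ x) + ∑ i, (m - θ i) ^ 2 * npdf (θ i) x := fun s => by
    have e : ∀ i, (s - θ i) ^ 2 * npdf (θ i) x = (s - m) ^ 2 * npdf (θ i) x +
        (m - θ i) ^ 2 * npdf (θ i) x + 2 * (s - m) * ((m - x) * npdf (θ i) x) -
        2 * (s - m) * ((θ i - x) * npdf (θ i) x) := fun i => by ring
    simp_rw [e]
    rw [Finset.sum_sub_distrib, Finset.sum_add_distrib, Finset.sum_add_distrib, ← Finset.mul_sum,
      ← Finset.mul_sum, ← Finset.mul_sum, ← Finset.mul_sum, ← card_mul_mix, ← card_mul_mixD]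
    have : (m - x) * mix θ x = mixD θ x := by rw [hm]; field_simp; ring
    rw [mul_left_comm (m - x), this]
    ring
  rw [key t, key h]
  have hn := card_pos_real (ι := ι)
  have : 0 ≤ (Fintype.card ι : ℝ) * ((h - m) ^ 2 * mix θ x) := by positivity
  linarith

/-- Where f ≥ ρ the two scores agree; where f < ρ they differ by `f'/f` times `1 - f/ρ`, a factor in
[0, 1]. -/
theorem sq_sub_score_mul_mix_le {ρ : ℝ} (hρ : 0 < ρ) (g : ℝ) :
    (g - mixD θ x / mix θ x) ^ 2 * mix θ x ≤
      2 * ((g - regScore ρ θ x) ^ 2 * mix θ x) +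
        2 * (if mix θ x < ρ then mixD θ x ^ 2 / mix θ x else 0) := by
  have hf := mix_pos θ x
  have h1 : (g - mixD θ x / mix θ x) ^ 2 * mix θ x ≤ 2 * ((g - regScore ρ θ x) ^ 2 * mix θ x) +
      2 * ((regScore ρ θ x - mixD θ x / mix θ x) ^ 2 * mix θ x) := by
    nlinarith [sq_nonneg ((g - regScore ρ θ x) - (regScore ρ θ x - mixD θ x / mix θ x))]
  refine h1.trans (add_le_add_right (mul_le_mul_of_nonneg_left ?_ zero_le_two) _)
  split_ifs with h
  · rw [regScore, max_eq_left h.le]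
    have e : mixD θ x / ρ - mixD θ x / mix θ x = -(mixD θ x / mix θ x) * (1 - mix θ x / ρ) := by
      field_simp; ring
    have h2 : 0 ≤ mix θ x / ρ := by positivity
    have h3 : mix θ x / ρ ≤ 1 := (div_le_one hρ).2 h.le
    have e2 : mixD θ x ^ 2 / mix θ x = (mixD θ x / mix θ x) ^ 2 * mix θ x := by field_simp
    rw [e, e2, mul_pow, neg_sq]
    gcongr
    refine mul_le_of_le_one_right (sq_nonneg _) ?_
    exact pow_le_one₀ (by linarith) (by linarith)
  · rw [regScore, max_eq_right (not_lt.1 h)]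
    simp

/-- For any rule `x + g x`, the conditional risk is at most that of any separable rule plus
the squared distance to the regularised score and the regularisation bias. -/
theorem sum_lintegral_rule_le {ρ : ℝ} (hρ : 0 < ρ) {g h : ℝ → ℝ} (hg : Measurable g)
    (hh : Measurable h) :
    ∑ i, ∫⁻ x, ENNReal.ofReal ((x + g x - θ i) ^ 2) ∂(gaussianReal (θ i) 1) ≤
      ∑ i, ∫⁻ x, ENNReal.ofReal ((h x - θ i) ^ 2) ∂(gaussianReal (θ i) 1) +
        Fintype.card ι * (2 * (∫⁻ x, ENNReal.ofReal ((g x - regScore ρ θ x) ^ 2 * mix θ x)) +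
          2 * regBias ρ θ) := by
  have m0 := fun i => (continuous_npdf (θ i)).measurable
  have m1 := (continuous_mix θ).measurable
  have m2 := (continuous_mixD θ).measurable
  have m3 : Measurable (regScore ρ θ) := by unfold regScore; fun_prop
  have m4 : MeasurableSet {x | mix θ x < ρ} := measurableSet_lt m1 measurable_const
  have m5 : Measurable fun x => if mix θ x < ρ then ENNReal.ofReal (mixD θ x ^ 2 / mix θ x) else 0 :=
    Measurable.ite m4 (by fun_prop) measurable_const
  simp_rw [lintegral_gaussian]
  unfold regBias
  -- Everything becomes one integral over x, so that the comparison can be made pointwise.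
  rw [← lintegral_finsetSum _ fun i _ => by have := m0 i; fun_prop,
    ← lintegral_finsetSum _ fun i _ => by have := m0 i; fun_prop,
    ← lintegral_const_mul' _ _ ENNReal.ofNat_ne_top, ← lintegral_const_mul' _ _ ENNReal.ofNat_ne_top,
    ← lintegral_add_left (by fun_prop), ← lintegral_const_mul' _ _ (ENNReal.natCast_ne_top _),
    ← lintegral_add_left (Finset.measurable_fun_sum _ fun i _ => by have := m0 i; fun_prop)]
  refine lintegral_mono fun x => ?_
  simp only []
  have hf := mix_pos θ x
  have e : ∀ t : ℝ, ∑ i, ENNReal.ofReal (npdf (θ i) x) * ENNReal.ofReal ((t - θ i) ^ 2) =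
      ENNReal.ofReal (∑ i, (t - θ i) ^ 2 * npdf (θ i) x) := fun t => by
    rw [ENNReal.ofReal_sum_of_nonneg fun i _ => mul_nonneg (sq_nonneg _) (npdf_pos _ _).le]
    refine Finset.sum_congr rfl fun i _ => ?_
    rw [← ENNReal.ofReal_mul (npdf_pos _ _).le, mul_comm]
  have e3 : (if mix θ x < ρ then ENNReal.ofReal (mixD θ x ^ 2 / mix θ x) else 0) =
      ENNReal.ofReal (if mix θ x < ρ then mixD θ x ^ 2 / mix θ x else 0) := by
    split_ifs <;> simp
  have p3 : 0 ≤ (if mix θ x < ρ then mixD θ x ^ 2 / mix θ x else 0) := by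
    split_ifs <;> positivity
  have e4 : (2 : ℝ≥0∞) = ENNReal.ofReal 2 := by simp
  rw [e, e, e3, e4, ← ENNReal.ofReal_natCast, ← ENNReal.ofReal_mul zero_le_two,
    ← ENNReal.ofReal_mul zero_le_two, ← ENNReal.ofReal_add (by positivity) (by positivity),
    ← ENNReal.ofReal_mul (by positivity), ← ENNReal.ofReal_add
      (Finset.sum_nonneg fun i _ => mul_nonneg (sq_nonneg _) (npdf_pos _ _).le) (by positivity)]
  refine ENNReal.ofReal_le_ofReal ?_
  refine (sum_sq_sub_mul_npdf_le θ x (x + g x) (h x)).trans ?_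
  rw [add_sub_add_left_eq_sub, add_comm]
  gcongr
  exact sq_sub_score_mul_mix_le θ x hρ (g x)

end Mixture

/-! ### The estimated score -/

section Score

variable {ι : Type*} [Fintype ι]

/-- The kernel density estimate with inverse bandwidth `a`. -/
def kde (a : ℝ) (X : ι → ℝ) (x : ℝ) : ℝ :=
  (1 / (Fintype.card ι : ℝ)) * ∑ i, a * kernel (a * (x - X i))

/-- The derivative of `kde`. -/
def kdeD (a : ℝ) (X : ι → ℝ) (x : ℝ) : ℝ :=
  (1 / (Fintype.card ι : ℝ)) * ∑ i, a ^ 2 * kernelDeriv (a * (x - X i))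

/-- The regularised estimate of the score. -/
def score (ρ a : ℝ) (X : ι → ℝ) (x : ℝ) : ℝ := kdeD a X x / max ρ (kde a X x)

theorem hasDerivAt_kde (a : ℝ) (X : ι → ℝ) (x : ℝ) : HasDerivAt (kde a X) (kdeD a X x) x := by
  unfold kde kdeD
  refine HasDerivAt.const_mul _ (HasDerivAt.fun_sum fun i _ => ?_)
  have := ((hasDerivAt_kernel (a * (x - X i))).comp x
    (((hasDerivAt_id x).sub_const (X i)).const_mul a)).const_mul a
  exact this.congr_deriv (by ring)

theorem measurable_kde_uncurry (a : ℝ) :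
    Measurable fun p : (ι → ℝ) × ℝ => kde a p.1 p.2 := by
  unfold kde
  have := continuous_kernel.measurable
  fun_prop

theorem measurable_kdeD_uncurry (a : ℝ) :
    Measurable fun p : (ι → ℝ) × ℝ => kdeD a p.1 p.2 := by
  unfold kdeD
  have := continuous_kernelDeriv.measurable
  fun_prop

theorem measurable_score_uncurry (ρ a : ℝ) :
    Measurable fun p : (ι → ℝ) × ℝ => score ρ a p.1 p.2 := by
  unfold score
  exact (measurable_kdeD_uncurry a).div (measurable_const.max (measurable_kde_uncurry a))

theorem measurable_score (ρ a : ℝ) (X : ι → ℝ) : Measurable (score ρ a X) := by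
  have h1 := continuous_kernel.measurable
  have h2 := continuous_kernelDeriv.measurable
  unfold score kde kdeD
  fun_prop

/-- N and M stand for noise, B and B' for deterministic bias. With D, D₀ the two denominators the
difference is `(FD - fD + (fD/D₀)(D₀ - D)) / D`, and the weight is `f/D²`. Bias terms use `f/D² ≤
f/ρ²`, integrable in x because f is; noise terms need a bound free of f, since their integrability
comes from the variance. -/
theorem sq_div_max_sub_div_max_mul_le {f fD F FD N M B B' ρ G : ℝ} (hf : 0 < f) (hρ : 0 < ρ)
    (hF : F - f = N + B) (hFD : FD - fD = M + B') (hG : (fD / max ρ f) ^ 2 ≤ G)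
    (hB : B ^ 2 ≤ ρ ^ 2) :
    (FD / max ρ F - fD / max ρ f) ^ 2 * f ≤
      4 * (M ^ 2 + G * N ^ 2) * (6 / ρ + 4 * N ^ 2 / ρ ^ 3) +
        4 * (B' ^ 2 + G * B ^ 2) * (f / ρ ^ 2) := by
  set D := max ρ F with hD
  set D₀ := max ρ f with hD₀
  have hDρ : ρ ≤ D := le_max_left _ _
  have hD0 : 0 < D := hρ.trans_le hDρ
  have hD₀0 : 0 < D₀ := hρ.trans_le (le_max_left _ _)
  have hG0 : 0 ≤ G := (sq_nonneg _).trans hG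
  have hdiff : (D₀ - D) ^ 2 ≤ (N + B) ^ 2 := by
    rw [← hF, ← sq_abs (D₀ - D), ← sq_abs (F - f)]
    refine pow_le_pow_left₀ (abs_nonneg _) ?_ 2
    rw [abs_sub_comm F f, hD, hD₀, max_comm ρ, max_comm ρ]
    exact abs_max_sub_max_le_abs f F ρ
  have e : FD / D - fD / D₀ = ((M + B') + fD / D₀ * (D₀ - D)) / D := by
    rw [← hFD]; field_simp; ring
  have hQ1 : f / D ^ 2 ≤ f / ρ ^ 2 := by gcongr
  have hQ2 : f / D ^ 2 ≤ 6 / ρ + 4 * N ^ 2 / ρ ^ 3 := by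
    have hd : (N + B) ^ 2 ≤ 2 * N ^ 2 + 2 * ρ ^ 2 := by nlinarith [sq_nonneg (N - B)]
    rcases le_or_gt f (2 * D) with h | h
    · have h1 : f / D ^ 2 ≤ 2 / ρ := by
        rw [div_le_div_iff₀ (by positivity) hρ]
        nlinarith [mul_le_mul_of_nonneg_left hDρ hf.le, mul_le_mul_of_nonneg_right h hD0.le]
      have : 0 ≤ 4 * N ^ 2 / ρ ^ 3 := by positivity
      have : 2 / ρ ≤ 6 / ρ := by gcongr; norm_num
      linarith
    -- If f > 2D, the estimate misses f by `d ≥ f/2`, and also `d ≥ ρ`: the excess of f over the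
    -- denominator is paid by the error itself, which the noise and the small bias control.
    · have hFD' : F ≤ D := le_max_right _ _
      set d := f - F with hd'
      have hd2 : d ^ 2 = (N + B) ^ 2 := by rw [← hF]; ring
      have h1 : f ≤ 2 * d := by linarith
      have h2 : ρ ≤ d := by linarith
      have h3 : f / ρ ^ 2 ≤ 2 * d ^ 2 / ρ ^ 3 := by
        rw [div_le_div_iff₀ (by positivity) (by positivity)]
        have : f * ρ ≤ 2 * d ^ 2 := by nlinarith
        have h4 : 0 ≤ ρ ^ 2 := by positivity
        calc f * ρ ^ 3 = f * ρ * ρ ^ 2 := by ring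
          _ ≤ _ := by gcongr
      have h5 : 2 * d ^ 2 / ρ ^ 3 ≤ 4 / ρ + 4 * N ^ 2 / ρ ^ 3 := by
        have : 4 / ρ + 4 * N ^ 2 / ρ ^ 3 = (4 * ρ ^ 2 + 4 * N ^ 2) / ρ ^ 3 := by field_simp
        rw [this]
        gcongr
        linarith
      have : 4 / ρ ≤ 6 / ρ := by gcongr; norm_num
      linarith
  have hQ0 : 0 ≤ f / D ^ 2 := by positivity
  have hMN : 0 ≤ 4 * (M ^ 2 + G * N ^ 2) := by positivity
  have hBB : 0 ≤ 4 * (B' ^ 2 + G * B ^ 2) := by positivity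
  calc (FD / D - fD / D₀) ^ 2 * f
      = ((M + B') + fD / D₀ * (D₀ - D)) ^ 2 * (f / D ^ 2) := by rw [e]; field_simp
    _ ≤ (4 * (M ^ 2 + G * N ^ 2) + 4 * (B' ^ 2 + G * B ^ 2)) * (f / D ^ 2) := by
        refine mul_le_mul_of_nonneg_right ?_ hQ0
        have h1 : (fD / D₀) ^ 2 * (D₀ - D) ^ 2 ≤ G * (N + B) ^ 2 := by gcongr
        have h2 : G * (N + B) ^ 2 ≤ G * (2 * N ^ 2 + 2 * B ^ 2) := by
          gcongr; nlinarith [sq_nonneg (N - B)]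
        nlinarith [sq_nonneg ((M + B') - fD / D₀ * (D₀ - D)), sq_nonneg (M - B')]
    _ ≤ _ := by
        rw [add_mul]
        exact add_le_add (mul_le_mul_of_nonneg_left hQ2 hMN) (mul_le_mul_of_nonneg_left hQ1 hBB)

variable [Nonempty ι] {a : ℝ} (ha : 1 ≤ a) (θ X : ι → ℝ) (x : ℝ)

include ha in
theorem abs_kde_sub_le :
    |kde a X x - mix θ x - noise kernel a θ x X| ≤ Real.exp (-a ^ 2 / 2) := by
  have e : kde a X x - mix θ x - noise kernel a θ x X =
      (1 / (Fintype.card ι : ℝ)) * ∑ i, (kernelMean kernel a (θ i) x - npdf (θ i) x) := by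
    unfold kde mix noise
    rw [← mul_sub, ← mul_sub, ← Finset.sum_sub_distrib, ← Finset.sum_sub_distrib]
    congr 1
    exact Finset.sum_congr rfl fun i _ => by ring
  rw [e]
  exact abs_avg_le_of_le fun i => abs_integral_kernel_sub_npdf_le ha (θ i) x

include ha in
theorem abs_kdeD_sub_le :
    |kdeD a X x - mixD θ x - a * noise kernelDeriv a θ x X| ≤ Real.exp (-a ^ 2 / 2) := by
  have e : kdeD a X x - mixD θ x - a * noise kernelDeriv a θ x X =
      (1 / (Fintype.card ι : ℝ)) *
        ∑ i, (a * kernelMean kernelDeriv a (θ i) x - (θ i - x) * npdf (θ i) x) := by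
    unfold kdeD mixD noise
    rw [mul_left_comm a, ← mul_sub, Finset.mul_sum, ← mul_sub, ← Finset.sum_sub_distrib,
      ← Finset.sum_sub_distrib]
    congr 1
    exact Finset.sum_congr rfl fun i _ => by ring
  rw [e]
  refine abs_avg_le_of_le fun i => ?_
  have : a * kernelMean kernelDeriv a (θ i) x =
      ∫ y, a ^ 2 * kernelDeriv (a * (x - y)) ∂(gaussianReal (θ i) 1) := by
    rw [kernelMean, ← integral_const_mul]
    congr 1; ext y; ring
  rw [this]
  exact abs_integral_kernelDeriv_sub_npdf_le ha (θ i) x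

/-- The bound for the mean integrated squared error of the estimated score. -/
def scoreErr (ρ a n : ℝ) : ℝ :=
  π * a / n * ((a ^ 2 + 2 * (Real.log (1 / ρ) + 1)) *
    (24 / ρ + 16 / ρ ^ 3 * (3 * (π * a / n) + 4 * a ^ 2 / n ^ 2))) +
  4 * (1 + 2 * (Real.log (1 / ρ) + 1)) * (Real.exp (-a ^ 2 / 2)) ^ 2 / ρ ^ 2

theorem lintegral_quartic_le {Ω : Type*} [MeasurableSpace Ω] {μ : Measure Ω}
    [IsProbabilityMeasure μ] {M N : Ω → ℝ} (hM : Measurable M) (hN : Measurable N) {C : ℝ}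
    (hMb : ∀ ω, |M ω| ≤ C) (hNb : ∀ ω, |N ω| ≤ C) {V W : ℝ}
    (hM2 : ∫ ω, M ω ^ 2 ∂μ ≤ V) (hN2 : ∫ ω, N ω ^ 2 ∂μ ≤ V)
    (hM4 : ∫ ω, M ω ^ 4 ∂μ ≤ W) (hN4 : ∫ ω, N ω ^ 4 ∂μ ≤ W) {A₁ A₂ A₃ A₄ R : ℝ}
    (h1 : 0 ≤ A₁) (h2 : 0 ≤ A₂) (h3 : 0 ≤ A₃) (h4 : 0 ≤ A₄) (hR : 0 ≤ R) :
    ∫⁻ ω, ENNReal.ofReal (A₁ * M ω ^ 2 + A₂ * N ω ^ 2 + A₃ * M ω ^ 4 + A₄ * N ω ^ 4 + R) ∂μ ≤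
      ENNReal.ofReal (A₁ * V + A₂ * V + A₃ * W + A₄ * W + R) := by
  have ip : ∀ {f : Ω → ℝ}, Measurable f → (∀ ω, |f ω| ≤ C) → ∀ p : ℕ,
      Integrable (fun ω => f ω ^ p) μ := fun hf hb p =>
    integrable_of_measurable_bounded (hf.pow_const p) fun ω => by
      rw [abs_pow]; exact pow_le_pow_left₀ (abs_nonneg _) (hb ω) p
  have i1 := (ip hM hMb 2).const_mul A₁
  have i2 := (ip hN hNb 2).const_mul A₂
  have i3 := (ip hM hMb 4).const_mul A₃
  have i4 := (ip hN hNb 4).const_mul A₄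
  have i12 : Integrable (fun ω => A₁ * M ω ^ 2 + A₂ * N ω ^ 2) μ := i1.add i2
  have i123 : Integrable (fun ω => A₁ * M ω ^ 2 + A₂ * N ω ^ 2 + A₃ * M ω ^ 4) μ := i12.add i3
  have i1234 : Integrable (fun ω => A₁ * M ω ^ 2 + A₂ * N ω ^ 2 + A₃ * M ω ^ 4 + A₄ * N ω ^ 4) μ :=
    i123.add i4
  have i5 : Integrable (fun ω => A₁ * M ω ^ 2 + A₂ * N ω ^ 2 + A₃ * M ω ^ 4 + A₄ * N ω ^ 4 + R) μ :=
    i1234.add (integrable_const R)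
  rw [← ofReal_integral_eq_lintegral_ofReal i5
    (Eventually.of_forall fun ω => by simp only [Pi.zero_apply]; positivity)]
  refine ENNReal.ofReal_le_ofReal ?_
  rw [integral_add i1234 (integrable_const R), integral_add i123 i4, integral_add i12 i3,
    integral_add i1 i2, integral_const_mul, integral_const_mul, integral_const_mul,
    integral_const_mul, integral_const, probReal_univ, one_smul]
  have b1 := mul_le_mul_of_nonneg_left hM2 h1
  have b2 := mul_le_mul_of_nonneg_left hN2 h2
  have b3 := mul_le_mul_of_nonneg_left hM4 h3
  have b4 := mul_le_mul_of_nonneg_left hN4 h4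
  linarith

/-- Separates the moments by `M² N² ≤ (M⁴ + N⁴)/2`, so that marginal moments suffice although M and
N are dependent. -/
theorem score_error_expand {a ρ G e f N M B B' : ℝ} (hρ : 0 < ρ) (hG : 0 ≤ G) (hf : 0 ≤ f)
    (hB : B ^ 2 ≤ e ^ 2) (hB' : B' ^ 2 ≤ e ^ 2) :
    4 * ((a * M) ^ 2 + G * N ^ 2) * (6 / ρ + 4 * N ^ 2 / ρ ^ 3) +
        4 * (B' ^ 2 + G * B ^ 2) * (f / ρ ^ 2) ≤
      (24 / ρ * a ^ 2) * M ^ 2 + (24 / ρ * G) * N ^ 2 + (8 / ρ ^ 3 * a ^ 2) * M ^ 4 +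
        (16 / ρ ^ 3 * (a ^ 2 / 2 + G)) * N ^ 4 + 4 * (1 + G) * e ^ 2 / ρ ^ 2 * f := by
  have h1 : 4 * (B' ^ 2 + G * B ^ 2) * (f / ρ ^ 2) ≤ 4 * (1 + G) * e ^ 2 / ρ ^ 2 * f := by
    have h : B' ^ 2 + G * B ^ 2 ≤ (1 + G) * e ^ 2 := by
      linarith [mul_le_mul_of_nonneg_left hB hG]
    calc _ ≤ 4 * ((1 + G) * e ^ 2) * (f / ρ ^ 2) := by gcongr
      _ = _ := by ring
  have e1 : 4 * ((a * M) ^ 2 + G * N ^ 2) * (6 / ρ + 4 * N ^ 2 / ρ ^ 3) =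
      (24 / ρ * a ^ 2) * M ^ 2 + (24 / ρ * G) * N ^ 2 +
      (16 / ρ ^ 3 * a ^ 2) * (M ^ 2 * N ^ 2) + (16 / ρ ^ 3 * G) * N ^ 4 := by ring
  have e2 : M ^ 2 * N ^ 2 ≤ (M ^ 4 + N ^ 4) / 2 := by
    linarith [sq_nonneg (M ^ 2 - N ^ 2)]
  have e3 : (16 / ρ ^ 3 * a ^ 2) * (M ^ 2 * N ^ 2) ≤
      (16 / ρ ^ 3 * a ^ 2) * ((M ^ 4 + N ^ 4) / 2) := by gcongr
  have e4 : (16 / ρ ^ 3 * a ^ 2) * ((M ^ 4 + N ^ 4) / 2) + (16 / ρ ^ 3 * G) * N ^ 4 =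
      (8 / ρ ^ 3 * a ^ 2) * M ^ 4 + (16 / ρ ^ 3 * (a ^ 2 / 2 + G)) * N ^ 4 := by ring
  linarith

include ha in
theorem lintegral_score_error_pointwise {ρ : ℝ} (hρ : 0 < ρ) (hρ1 : ρ ≤ 1)
    (he : Real.exp (-a ^ 2 / 2) ≤ ρ) :
    ∫⁻ X, ENNReal.ofReal ((score ρ a X x - regScore ρ θ x) ^ 2 * mix θ x) ∂(gaussProd θ) ≤
      ENNReal.ofReal (noiseVar a θ x * ((a ^ 2 + 2 * (Real.log (1 / ρ) + 1)) *
        (24 / ρ + 16 / ρ ^ 3 *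
          (3 * (π * a / Fintype.card ι) + 4 * a ^ 2 / (Fintype.card ι : ℝ) ^ 2))) +
        4 * (1 + 2 * (Real.log (1 / ρ) + 1)) * (Real.exp (-a ^ 2 / 2)) ^ 2 / ρ ^ 2 * mix θ x) := by
  have ha0 : 0 < a := by linarith
  have hlog : 0 ≤ Real.log (1 / ρ) := Real.log_nonneg ((one_le_div hρ).2 hρ1)
  have hk1 : ∀ x, |kernel x| ≤ 1 := fun x => (abs_kernel_le x).trans (by linarith [one_div_pi_le])
  have hk2 : ∀ x, |kernelDeriv x| ≤ 1 :=
    fun x => (abs_kernelDeriv_le x).trans (by linarith [one_div_pi_le])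
  have hV0 := noiseVar_nonneg θ a x
  have hVle := noiseVar_le ha0 θ x
  obtain ⟨hN2, hN4⟩ := noise_moments continuous_kernel hk1 kernel_sq_le ha0 θ x
  obtain ⟨hM2, hM4⟩ := noise_moments continuous_kernelDeriv hk2 kernelDeriv_sq_le ha0 θ x
  have hf := mix_pos θ x
  have hG := fun X => sq_div_max_sub_div_max_mul_le (F := kde a X x) (FD := kdeD a X x)
    (N := noise kernel a θ x X) (M := a * noise kernelDeriv a θ x X)
    (B := kde a X x - mix θ x - noise kernel a θ x X)
    (B' := kdeD a X x - mixD θ x - a * noise kernelDeriv a θ x X) hf hρ (by ring) (by ring)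
    (regScore_sq_le θ x hρ hρ1)
  have hbd := fun X => pow_le_pow_left₀ (abs_nonneg _) (abs_kde_sub_le ha θ X x) 2
  have hbd' := fun X => pow_le_pow_left₀ (abs_nonneg _) (abs_kdeD_sub_le ha θ X x) 2
  simp only [sq_abs] at hbd hbd'
  -- The bias is at most `exp (-a²/2) ≤ ρ`, as the comparison of the two quotients requires.
  have he2 := pow_le_pow_left₀ (Real.exp_pos _).le he 2
  have hG0 : 0 ≤ 2 * (Real.log (1 / ρ) + 1) := by positivity
  generalize 2 * (Real.log (1 / ρ) + 1) = G at *
  refine (lintegral_mono fun X => ENNReal.ofReal_le_ofReal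
    ((hG X ((hbd X).trans he2)).trans
      (score_error_expand hρ hG0 hf.le (hbd X) (hbd' X)))).trans ?_
  clear hG hbd hbd'
  -- One factor of the variance is kept and the other replaced by its uniform bound: the estimate
  -- stays linear in `noiseVar`, hence integrable in x.
  have hc4 : 3 * noiseVar a θ x ^ 2 + 4 * a ^ 2 / (Fintype.card ι : ℝ) ^ 2 * noiseVar a θ x ≤
      (3 * (π * a / Fintype.card ι) + 4 * a ^ 2 / (Fintype.card ι : ℝ) ^ 2) * noiseVar a θ x := by
    rw [add_mul]
    refine add_le_add_left ?_ _
    rw [sq, mul_assoc]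
    exact mul_le_mul_of_nonneg_left (mul_le_mul_of_nonneg_right hVle hV0) (by norm_num)
  have key := lintegral_quartic_le (μ := gaussProd θ)
    (measurable_noise continuous_kernelDeriv θ x) (measurable_noise continuous_kernel θ x)
    (C := 2 * a)
    (fun X => abs_avg_le_of_le fun i => abs_noise_term_le hk2 ha0 x (θ i) (X i))
    (fun X => abs_avg_le_of_le fun i => abs_noise_term_le hk1 ha0 x (θ i) (X i))
    hM2 hN2 (hM4.trans hc4) (hN4.trans hc4) (A₁ := 24 / ρ * a ^ 2) (A₂ := 24 / ρ * G)
    (A₃ := 8 / ρ ^ 3 * a ^ 2) (A₄ := 16 / ρ ^ 3 * (a ^ 2 / 2 + G))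
    (R := 4 * (1 + G) * Real.exp (-a ^ 2 / 2) ^ 2 / ρ ^ 2 * mix θ x)
    (by positivity) (by positivity) (by positivity) (by positivity) (by positivity)
  refine key.trans (le_of_eq ?_)
  congr 1
  ring

include ha in
theorem lintegral_score_error {ρ : ℝ} (hρ : 0 < ρ) (hρ1 : ρ ≤ 1)
    (he : Real.exp (-a ^ 2 / 2) ≤ ρ) :
    ∫⁻ X, ∫⁻ x, ENNReal.ofReal ((score ρ a X x - regScore ρ θ x) ^ 2 * mix θ x) ∂volume ∂(gaussProd θ) ≤
      ENNReal.ofReal (scoreErr ρ a (Fintype.card ι)) := by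
  have ha0 : 0 < a := by linarith
  have hn0 : (0 : ℝ) < Fintype.card ι := card_pos_real
  have hlog : 0 ≤ Real.log (1 / ρ) := Real.log_nonneg ((one_le_div hρ).2 hρ1)
  have m1 := (continuous_mix θ).measurable
  have m2 := (continuous_mixD θ).measurable
  have m3 : Measurable (regScore ρ θ) := by unfold regScore; fun_prop
  have m4 := measurable_score_uncurry (ι := ι) ρ a
  have m5 : Measurable fun p : (ι → ℝ) × ℝ => regScore ρ θ p.2 := m3.comp measurable_snd
  have m6 : Measurable fun p : (ι → ℝ) × ℝ => mix θ p.2 := m1.comp measurable_snd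
  have m7 : Measurable (fun p : (ι → ℝ) × ℝ =>
    ENNReal.ofReal ((score ρ a p.1 p.2 - regScore ρ θ p.2) ^ 2 * mix θ p.2)) :=
    (((m4.sub m5).pow_const 2).mul m6).ennreal_ofReal
  rw [lintegral_lintegral_swap m7.aemeasurable]
  refine (lintegral_mono fun x => lintegral_score_error_pointwise ha θ x hρ hρ1 he).trans ?_
  unfold scoreErr
  set A := (a ^ 2 + 2 * (Real.log (1 / ρ) + 1)) * (24 / ρ + 16 / ρ ^ 3 *
    (3 * (π * a / Fintype.card ι) + 4 * a ^ 2 / (Fintype.card ι : ℝ) ^ 2)) with hA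
  set B := 4 * (1 + 2 * (Real.log (1 / ρ) + 1)) * (Real.exp (-a ^ 2 / 2)) ^ 2 / ρ ^ 2 with hB
  have hA0 : 0 ≤ A := by positivity
  have hB0 : 0 ≤ B := by positivity
  have e : ∀ x, ENNReal.ofReal (noiseVar a θ x * A + B * mix θ x) =
      ENNReal.ofReal (noiseVar a θ x) * ENNReal.ofReal A +
        ENNReal.ofReal B * ENNReal.ofReal (mix θ x) := fun x => by
    have hV0 : 0 ≤ noiseVar a θ x := noiseVar_nonneg θ a x
    have hf := mix_nonneg θ x
    rw [ENNReal.ofReal_add (by positivity) (by positivity), ENNReal.ofReal_mul hV0,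
      ENNReal.ofReal_mul hB0]
  simp_rw [e]
  rw [lintegral_add_right _ (by fun_prop), lintegral_mul_const' _ _ ENNReal.ofReal_ne_top,
    lintegral_const_mul' _ _ ENNReal.ofReal_ne_top, lintegral_noiseVar ha0, lintegral_mix, mul_one,
    ← ENNReal.ofReal_mul (by positivity), ← ENNReal.ofReal_add (by positivity) hB0]

end Score

/-! ### Replacing one coordinate by an independent copy -/

section Resample

variable {ι : Type*} [Fintype ι]

open Classical in
-- The inner integral over z is already the marginal in coordinate i, so integrating that coordinate
-- again changes nothing.
theorem lintegral_gaussProd_update (θ : ι → ℝ) (i : ι) {H : (ι → ℝ) → ℝ≥0∞} (hH : Measurable H) :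
    ∫⁻ X, H X ∂(gaussProd θ) =
      ∫⁻ X, ∫⁻ z, H (Function.update X i z) ∂(gaussianReal (θ i) 1) ∂(gaussProd θ) := by
  have hm : Measurable fun p : (ι → ℝ) × ℝ => H (Function.update p.1 i p.2) :=
    hH.comp measurable_update'
  refine lintegral_eq_of_lmarginal_eq {i} hH hm.lintegral_prod_right' ?_
  ext X
  rw [lmarginal_singleton, lmarginal_singleton]
  simp

open Classical in
-- X_i and a fresh x with the same law are exchangeable. This turns a score evaluated at an
-- independent point into one evaluated at X_i, at the price of altering the sample in coordinate i
-- only.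
theorem lintegral_gaussProd_resample (θ : ι → ℝ) (i : ι) {H : (ι → ℝ) × ℝ → ℝ≥0∞}
    (hH : Measurable H) :
    ∫⁻ X, ∫⁻ x, H (X, x) ∂(gaussianReal (θ i) 1) ∂(gaussProd θ) =
      ∫⁻ X, ∫⁻ z, H (Function.update X i z, X i) ∂(gaussianReal (θ i) 1) ∂(gaussProd θ) := by
  have hu : Measurable fun p : (ι → ℝ) × ℝ => Function.update p.1 i p.2 := measurable_update'
  have h1 : Measurable fun p : (ι → ℝ) × ℝ => H (Function.update p.1 i p.2, p.1 i) :=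
    hH.comp (hu.prodMk ((measurable_pi_apply i).comp measurable_fst))
  rw [lintegral_gaussProd_update θ i hH.lintegral_prod_right',
    lintegral_gaussProd_update θ i h1.lintegral_prod_right']
  refine lintegral_congr fun X => ?_
  simp only [Function.update_idem, Function.update_self]
  rw [lintegral_lintegral_swap]
  have h2 : Measurable fun p : ℝ × ℝ => (Function.update X i p.1, p.2) :=
    ((measurable_update X).comp measurable_fst).prodMk measurable_snd
  exact (hH.comp h2).aemeasurable

end Resample

/-! ### The risk of the regularised general empirical Bayes rule -/

section Regularised

variable {ι : Type*} [Fintype ι] [Nonempty ι]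

open Classical in
theorem abs_kde_update_sub_le {a : ℝ} (ha : 0 ≤ a) (X : ι → ℝ) (i : ι) (z x : ℝ) :
    |kde a (Function.update X i z) x - kde a X x| ≤ a / Fintype.card ι := by
  have hn := card_pos_real (ι := ι)
  have e : kde a (Function.update X i z) x - kde a X x = (1 / (Fintype.card ι : ℝ)) *
      (a * kernel (a * (x - z)) - a * kernel (a * (x - X i))) := by
    unfold kde
    rw [← mul_sub, ← Finset.sum_sub_distrib]
    congr 1
    rw [Finset.sum_eq_single i (fun j _ hj => by simp [Function.update_of_ne hj]) (by simp),
      Function.update_self]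
  have h1 := abs_kernel_le (a * (x - z))
  have h2 := abs_kernel_le (a * (x - X i))
  have h3 := one_div_pi_le
  rw [e, ← mul_sub, abs_mul, abs_mul, abs_of_pos (by positivity), abs_of_nonneg ha, one_div,
    div_eq_inv_mul]
  refine mul_le_mul_of_nonneg_left (mul_le_of_le_one_right ha ?_) (by positivity)
  have := abs_sub (kernel (a * (x - z))) (kernel (a * (x - X i)))
  linarith

open Classical in
theorem abs_kdeD_update_sub_le (a : ℝ) (X : ι → ℝ) (i : ι) (z x : ℝ) :
    |kdeD a (Function.update X i z) x - kdeD a X x| ≤ a ^ 2 / Fintype.card ι := by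
  have hn := card_pos_real (ι := ι)
  have e : kdeD a (Function.update X i z) x - kdeD a X x = (1 / (Fintype.card ι : ℝ)) *
      (a ^ 2 * kernelDeriv (a * (x - z)) - a ^ 2 * kernelDeriv (a * (x - X i))) := by
    unfold kdeD
    rw [← mul_sub, ← Finset.sum_sub_distrib]
    congr 1
    rw [Finset.sum_eq_single i (fun j _ hj => by simp [Function.update_of_ne hj]) (by simp),
      Function.update_self]
  have h1 := abs_kernelDeriv_le (a * (x - z))
  have h2 := abs_kernelDeriv_le (a * (x - X i))
  have h3 := one_div_pi_le
  rw [e, ← mul_sub, abs_mul, abs_mul, abs_of_pos (by positivity), abs_of_nonneg (sq_nonneg a),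
    one_div, div_eq_inv_mul]
  refine mul_le_mul_of_nonneg_left (mul_le_of_le_one_right (sq_nonneg a) ?_) (by positivity)
  have := abs_sub (kernelDeriv (a * (x - z))) (kernelDeriv (a * (x - X i)))
  linarith

open Classical in
-- One observation moves the density estimate by at most a/n and its derivative by at most a²/n; the
-- denominators are at least ρ.
theorem abs_score_update_sub_le {ρ a : ℝ} (hρ : 0 < ρ) (ha : 0 ≤ a) (X : ι → ℝ) (i : ι) (z x : ℝ) :
    |score ρ a X x - score ρ a (Function.update X i z) x| ≤
      a / (Fintype.card ι * ρ) * (a + |score ρ a (Function.update X i z) x|) := by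
  have hn := card_pos_real (ι := ι)
  have h1 := abs_kde_update_sub_le ha X i z x
  have h2 := abs_kdeD_update_sub_le a X i z x
  set X' := Function.update X i z
  set D := max ρ (kde a X x) with hD
  set D' := max ρ (kde a X' x) with hD'
  have hDρ : ρ ≤ D := le_max_left _ _
  have hD0 : 0 < D := hρ.trans_le hDρ
  have hD'0 : 0 < D' := hρ.trans_le (le_max_left _ _)
  have h3 : |D' - D| ≤ a / Fintype.card ι := by
    refine le_trans ?_ h1
    rw [hD, hD', max_comm ρ, max_comm ρ]
    exact abs_max_sub_max_le_abs _ _ ρ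
  have hs : score ρ a X x = kdeD a X x / D := rfl
  have hs' : score ρ a X' x = kdeD a X' x / D' := rfl
  have e : score ρ a X x - score ρ a X' x =
      (-(kdeD a X' x - kdeD a X x) + score ρ a X' x * (D' - D)) / D := by
    rw [hs, hs']; field_simp; ring
  rw [e, abs_div, abs_of_pos hD0, div_le_iff₀ hD0]
  have h4 := abs_add_le (-(kdeD a X' x - kdeD a X x)) (score ρ a X' x * (D' - D))
  rw [abs_neg, abs_mul] at h4
  have h5 := mul_le_mul_of_nonneg_left h3 (abs_nonneg (score ρ a X' x))
  calc _ ≤ a / Fintype.card ι * (a + |score ρ a X' x|) := by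
        refine h4.trans ((add_le_add h2 h5).trans (le_of_eq (by ring)))
    _ = a / (Fintype.card ι * ρ) * (a + |score ρ a X' x|) * ρ := by field_simp
    _ ≤ _ := by
        refine mul_le_mul_of_nonneg_left hDρ ?_
        have := abs_nonneg (score ρ a X' x)
        positivity

/-- Since `δ ≤ 1`, the quadratic term in δ is absorbed by the linear one. -/
theorem sq_le_of_abs_sub_le {a δ g g' z : ℝ} (hδ : 0 ≤ δ) (hδ1 : δ ≤ 1)
    (h : |g - g'| ≤ δ * (a + |g'|)) :
    (z + g) ^ 2 ≤ (z + g') ^ 2 + δ * (6 * g' ^ 2 + 2 * z ^ 2 + 4 * a ^ 2) := by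
  have e : (z + g) ^ 2 = (z + g') ^ 2 + 2 * (z + g') * (g - g') + (g - g') ^ 2 := by ring
  have h1 : (z + g') * (g - g') ≤ (|z| + |g'|) * (δ * (a + |g'|)) := by
    refine (le_abs_self _).trans ?_
    rw [abs_mul]
    exact mul_le_mul (abs_add_le _ _) h (abs_nonneg _) (by positivity)
  have h2 : (g - g') ^ 2 ≤ δ * (a + |g'|) ^ 2 := by
    rw [← sq_abs]
    refine (pow_le_pow_left₀ (abs_nonneg _) h 2).trans ?_
    rw [mul_pow]
    exact mul_le_mul_of_nonneg_right (by nlinarith) (sq_nonneg _)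
  have h3 : 2 * ((|z| + |g'|) * (a + |g'|)) + (a + |g'|) ^ 2 ≤
      6 * g' ^ 2 + 2 * z ^ 2 + 4 * a ^ 2 := by
    rw [← sq_abs g', ← sq_abs z]
    nlinarith [sq_nonneg (|z| - a), sq_nonneg (|z| - |g'|), sq_nonneg (a - |g'|)]
  have h4 := mul_le_mul_of_nonneg_left h3 hδ
  nlinarith

variable {ρ a : ℝ} (θ : ι → ℝ)

theorem lintegral_sq_sub_gaussian (t : ℝ) :
    ∫⁻ x, ENNReal.ofReal ((x - t) ^ 2) ∂(gaussianReal t 1) = 1 := by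
  have h : ∫ x, (x - t) ^ 2 ∂(gaussianReal t 1) = 1 := by
    have := variance_id_gaussianReal (μ := t) (v := 1)
    rw [variance_eq_integral measurable_id.aemeasurable] at this
    simpa using this
  rw [← ofReal_integral_eq_lintegral_ofReal ?_ (Eventually.of_forall fun x => sq_nonneg _), h,
    ENNReal.ofReal_one]
  have := (memLp_id_gaussianReal (μ := t) (v := 1) 2).sub (memLp_const t)
  exact this.integrable_sq

theorem scoreErr_nonneg {n : ℝ} (hρ : 0 < ρ) (hρ1 : ρ ≤ 1) (ha : 0 ≤ a) (hn : 0 ≤ n) :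
    0 ≤ scoreErr ρ a n := by
  have hlog : 0 ≤ Real.log (1 / ρ) := Real.log_nonneg ((one_le_div hρ).2 hρ1)
  unfold scoreErr
  positivity

/-- Bounds the factor that multiplies δ in the exchange argument: the squared score is at most twice
the squared error plus twice the squared regularised score, which is O(log(1/ρ)). -/
theorem lintegral_score_sq_le (hρ : 0 < ρ) (hρ1 : ρ ≤ 1) (ha : 1 ≤ a)
    (he : Real.exp (-a ^ 2 / 2) ≤ ρ) :
    ∫⁻ X, ∑ i, ∫⁻ x, ENNReal.ofReal (score ρ a X x ^ 2) ∂(gaussianReal (θ i) 1) ∂(gaussProd θ) ≤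
      Fintype.card ι * ENNReal.ofReal (2 * scoreErr ρ a (Fintype.card ι) +
        4 * (Real.log (1 / ρ) + 1)) := by
  have hlog : 0 ≤ Real.log (1 / ρ) := Real.log_nonneg ((one_le_div hρ).2 hρ1)
  have hn := card_pos_real (ι := ι)
  have hE0 := scoreErr_nonneg hρ hρ1 (zero_le_one.trans ha) hn.le
  have m0 := measurable_score_uncurry (ι := ι) ρ a
  have hsec : ∀ X : ι → ℝ, Measurable (score ρ a X) := measurable_score ρ a
  have m1 := (continuous_mix θ).measurable
  have m2 := (continuous_mixD θ).measurable
  have m3 : Measurable (regScore ρ θ) := by unfold regScore; fun_prop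
  have hX : ∀ X : ι → ℝ, ∑ i, ∫⁻ x, ENNReal.ofReal (score ρ a X x ^ 2) ∂(gaussianReal (θ i) 1) ≤
      Fintype.card ι * (2 * (∫⁻ x, ENNReal.ofReal ((score ρ a X x - regScore ρ θ x) ^ 2 *
        mix θ x)) + ENNReal.ofReal (4 * (Real.log (1 / ρ) + 1))) := fun X => by
    have mX := hsec X
    rw [sum_lintegral_gaussian θ (by fun_prop)]
    gcongr
    rw [← mul_one (ENNReal.ofReal (4 * (Real.log (1 / ρ) + 1))), ← lintegral_mix θ,
      ← lintegral_const_mul' _ _ ENNReal.ofNat_ne_top,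
      ← lintegral_const_mul' _ _ ENNReal.ofReal_ne_top, ← lintegral_add_left (by fun_prop)]
    refine lintegral_mono fun x => ?_
    have hf := mix_nonneg θ x
    have e4 : (2 : ℝ≥0∞) = ENNReal.ofReal 2 := by simp
    simp only []
    rw [e4, ← ENNReal.ofReal_mul zero_le_two, ← ENNReal.ofReal_mul hf, ← ENNReal.ofReal_mul (by positivity),
      ← ENNReal.ofReal_add (by positivity) (by positivity)]
    refine ENNReal.ofReal_le_ofReal ?_
    have h1 := regScore_sq_le θ x hρ hρ1
    have h2 : score ρ a X x ^ 2 ≤ 2 * (score ρ a X x - regScore ρ θ x) ^ 2 +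
        4 * (Real.log (1 / ρ) + 1) := by
      nlinarith [sq_nonneg (score ρ a X x - 2 * regScore ρ θ x)]
    nlinarith [mul_le_mul_of_nonneg_left h2 hf]
  refine (lintegral_mono hX).trans ?_
  rw [lintegral_const_mul' _ _ (ENNReal.natCast_ne_top _), lintegral_add_right _ measurable_const,
    lintegral_const_mul' _ _ ENNReal.ofNat_ne_top, lintegral_const, measure_univ, mul_one,
    ENNReal.ofReal_add (by positivity) (by positivity), ENNReal.ofReal_mul zero_le_two]
  have := lintegral_score_error ha θ hρ hρ1 he
  gcongr
  simp

/-- After the exchange with an independent copy the sample is fixed with respect to the evaluation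
point, and the comparison for deterministic rules, `sum_lintegral_rule_le`, applies for each X. What
remains is the integrated score error and a perturbation of size δ. -/
theorem sum_lintegral_score_rule_le (hρ : 0 < ρ) (hρ1 : ρ ≤ 1) (ha : 1 ≤ a)
    (he : Real.exp (-a ^ 2 / 2) ≤ ρ) (hδ : a / (Fintype.card ι * ρ) ≤ 1) {h : ℝ → ℝ}
    (hh : Measurable h) :
    ∑ i, ∫⁻ X, ENNReal.ofReal ((X i + score ρ a X (X i) - θ i) ^ 2) ∂(gaussProd θ) ≤
      ∑ i, ∫⁻ x, ENNReal.ofReal ((h x - θ i) ^ 2) ∂(gaussianReal (θ i) 1) +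
        Fintype.card ι * (ENNReal.ofReal (2 * scoreErr ρ a (Fintype.card ι) +
          a / (Fintype.card ι * ρ) * (6 * (2 * scoreErr ρ a (Fintype.card ι) +
            4 * (Real.log (1 / ρ) + 1)) + 2 + 4 * a ^ 2)) + 2 * regBias ρ θ) := by
  classical
  have hlog : 0 ≤ Real.log (1 / ρ) := Real.log_nonneg ((one_le_div hρ).2 hρ1)
  have hn := card_pos_real (ι := ι)
  have hE0 := scoreErr_nonneg hρ hρ1 (zero_le_one.trans ha) hn.le
  set δ := a / (Fintype.card ι * ρ) with hδdef
  have hδ0 : 0 ≤ δ := by positivity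
  set E := scoreErr ρ a (Fintype.card ι) with hE
  have m0 := measurable_score_uncurry (ι := ι) ρ a
  have hsec : ∀ X : ι → ℝ, Measurable (score ρ a X) := measurable_score ρ a
  let H : ι → (ι → ℝ) × ℝ → ℝ≥0∞ := fun i p =>
    ENNReal.ofReal ((p.2 + score ρ a p.1 p.2 - θ i) ^ 2) + ENNReal.ofReal δ *
      (ENNReal.ofReal (6 * score ρ a p.1 p.2 ^ 2) + ENNReal.ofReal (2 * (p.2 - θ i) ^ 2) +
        ENNReal.ofReal (4 * a ^ 2))
  have hHm : ∀ i, Measurable (H i) := fun i => by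
    simp only [H]; fun_prop
  have step : ∀ i, ∫⁻ X, ENNReal.ofReal ((X i + score ρ a X (X i) - θ i) ^ 2) ∂(gaussProd θ) ≤
      ∫⁻ X, ∫⁻ x, H i (X, x) ∂(gaussianReal (θ i) 1) ∂(gaussProd θ) := fun i => by
    rw [lintegral_gaussProd_resample θ i (hHm i)]
    refine lintegral_mono fun X => ?_
    have : ∀ z, ENNReal.ofReal ((X i + score ρ a X (X i) - θ i) ^ 2) ≤
        H i (Function.update X i z, X i) := fun z => by
      have hb := sq_le_of_abs_sub_le (z := X i - θ i) hδ0 hδ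
        (abs_score_update_sub_le hρ (by linarith) X i z (X i))
      simp only [H]
      rw [← ENNReal.ofReal_add (by positivity) (by positivity),
        ← ENNReal.ofReal_add (by positivity) (by positivity), ← ENNReal.ofReal_mul hδ0,
        ← ENNReal.ofReal_add (by positivity) (by positivity)]
      refine ENNReal.ofReal_le_ofReal ?_
      rw [add_sub_right_comm, add_sub_right_comm]
      exact hb
    -- The loss does not involve z, so it may be averaged over z and compared under the integral.
    calc _ = ∫⁻ _z, ENNReal.ofReal ((X i + score ρ a X (X i) - θ i) ^ 2)
          ∂(gaussianReal (θ i) 1) := by simp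
      _ ≤ _ := lintegral_mono this
  refine (Finset.sum_le_sum fun i _ => step i).trans ?_
  rw [← lintegral_finsetSum _ fun i _ => (hHm i).lintegral_prod_right']
  have hpoint : ∀ X : ι → ℝ, ∑ i, ∫⁻ x, H i (X, x) ∂(gaussianReal (θ i) 1) =
      ∑ i, ∫⁻ x, ENNReal.ofReal ((x + score ρ a X x - θ i) ^ 2) ∂(gaussianReal (θ i) 1) +
      ENNReal.ofReal δ * (ENNReal.ofReal 6 * (∑ i, ∫⁻ x, ENNReal.ofReal (score ρ a X x ^ 2)
        ∂(gaussianReal (θ i) 1)) + Fintype.card ι * ENNReal.ofReal (2 + 4 * a ^ 2)) := fun X => by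
    have mX := hsec X
    rw [Finset.mul_sum, ← Finset.card_univ, ← nsmul_eq_mul, ← Finset.sum_const,
      ← Finset.sum_add_distrib, Finset.mul_sum, ← Finset.sum_add_distrib]
    refine Finset.sum_congr rfl fun i _ => ?_
    simp only [H]
    rw [lintegral_add_left (by fun_prop), lintegral_const_mul' _ _ ENNReal.ofReal_ne_top,
      lintegral_add_right _ measurable_const, lintegral_add_left (by fun_prop)]
    simp_rw [ENNReal.ofReal_mul (by norm_num : (0 : ℝ) ≤ 6),
      ENNReal.ofReal_mul (by norm_num : (0 : ℝ) ≤ 2)]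
    rw [lintegral_const_mul' _ _ ENNReal.ofReal_ne_top,
      lintegral_const_mul' _ _ ENNReal.ofReal_ne_top, lintegral_sq_sub_gaussian, mul_one,
      lintegral_const, measure_univ, mul_one, add_assoc, ← ENNReal.ofReal_add (by norm_num)
        (by positivity)]
  simp_rw [hpoint]
  have hle : ∀ X : ι → ℝ, ∑ i, ∫⁻ x, ENNReal.ofReal ((x + score ρ a X x - θ i) ^ 2)
      ∂(gaussianReal (θ i) 1) ≤
      ∑ i, ∫⁻ x, ENNReal.ofReal ((h x - θ i) ^ 2) ∂(gaussianReal (θ i) 1) +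
        Fintype.card ι * (2 * (∫⁻ x, ENNReal.ofReal ((score ρ a X x - regScore ρ θ x) ^ 2 *
          mix θ x)) + 2 * regBias ρ θ) := fun X => sum_lintegral_rule_le θ hρ (hsec X) hh
  have mA : Measurable fun X : ι → ℝ => ∑ i, ∫⁻ x, ENNReal.ofReal ((x + score ρ a X x - θ i) ^ 2)
      ∂(gaussianReal (θ i) 1) := Finset.measurable_fun_sum _ fun i _ => by
    have : Measurable fun p : (ι → ℝ) × ℝ =>
      ENNReal.ofReal ((p.2 + score ρ a p.1 p.2 - θ i) ^ 2) := by fun_prop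
    exact this.lintegral_prod_right'
  rw [lintegral_add_left mA, lintegral_const_mul' _ _ ENNReal.ofReal_ne_top,
    lintegral_add_right _ measurable_const, lintegral_const_mul' _ _ ENNReal.ofReal_ne_top,
    lintegral_const, measure_univ, mul_one]
  have b1 := lintegral_score_error ha θ hρ hρ1 he
  have b2 := lintegral_score_sq_le θ hρ hρ1 ha he
  have b3 : ∫⁻ X, ∑ i, ∫⁻ x, ENNReal.ofReal ((x + score ρ a X x - θ i) ^ 2)
      ∂(gaussianReal (θ i) 1) ∂(gaussProd θ) ≤
      ∑ i, ∫⁻ x, ENNReal.ofReal ((h x - θ i) ^ 2) ∂(gaussianReal (θ i) 1) +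
        Fintype.card ι * (2 * ENNReal.ofReal E + 2 * regBias ρ θ) := by
    refine (lintegral_mono hle).trans ?_
    rw [lintegral_add_left measurable_const, lintegral_const, measure_univ, mul_one,
      lintegral_const_mul' _ _ (ENNReal.natCast_ne_top _), lintegral_add_right _ measurable_const,
      lintegral_const_mul' _ _ ENNReal.ofNat_ne_top, lintegral_const, measure_univ, mul_one]
    gcongr
  rw [← hE] at b1 b2
  refine (add_le_add b3 (mul_le_mul_right (add_le_add (mul_le_mul_right b2 _) le_rfl) _)).trans ?_
  have hQ : 0 ≤ 2 * E + 4 * (Real.log (1 / ρ) + 1) := by positivity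
  generalize 2 * E + 4 * (Real.log (1 / ρ) + 1) = Q at *
  have e : ENNReal.ofReal (2 * E + δ * (6 * Q + 2 + 4 * a ^ 2)) = 2 * ENNReal.ofReal E +
      ENNReal.ofReal δ * (ENNReal.ofReal 6 * ENNReal.ofReal Q +
        ENNReal.ofReal (2 + 4 * a ^ 2)) := by
    rw [ENNReal.ofReal_add (by positivity) (by positivity), ENNReal.ofReal_mul zero_le_two,
      ENNReal.ofReal_mul hδ0, add_assoc, ENNReal.ofReal_add (by positivity) (by positivity),
      ENNReal.ofReal_mul (by norm_num : (0 : ℝ) ≤ 6), ENNReal.ofReal_ofNat 2]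
  rw [e]
  exact le_of_eq (by ring)

end Regularised

/-! ### Gaussian tails -/

theorem integrable_sq_mul_exp : Integrable fun x : ℝ => x ^ 2 * Real.exp (-x ^ 2 / 2) := by
  have := integrable_rpow_mul_exp_neg_mul_sq (b := 1 / 2) (by norm_num) (s := 2) (by norm_num)
  refine this.congr (Eventually.of_forall fun u => ?_)
  simp only [Real.rpow_ofNat]
  congr 2; ring

/-- Adding `x⁻²` to the factor `x²` gives an exact primitive, `-(x + 1/x) exp (-x²/2)`, and `y + 1/y
≤ 2y` for y ≥ 1. -/
theorem integral_Ioi_sq_mul_exp_le {y : ℝ} (hy : 1 ≤ y) :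
    ∫ x in Set.Ioi y, x ^ 2 * Real.exp (-x ^ 2 / 2) ≤ 2 * y * Real.exp (-y ^ 2 / 2) := by
  have hpos : ∀ x ∈ Set.Ici y, 0 < x := fun x hx => by
    have := Set.mem_Ici.1 hx; linarith
  have hd : ∀ x ∈ Set.Ici y, HasDerivAt (fun x : ℝ => -((x + x⁻¹) * Real.exp (-x ^ 2 / 2)))
      ((x ^ 2 + (x ^ 2)⁻¹) * Real.exp (-x ^ 2 / 2)) x := fun x hx => by
    have hx0 := (hpos x hx).ne'
    have h2 : HasDerivAt (fun u : ℝ => Real.exp (-u ^ 2 / 2))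
        (Real.exp (-x ^ 2 / 2) * (-(2 * x) / 2)) x := by
      have := (((hasDerivAt_pow 2 x).neg).div_const 2).exp
      simpa using this
    refine (((hasDerivAt_id x).add (hasDerivAt_inv hx0)).mul h2).neg.congr_deriv ?_
    simp only [Pi.add_apply, id]
    field_simp
    ring
  have hnn : ∀ x ∈ Set.Ioi y, 0 ≤ (x ^ 2 + (x ^ 2)⁻¹) * Real.exp (-x ^ 2 / 2) := fun x _ => by
    positivity
  have hlim : Tendsto (fun x : ℝ => -((x + x⁻¹) * Real.exp (-x ^ 2 / 2))) atTop (𝓝 0) := by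
    refine squeeze_zero_norm' (a := fun x : ℝ => 2 * (x ^ 1 * Real.exp (-x))) ?_ ?_
    · filter_upwards [eventually_ge_atTop 2] with x hx
      have h1 : x⁻¹ ≤ x := (inv_le_one_of_one_le₀ (by linarith)).trans (by linarith)
      have h2 : 0 ≤ x⁻¹ := by positivity
      rw [norm_neg, norm_mul, Real.norm_eq_abs, Real.norm_eq_abs, abs_of_pos (Real.exp_pos _),
        abs_of_nonneg (by linarith), pow_one, ← mul_assoc]
      gcongr
      · linarith
      · nlinarith
    · simpa using (Real.tendsto_pow_mul_exp_neg_atTop_nhds_zero 1).const_mul 2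
  have h1 := integral_Ioi_of_hasDerivAt_of_nonneg' hd hnn hlim
  have h2 := integrableOn_Ioi_deriv_of_nonneg' hd hnn hlim
  calc _ ≤ ∫ x in Set.Ioi y, (x ^ 2 + (x ^ 2)⁻¹) * Real.exp (-x ^ 2 / 2) := by
        refine integral_mono integrable_sq_mul_exp.integrableOn h2 fun x => ?_
        have : 0 ≤ (x ^ 2)⁻¹ := by positivity
        simp only []
        gcongr
        linarith
    _ ≤ _ := by
        rw [h1, zero_sub, neg_neg]
        gcongr
        have : y⁻¹ ≤ 1 := inv_le_one_of_one_le₀ hy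
        linarith

theorem two_le_sqrt_two_pi : 2 ≤ √(2 * π) := by
  refine Real.le_sqrt_of_sq_le ?_
  linarith [Real.pi_gt_three]

theorem lintegral_gaussian_sub (t : ℝ) (F : ℝ → ℝ≥0∞) :
    ∫⁻ x, F (x - t) ∂(gaussianReal t 1) = ∫⁻ z, F z ∂(gaussianReal 0 1) := by
  rw [lintegral_gaussian, lintegral_gaussian,
    ← lintegral_sub_right_eq_self (fun z => ENNReal.ofReal (npdf 0 z) * F z) t]
  simp [npdf]

/-- There are two tails, and their factor 2 is cancelled by `√(2π) ≥ 2`. -/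
theorem lintegral_tail_le {y : ℝ} (hy : 1 ≤ y) (t : ℝ) :
    ∫⁻ x, (if y ≤ |x - t| then ENNReal.ofReal ((x - t) ^ 2) else 0) ∂(gaussianReal t 1) ≤
      ENNReal.ofReal (2 * y * Real.exp (-y ^ 2 / 2)) := by
  rw [lintegral_gaussian_sub t fun z => if y ≤ |z| then ENNReal.ofReal (z ^ 2) else 0,
    lintegral_gaussian]
  set f : ℝ → ℝ := fun z => (Set.Ici y).indicator (fun z => z ^ 2 * Real.exp (-z ^ 2 / 2)) z
    with hf
  have hfabs : ∀ z, f |z| = {z : ℝ | y ≤ |z|}.indicator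
      (fun z => z ^ 2 * Real.exp (-z ^ 2 / 2)) z := fun z => by
    simp [hf, Set.indicator_apply, sq_abs]
  have hms : MeasurableSet {z : ℝ | y ≤ |z|} :=
    measurableSet_le measurable_const (by fun_prop)
  have hfi : Integrable fun z => f |z| := by
    simp_rw [hfabs]
    exact integrable_sq_mul_exp.indicator hms
  have hfn : ∀ z, 0 ≤ f z := fun z => by
    simp only [hf]
    exact Set.indicator_nonneg (fun z _ => by positivity) z
  have e : ∀ z, ENNReal.ofReal (npdf 0 z) * (if y ≤ |z| then ENNReal.ofReal (z ^ 2) else 0) =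
      ENNReal.ofReal ((√(2 * π))⁻¹) * ENNReal.ofReal (f |z|) := fun z => by
    rw [hfabs, Set.indicator_apply]
    simp only [Set.mem_ofPred_eq]
    split_ifs with h
    · rw [← ENNReal.ofReal_mul (npdf_pos _ _).le, ← ENNReal.ofReal_mul (by positivity)]
      congr 1
      unfold npdf; rw [sub_zero]; ring
    · simp
  simp_rw [e]
  rw [lintegral_const_mul' _ _ ENNReal.ofReal_ne_top, ← ofReal_integral_eq_lintegral_ofReal hfi
    (Eventually.of_forall fun z => hfn _), ← ENNReal.ofReal_mul (by positivity)]
  refine ENNReal.ofReal_le_ofReal ?_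
  rw [integral_comp_abs]
  have h1 : ∫ x in Set.Ioi 0, f x = ∫ x in Set.Ioi y, x ^ 2 * Real.exp (-x ^ 2 / 2) := by
    rw [hf, setIntegral_indicator measurableSet_Ici, ← integral_Ici_eq_integral_Ioi]
    congr 2
    ext z
    simp only [Set.mem_inter_iff, Set.mem_Ioi, Set.mem_Ici]
    exact ⟨fun h => h.2, fun h => ⟨by linarith, h⟩⟩
  rw [h1, inv_mul_le_iff₀ (by positivity)]
  have h2 := integral_Ioi_sq_mul_exp_le hy
  have h3 : 0 ≤ 2 * y * Real.exp (-y ^ 2 / 2) := by positivity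
  nlinarith [two_le_sqrt_two_pi]

/-! ### The regularisation bias -/

section Bias

variable {ι : Type*} [Fintype ι] (θ : ι → ℝ)

theorem measurableSet_mix_lt (ρ : ℝ) : MeasurableSet {x | mix θ x < ρ} :=
  measurableSet_lt (continuous_mix θ).measurable measurable_const

theorem regBias_eq (ρ : ℝ) : regBias ρ θ = ∫⁻ x, {x | mix θ x < ρ}.indicator
    (fun x => ENNReal.ofReal (mixD θ x ^ 2 / mix θ x)) x := by
  simp [regBias, Set.indicator_apply]

variable [Nonempty ι]

/-- Convexity of Fisher information, localised to S: pointwise it is Cauchy-Schwarz over the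
components. -/
theorem card_mul_lintegral_fisher_le (S : Set ℝ) (hS : MeasurableSet S) :
    (Fintype.card ι : ℝ≥0∞) * ∫⁻ x, S.indicator
      (fun x => ENNReal.ofReal (mixD θ x ^ 2 / mix θ x)) x ≤
    ∑ i, ∫⁻ x, S.indicator (fun x => ENNReal.ofReal ((x - θ i) ^ 2)) x
      ∂(gaussianReal (θ i) 1) := by
  have hn := card_pos_real (ι := ι)
  simp_rw [lintegral_gaussian]
  rw [← lintegral_finsetSum, ← lintegral_const_mul' _ _ (ENNReal.natCast_ne_top _)]
  · refine lintegral_mono fun x => ?_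
    by_cases hx : x ∈ S
    · simp only [Set.indicator_of_mem hx]
      have e : ∀ i, ENNReal.ofReal (npdf (θ i) x) * ENNReal.ofReal ((x - θ i) ^ 2) =
          ENNReal.ofReal ((x - θ i) ^ 2 * npdf (θ i) x) := fun i => by
        rw [← ENNReal.ofReal_mul (npdf_pos _ _).le, mul_comm]
      simp_rw [e]
      rw [← ENNReal.ofReal_sum_of_nonneg fun i _ => mul_nonneg (sq_nonneg _) (npdf_pos _ _).le,
        ← ENNReal.ofReal_natCast, ← ENNReal.ofReal_mul hn.le]
      refine ENNReal.ofReal_le_ofReal ?_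
      have h := mixD_sq_le θ x
      have hf := mix_pos θ x
      rw [← div_le_iff₀' hf] at h
      calc _ ≤ (Fintype.card ι : ℝ) * ((1 / (Fintype.card ι : ℝ)) *
            ∑ i, (x - θ i) ^ 2 * npdf (θ i) x) := by gcongr
        _ = _ := by field_simp
    · simp [Set.indicator_of_notMem hx]
  · intro i _
    have h1 := (continuous_npdf (θ i)).measurable
    have h2 : Measurable fun x : ℝ => ENNReal.ofReal ((x - θ i) ^ 2) := by fun_prop
    exact (h1.ennreal_ofReal).mul (h2.indicator hS)

theorem lintegral_indicator_sq_le_one (S : Set ℝ) (t : ℝ) :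
    ∫⁻ x, S.indicator (fun x => ENNReal.ofReal ((x - t) ^ 2)) x ∂(gaussianReal t 1) ≤ 1 := by
  rw [← lintegral_sq_sub_gaussian t]
  exact lintegral_mono fun x => Set.indicator_le_self _ _ x

theorem card_mul_regBias_le (ρ : ℝ) : (Fintype.card ι : ℝ≥0∞) * regBias ρ θ ≤ Fintype.card ι := by
  rw [regBias_eq]
  refine (card_mul_lintegral_fisher_le θ _ (measurableSet_mix_lt θ ρ)).trans ?_
  calc _ ≤ ∑ _i : ι, (1 : ℝ≥0∞) :=
        Finset.sum_le_sum fun i _ => lintegral_indicator_sq_le_one _ (θ i)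
    _ = _ := by simp

theorem lintegral_indicator_sq_le_tail {S : Set ℝ} {y t : ℝ} (hy : 1 ≤ y)
    (h : ∀ x ∈ S, y ≤ |x - t|) :
    ∫⁻ x, S.indicator (fun x => ENNReal.ofReal ((x - t) ^ 2)) x ∂(gaussianReal t 1) ≤
      ENNReal.ofReal (2 * y * Real.exp (-y ^ 2 / 2)) := by
  refine le_trans (lintegral_mono fun x => ?_) (lintegral_tail_le hy t)
  by_cases hx : x ∈ S
  · simp [Set.indicator_of_mem hx, h x hx]
  · simp [Set.indicator_of_notMem hx]

/-- Inside `[-2y, 2y]` the pointwise bound for `f'²/f` is multiplied by the length 4y. Outside, the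
information is distributed over the components: a mean with `|θ_i| ≤ y` sees only a Gaussian tail
beyond y. -/
theorem card_mul_regBias_le_of_truncation {ρ y q : ℝ} (hρ1 : ρ ≤ 1) (hρ : 0 < ρ) (hy : 1 ≤ y)
    (hq : 0 < q) :
    (Fintype.card ι : ℝ≥0∞) * regBias ρ θ ≤
      Fintype.card ι * ENNReal.ofReal (8 * y * ρ * (Real.log (1 / ρ) + 1) +
        2 * y * Real.exp (-y ^ 2 / 2)) + ∑ i, ENNReal.ofReal ((|θ i| / y) ^ q) := by
  have hy0 : 0 < y := by linarith
  have hlog : 0 ≤ Real.log (1 / ρ) := Real.log_nonneg ((one_le_div hρ).2 hρ1)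
  set S : Set ℝ := {x | 2 * y < |x|} with hSdef
  have hS : MeasurableSet S := measurableSet_lt measurable_const (by fun_prop)
  have hsplit : regBias ρ θ ≤ ENNReal.ofReal (8 * y * ρ * (Real.log (1 / ρ) + 1)) +
      ∫⁻ x, S.indicator (fun x => ENNReal.ofReal (mixD θ x ^ 2 / mix θ x)) x := by
    have h0 : ENNReal.ofReal (8 * y * ρ * (Real.log (1 / ρ) + 1)) =
        ∫⁻ x, (Set.Icc (-(2 * y)) (2 * y)).indicator
          (fun _ => ENNReal.ofReal (2 * ρ * (Real.log (1 / ρ) + 1))) x := by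
      rw [lintegral_indicator_const measurableSet_Icc, Real.volume_Icc,
        ← ENNReal.ofReal_mul (by positivity)]
      congr 1; ring
    rw [h0, ← lintegral_add_left (measurable_const.indicator measurableSet_Icc), regBias_eq]
    refine lintegral_mono fun x => ?_
    by_cases hx : mix θ x < ρ
    · rw [Set.indicator_of_mem (by exact hx)]
      by_cases hxS : x ∈ S
      · rw [Set.indicator_of_mem hxS]
        exact le_add_self
      · rw [Set.indicator_of_notMem hxS, add_zero, Set.indicator_of_mem]
        · exact ENNReal.ofReal_le_ofReal (mixD_sq_div_le_of_lt θ x hx hρ1)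
        · exact Set.mem_Icc.2 (abs_le.1 (not_lt.1 hxS))
    · rw [Set.indicator_of_notMem (by exact hx)]
      exact zero_le
  refine (mul_le_mul_right hsplit _).trans ?_
  rw [mul_add, ENNReal.ofReal_add (by positivity) (by positivity),
    mul_add (Fintype.card ι : ℝ≥0∞) (ENNReal.ofReal _), add_assoc]
  refine add_le_add le_rfl ((card_mul_lintegral_fisher_le θ S hS).trans ?_)
  rw [← nsmul_eq_mul, ← Finset.card_univ, ← Finset.sum_const, ← Finset.sum_add_distrib]
  refine Finset.sum_le_sum fun i _ => ?_
  rcases lt_or_ge y |θ i| with h | h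
  -- A mean beyond y pays its whole Fisher information 1, which is at most `(|θ_i|/y)^q`.
  · refine (lintegral_indicator_sq_le_one S (θ i)).trans (le_trans ?_ le_add_self)
    rw [ENNReal.one_le_ofReal]
    exact Real.one_le_rpow ((one_le_div hy0).2 h.le) hq.le
  · refine le_trans (lintegral_indicator_sq_le_tail hy fun x hx => ?_) le_self_add
    have h1 : 2 * y < |x| := hx
    have := abs_sub_abs_le_abs_sub x (θ i)
    linarith

theorem half_npdf_le_mix {a : ℝ}
    (hcount : (Fintype.card ι : ℝ) ≤ 2 * (Finset.univ.filter fun i => |θ i| ≤ 1 / a).card) (x : ℝ) :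
    1 / 2 * npdf 0 (|x| + 1 / a) ≤ mix θ x := by
  have hn := card_pos_real (ι := ι)
  set A := Finset.univ.filter fun i => |θ i| ≤ 1 / a with hA
  have h1 : ∀ i ∈ A, npdf 0 (|x| + 1 / a) ≤ npdf (θ i) x := fun i hi => by
    have hi' : |θ i| ≤ 1 / a := (Finset.mem_filter.1 hi).2
    refine mul_le_mul_of_nonneg_left (Real.exp_le_exp.2 ?_) (by positivity)
    have h := pow_le_pow_left₀ (abs_nonneg _)
      ((abs_sub x (θ i)).trans (add_le_add_right hi' |x|)) 2
    rw [sq_abs] at h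
    rw [sub_zero]
    linarith
  have h2 : (A.card : ℝ) * npdf 0 (|x| + 1 / a) ≤ ∑ i, npdf (θ i) x :=
    calc _ = ∑ _i ∈ A, npdf 0 (|x| + 1 / a) := by simp
      _ ≤ ∑ i ∈ A, npdf (θ i) x := Finset.sum_le_sum h1
      _ ≤ _ := Finset.sum_le_sum_of_subset_of_nonneg (Finset.subset_univ _)
          fun i _ _ => (npdf_pos _ _).le
  unfold mix
  rw [one_div (Fintype.card ι : ℝ), le_inv_mul_iff₀ hn]
  refine le_trans ?_ h2
  have := npdf_pos 0 (|x| + 1 / a)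
  nlinarith

/-- With half of the means within 1/a of 0, f dominates half a normal density, so f < ρ forces `|x|
> Y - 1/a`. Means up to 1/a leave a tail beyond `Y - 2/a`; means between 1/a and 1 leave a tail at
most `1/a² ≤ θ_i² ≤ |θ_i|^q`; larger ones pay `1 ≤ |θ_i|^q`. -/
theorem card_mul_regBias_le_of_sparse {ρ a Y q : ℝ} (ha : 1 ≤ a)
    (hcount : (Fintype.card ι : ℝ) ≤ 2 * (Finset.univ.filter fun i => |θ i| ≤ 1 / a).card)
    (hY : 3 ≤ Y) (hρY : ρ ≤ 1 / 2 * npdf 0 Y)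
    (hYa : 2 * Y * Real.exp (-(Y - 2) ^ 2 / 2) ≤ 1 / a ^ 2) (hq : 0 < q) (hq2 : q ≤ 2) :
    (Fintype.card ι : ℝ≥0∞) * regBias ρ θ ≤
      Fintype.card ι * ENNReal.ofReal (2 * Y * Real.exp (-(Y - 2 / a) ^ 2 / 2)) +
        ∑ i, ENNReal.ofReal (|θ i| ^ q) := by
  have ha0 : 0 < a := by linarith
  have ha1 : 1 / a ≤ 1 := (div_le_one ha0).2 ha
  have ha1' : 0 < 1 / a := by positivity
  rw [regBias_eq]
  refine (card_mul_lintegral_fisher_le θ _ (measurableSet_mix_lt θ ρ)).trans ?_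
  rw [← nsmul_eq_mul, ← Finset.card_univ, ← Finset.sum_const, ← Finset.sum_add_distrib]
  refine Finset.sum_le_sum fun i _ => ?_
  have hmem : ∀ x ∈ {x | mix θ x < ρ}, Y - 1 / a - |θ i| ≤ |x - θ i| := fun x hx => by
    have h1 := (half_npdf_le_mix θ hcount x).trans_lt ((show mix θ x < ρ from hx).trans_le hρY)
    have h2 : Y < |x| + 1 / a := by
      by_contra! hcon
      have h3 : npdf 0 Y ≤ npdf 0 (|x| + 1 / a) := by
        refine mul_le_mul_of_nonneg_left (Real.exp_le_exp.2 ?_) (by positivity)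
        have := pow_le_pow_left₀ (by positivity) hcon 2
        simp only [sub_zero]
        linarith
      linarith
    have := abs_sub_abs_le_abs_sub x (θ i)
    linarith
  rcases le_or_gt |θ i| (1 / a) with h | h
  · refine le_trans (lintegral_indicator_sq_le_tail (y := Y - 2 / a) ?_ fun x hx => ?_)
      (le_trans ?_ le_self_add)
    · have : 2 / a = 2 * (1 / a) := by ring
      linarith
    · have := hmem x hx
      have : 2 / a = 2 * (1 / a) := by ring
      linarith
    · refine ENNReal.ofReal_le_ofReal ?_
      have : 0 ≤ 2 / a := by positivity
      gcongr
      linarith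
  · rcases le_or_gt |θ i| 1 with h1 | h1
    · refine le_trans (lintegral_indicator_sq_le_tail (y := Y - 2) (by linarith) fun x hx => ?_)
        (le_trans ?_ le_add_self)
      · have := hmem x hx
        linarith
      · refine ENNReal.ofReal_le_ofReal ?_
        calc 2 * (Y - 2) * Real.exp (-(Y - 2) ^ 2 / 2) ≤
              2 * Y * Real.exp (-(Y - 2) ^ 2 / 2) := by gcongr; linarith
          _ ≤ (1 / a) ^ 2 := by rw [one_div_pow]; exact hYa
          _ ≤ |θ i| ^ 2 := by gcongr
          _ ≤ |θ i| ^ q := by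
            rw [← Real.rpow_natCast]
            exact Real.rpow_le_rpow_of_exponent_ge (ha1'.trans h) h1 (by exact_mod_cast hq2)
    · refine (lintegral_indicator_sq_le_one _ (θ i)).trans (le_trans ?_ le_add_self)
      rw [ENNReal.one_le_ofReal]
      exact Real.one_le_rpow h1.le hq.le

end Bias

/-! ### Soft thresholding -/

section Soft

variable {l : ℝ} (hl : 0 ≤ l)

include hl in
-- The identity minus a clamp to [-l, l]; boundedness, measurability and the Lipschitz property can
-- be read off this form.
theorem softThreshold_eq (x : ℝ) : softThreshold l x = x - max (-l) (min x l) := by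
  unfold softThreshold
  rcases lt_trichotomy x 0 with h | rfl | h
  · rw [Real.sign_of_neg h, abs_of_neg h, min_eq_left (by linarith)]
    rcases le_total (-l) x with h1 | h1
    · rw [max_eq_right (by linarith), max_eq_right h1]; ring
    · rw [max_eq_left (by linarith), max_eq_left h1]; ring
  · simp [hl]
  · rw [Real.sign_of_pos h, abs_of_pos h, max_eq_right (a := -l) (le_min (by linarith) (by linarith))]
    rcases le_total x l with h1 | h1
    · rw [max_eq_right (by linarith), min_eq_left h1]; ring
    · rw [max_eq_left (by linarith), min_eq_right h1]; ring

include hl in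
theorem abs_softThreshold_sub_self_le (x : ℝ) : |softThreshold l x - x| ≤ l := by
  rw [softThreshold_eq hl, sub_sub_cancel_left, abs_neg, abs_le]
  exact ⟨le_max_left _ _, max_le (by linarith) (min_le_right _ _)⟩

include hl in
theorem measurable_softThreshold : Measurable (softThreshold l) := by
  have : softThreshold l = fun x => x - max (-l) (min x l) := funext (softThreshold_eq hl)
  rw [this]
  fun_prop

theorem abs_softThreshold_le (x : ℝ) : |softThreshold l x| ≤ max (|x| - l) 0 := by
  unfold softThreshold
  rw [abs_mul, abs_of_nonneg (le_max_right (|x| - l) 0)]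
  refine mul_le_of_le_one_left (le_max_right _ _) ?_
  rcases Real.sign_apply_eq x with h | h | h <;> rw [h] <;> norm_num

include hl in
-- Compare with thresholding the pure noise x - t: the clamp is 1-Lipschitz, so the two errors
-- differ by at most |t|.
theorem sq_softThreshold_sub_le (x t : ℝ) :
    (softThreshold l x - t) ^ 2 ≤ 2 * (max (|x - t| - l) 0) ^ 2 + 2 * t ^ 2 := by
  have h1 := abs_softThreshold_le (l := l) (x - t)
  have h2 : |softThreshold l x - t - softThreshold l (x - t)| ≤ |t| := by
    rw [softThreshold_eq hl, softThreshold_eq hl]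
    have e : x - max (-l) (min x l) - t - (x - t - max (-l) (min (x - t) l)) =
      max (-l) (min (x - t) l) - max (-l) (min x l) := by ring
    rw [e]
    have h3 := abs_max_sub_max_le_abs (min (x - t) l) (min x l) (-l)
    have h4 := abs_min_sub_min_le_max (x - t) l x l
    rw [max_comm (-l), max_comm (-l)]
    refine h3.trans (h4.trans ?_)
    rw [sub_self, abs_zero, sub_sub_cancel_left, abs_neg, max_eq_left (abs_nonneg _)]
  have h3 : |softThreshold l x - t| ≤ max (|x - t| - l) 0 + |t| := by
    have := abs_add_le (softThreshold l x - t - softThreshold l (x - t)) (softThreshold l (x - t))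
    rw [sub_add_cancel] at this
    linarith
  have h4 := pow_le_pow_left₀ (abs_nonneg _) h3 2
  rw [sq_abs] at h4
  rw [← sq_abs t]
  nlinarith [sq_nonneg (max (|x - t| - l) 0 - |t|)]

/-- The quadratic factor is traded for `8/a²` times an exponential, and `z²/2 ≥ a z - a²/2` leaves
decay at rate a/2. Integration beyond a gains another 1/a; the resulting `a⁻³` becomes the `(log n +
1)^(-3/2)` of the theorem. -/
theorem sq_mul_exp_le {a z : ℝ} (ha : 0 < a) (hz : a ≤ z) :
    (z - a) ^ 2 * Real.exp (-z ^ 2 / 2) ≤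
      8 / a ^ 2 * (Real.exp (-a ^ 2 / 2) * (Real.exp (a ^ 2 / 2) * Real.exp (-(a / 2) * z))) := by
  have h1 : (a * (z - a)) ^ 2 / 8 ≤ Real.exp (a * (z - a) / 2) := by
    have := Real.quadratic_le_exp_of_nonneg (x := a * (z - a) / 2)
      (by have := sub_nonneg.2 hz; positivity)
    have h0 : 0 ≤ a * (z - a) / 2 := by have := sub_nonneg.2 hz; positivity
    nlinarith
  have h2 : Real.exp (a * (z - a) / 2) * Real.exp (-z ^ 2 / 2) ≤
      Real.exp (-a ^ 2 / 2) * (Real.exp (a ^ 2 / 2) * Real.exp (-(a / 2) * z)) := by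
    rw [← Real.exp_add, ← Real.exp_add, ← Real.exp_add]
    refine Real.exp_le_exp.2 ?_
    nlinarith [sq_nonneg (z - a)]
  calc _ = 8 / a ^ 2 * ((a * (z - a)) ^ 2 / 8 * Real.exp (-z ^ 2 / 2)) := by field_simp
    _ ≤ 8 / a ^ 2 * (Real.exp (a * (z - a) / 2) * Real.exp (-z ^ 2 / 2)) := by gcongr
    _ ≤ _ := by gcongr

theorem lintegral_soft_excess_le {a : ℝ} (ha : 0 < a) (t : ℝ) :
    ∫⁻ x, ENNReal.ofReal ((max (|x - t| - a) 0) ^ 2) ∂(gaussianReal t 1) ≤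
      ENNReal.ofReal (16 * Real.exp (-a ^ 2 / 2) / a ^ 3) := by
  rw [lintegral_gaussian_sub t fun z => ENNReal.ofReal ((max (|z| - a) 0) ^ 2), lintegral_gaussian]
  set g : ℝ → ℝ := fun z => 8 / a ^ 2 *
    (Real.exp (-a ^ 2 / 2) * (Real.exp (a ^ 2 / 2) * Real.exp (-(a / 2) * z))) with hg
  have hgi : IntegrableOn g (Set.Ioi a) :=
    (((integrableOn_exp_mul_Ioi (a := -(a / 2)) (by linarith) a).const_mul _).const_mul _).const_mul _
  set f : ℝ → ℝ := (Set.Ioi a).indicator g with hf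
  have hfn : ∀ z, 0 ≤ f z := Set.indicator_nonneg fun z _ => by simp only [hg]; positivity
  have hgI : ∫ z in Set.Ioi a, g z = 16 * Real.exp (-a ^ 2 / 2) / a ^ 3 := by
    simp only [hg]
    rw [integral_const_mul, integral_const_mul, integral_const_mul,
      integral_exp_mul_Ioi (by linarith)]
    have : Real.exp (a ^ 2 / 2) * Real.exp (-(a / 2) * a) = 1 := by
      rw [← Real.exp_add, Real.exp_eq_one_iff]; ring
    calc _ = 8 / a ^ 2 * (Real.exp (-a ^ 2 / 2) *
          ((Real.exp (a ^ 2 / 2) * Real.exp (-(a / 2) * a)) * (2 / a))) := by field_simp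
      _ = _ := by rw [this]; field_simp; ring
  have hf2 : ∫ z, f |z| = 2 * (16 * Real.exp (-a ^ 2 / 2) / a ^ 3) := by
    rw [integral_comp_abs, hf, setIntegral_indicator measurableSet_Ioi, ← hgI]
    congr 3
    ext z
    simp only [Set.mem_inter_iff, Set.mem_Ioi]
    exact ⟨fun h => h.2, fun h => ⟨by linarith, h⟩⟩
  -- A non-integrable function would have integral 0 by convention, but the computed value is
  -- positive.
  have hfi : Integrable fun z => f |z| := by
    by_contra h
    rw [integral_undef h] at hf2
    have : 0 < 2 * (16 * Real.exp (-a ^ 2 / 2) / a ^ 3) := by positivity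
    linarith
  calc _ ≤ ∫⁻ z, ENNReal.ofReal ((√(2 * π))⁻¹) * ENNReal.ofReal (f |z|) := by
        refine lintegral_mono fun z => ?_
        simp only []
        rw [← ENNReal.ofReal_mul (npdf_pos _ _).le, ← ENNReal.ofReal_mul (by positivity)]
        refine ENNReal.ofReal_le_ofReal ?_
        rw [npdf, sub_zero, mul_assoc]
        refine mul_le_mul_of_nonneg_left ?_ (by positivity)
        rcases lt_or_ge a |z| with h | h
        · rw [hf, Set.indicator_of_mem (by exact h), max_eq_left (by linarith), mul_comm,
            ← sq_abs z]
          exact sq_mul_exp_le ha h.le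
        · rw [max_eq_right (by linarith)]
          simpa using hfn |z|
    _ = ENNReal.ofReal ((√(2 * π))⁻¹ * (2 * (16 * Real.exp (-a ^ 2 / 2) / a ^ 3))) := by
        rw [lintegral_const_mul' _ _ ENNReal.ofReal_ne_top, ← ofReal_integral_eq_lintegral_ofReal
          hfi (Eventually.of_forall fun z => hfn _), hf2, ← ENNReal.ofReal_mul (by positivity)]
    _ ≤ _ := by
        refine ENNReal.ofReal_le_ofReal ?_
        rw [inv_mul_le_iff₀ (by positivity)]
        exact mul_le_mul_of_nonneg_right two_le_sqrt_two_pi (by positivity)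

theorem lintegral_soft_le {a : ℝ} (ha : 0 < a) (t : ℝ) :
    ∫⁻ x, ENNReal.ofReal ((softThreshold a x - t) ^ 2) ∂(gaussianReal t 1) ≤
      ENNReal.ofReal (32 * Real.exp (-a ^ 2 / 2) / a ^ 3 + 2 * min (t ^ 2) (1 + a ^ 2)) := by
  rcases le_total (t ^ 2) (1 + a ^ 2) with h | h
  · rw [min_eq_left h]
    have hm : Measurable fun x => ENNReal.ofReal (2 * (max (|x - t| - a) 0) ^ 2) := by fun_prop
    calc _ ≤ ∫⁻ x, ENNReal.ofReal (2 * (max (|x - t| - a) 0) ^ 2) + ENNReal.ofReal (2 * t ^ 2)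
          ∂(gaussianReal t 1) := by
          refine lintegral_mono fun x => ?_
          rw [← ENNReal.ofReal_add (by positivity) (by positivity)]
          exact ENNReal.ofReal_le_ofReal (sq_softThreshold_sub_le ha.le x t)
      _ ≤ ENNReal.ofReal 2 * ENNReal.ofReal (16 * Real.exp (-a ^ 2 / 2) / a ^ 3) +
          ENNReal.ofReal (2 * t ^ 2) := by
          rw [lintegral_add_right _ measurable_const, lintegral_const, measure_univ, mul_one]
          simp_rw [ENNReal.ofReal_mul (zero_le_two (α := ℝ))]
          rw [lintegral_const_mul' _ _ ENNReal.ofReal_ne_top]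
          gcongr
          exact lintegral_soft_excess_le ha t
      _ ≤ _ := by
          rw [← ENNReal.ofReal_mul (by norm_num), ← ENNReal.ofReal_add (by positivity)
            (by positivity)]
          refine ENNReal.ofReal_le_ofReal ?_
          have e : 2 * (16 * Real.exp (-a ^ 2 / 2) / a ^ 3) = 32 * Real.exp (-a ^ 2 / 2) / a ^ 3 := by
            ring
          rw [e]
  · rw [min_eq_right h]
    calc _ ≤ ∫⁻ x, ENNReal.ofReal 2 * ENNReal.ofReal ((x - t) ^ 2) + ENNReal.ofReal (2 * a ^ 2)
          ∂(gaussianReal t 1) := by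
          refine lintegral_mono fun x => ?_
          rw [← ENNReal.ofReal_mul (by norm_num), ← ENNReal.ofReal_add (by positivity)
            (by positivity)]
          refine ENNReal.ofReal_le_ofReal ?_
          have h1 := pow_le_pow_left₀ (abs_nonneg _) (abs_softThreshold_sub_self_le ha.le x) 2
          rw [sq_abs] at h1
          nlinarith [sq_nonneg (softThreshold a x - x - (x - t))]
      _ = ENNReal.ofReal (2 + 2 * a ^ 2) := by
          rw [lintegral_add_right _ measurable_const, lintegral_const, measure_univ, mul_one,
            lintegral_const_mul' _ _ ENNReal.ofReal_ne_top, lintegral_sq_sub_gaussian, mul_one,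
            ← ENNReal.ofReal_add (by positivity) (by positivity)]
      _ ≤ _ := by
          refine ENNReal.ofReal_le_ofReal ?_
          have : 0 ≤ 32 * Real.exp (-a ^ 2 / 2) / a ^ 3 := by positivity
          nlinarith

end Soft

/-! ### Concentration of `kappaHat` -/

section Kappa

variable {ι : Type*} [Fintype ι] (θ : ι → ℝ)

/-- The mean of `kappaHat`. -/
def kappa : ℝ := 1 - (1 / (Fintype.card ι : ℝ)) * ∑ i, Real.exp (-θ i ^ 2 / 4)

/-- Complete the square at t/2; the resulting Gaussian has variance 1/2, which accounts for the
factor √2 in `kappaHat`. -/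
theorem integral_exp_gaussian (t : ℝ) :
    ∫ x, √2 * Real.exp (-x ^ 2 / 2) ∂(gaussianReal t 1) = Real.exp (-t ^ 2 / 4) := by
  rw [integral_gaussian_eq]
  have e : ∀ x : ℝ, npdf t x * (√2 * Real.exp (-x ^ 2 / 2)) =
      (√(2 * π))⁻¹ * √2 * Real.exp (-t ^ 2 / 4) * Real.exp (-1 * (x - t / 2) ^ 2) := fun x => by
    have : Real.exp (-(x - t) ^ 2 / 2) * Real.exp (-x ^ 2 / 2) =
        Real.exp (-t ^ 2 / 4) * Real.exp (-1 * (x - t / 2) ^ 2) := by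
      rw [← Real.exp_add, ← Real.exp_add]; congr 1; ring
    unfold npdf
    linear_combination (√(2 * π))⁻¹ * √2 * this
  simp_rw [e]
  rw [integral_const_mul, integral_sub_right_eq_self (fun x => Real.exp (-1 * x ^ 2)),
    integral_gaussian, div_one, Real.sqrt_mul zero_le_two]
  have h2 : √2 ≠ 0 := by positivity
  have hp : √π ≠ 0 := by have := Real.pi_pos; positivity
  field_simp

/-- From `1 + t²/4 ≤ exp (t²/4)` the right side is at least `5 t² / (4 + t²)`. Small κ therefore
means small thresholding risk. -/
theorem min_one_sq_le (t : ℝ) : min 1 (t ^ 2) ≤ 5 * (1 - Real.exp (-t ^ 2 / 4)) := by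
  have h1 : Real.exp (-t ^ 2 / 4) ≤ (1 + t ^ 2 / 4)⁻¹ := by
    rw [neg_div, Real.exp_neg]
    refine inv_anti₀ (by positivity) ?_
    linarith [Real.add_one_le_exp (t ^ 2 / 4)]
  have h2 : 1 - (1 + t ^ 2 / 4)⁻¹ = t ^ 2 / (4 + t ^ 2) := by field_simp; ring
  have h3 : min 1 (t ^ 2) ≤ 5 * (t ^ 2 / (4 + t ^ 2)) := by
    rw [← mul_div_assoc, le_div_iff₀ (by positivity)]
    rcases le_total (t ^ 2) 1 with h | h
    · rw [min_eq_right h]; nlinarith [sq_nonneg t]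
    · rw [min_eq_left h]; linarith
  linarith

theorem one_sub_exp_le {t q : ℝ} (hq : 0 < q) (hq2 : q ≤ 2) :
    1 - Real.exp (-t ^ 2 / 4) ≤ |t| ^ q := by
  rcases le_total |t| 1 with h | h
  · have h1 := Real.add_one_le_exp (-t ^ 2 / 4)
    have h2 : |t| ^ (2 : ℝ) ≤ |t| ^ q := by
      rcases eq_or_lt_of_le (abs_nonneg t) with h0 | h0
      · rw [← h0, Real.zero_rpow two_ne_zero, Real.zero_rpow hq.ne']
      · exact Real.rpow_le_rpow_of_exponent_ge h0 h hq2
    rw [Real.rpow_ofNat, sq_abs] at h2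
    nlinarith [sq_nonneg t]
  · have := Real.one_le_rpow h hq.le
    linarith [Real.exp_pos (-t ^ 2 / 4)]

theorem continuous_kappaHat : Continuous fun X : ι → ℝ => kappaHat Finset.univ X := by
  unfold kappaHat; fun_prop

/-- For a rule within G of the data, the loss on A is bounded as long as the noise is below y; the
remaining noise is paid by its tail. Losses on rare events are then controlled by their probability.
-/
theorem sum_lintegral_indicator_rule_le {A : Set (ι → ℝ)} (hA : MeasurableSet A)
    {r : (ι → ℝ) → ι → ℝ} {G : ℝ} (hr : ∀ X i, |r X i - X i| ≤ G) {y : ℝ} (hy : 1 ≤ y) :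
    ∑ i, ∫⁻ X, A.indicator (fun X => ENNReal.ofReal ((r X i - θ i) ^ 2)) X ∂(gaussProd θ) ≤
      Fintype.card ι * (ENNReal.ofReal (2 * G ^ 2 + 2 * y ^ 2) * gaussProd θ A +
        ENNReal.ofReal (4 * y * Real.exp (-y ^ 2 / 2))) := by
  rw [← nsmul_eq_mul, ← Finset.card_univ, ← Finset.sum_const]
  refine Finset.sum_le_sum fun i _ => ?_
  have hm : Measurable fun x : ℝ =>
      if y ≤ |x - θ i| then ENNReal.ofReal ((x - θ i) ^ 2) else 0 :=
    Measurable.ite (measurableSet_le measurable_const (by fun_prop)) (by fun_prop) measurable_const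
  calc _ ≤ ∫⁻ X, A.indicator (fun _ => ENNReal.ofReal (2 * G ^ 2 + 2 * y ^ 2)) X + ENNReal.ofReal 2 *
        (if y ≤ |X i - θ i| then ENNReal.ofReal ((X i - θ i) ^ 2) else 0) ∂(gaussProd θ) := by
        refine lintegral_mono fun X => ?_
        by_cases hX : X ∈ A
        · simp only [Set.indicator_of_mem hX]
          have h1 := pow_le_pow_left₀ (abs_nonneg _) (hr X i) 2
          rw [sq_abs] at h1
          have h2 : (r X i - θ i) ^ 2 ≤ 2 * G ^ 2 + 2 * (X i - θ i) ^ 2 := by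
            nlinarith [sq_nonneg (r X i - X i - (X i - θ i))]
          split_ifs with h
          · rw [← ENNReal.ofReal_mul (by norm_num), ← ENNReal.ofReal_add (by positivity)
              (by positivity)]
            refine ENNReal.ofReal_le_ofReal ?_
            nlinarith [sq_nonneg y]
          · rw [mul_zero, add_zero]
            refine ENNReal.ofReal_le_ofReal ?_
            have h3 := pow_le_pow_left₀ (abs_nonneg _) (not_le.1 h).le 2
            rw [sq_abs] at h3
            linarith
        · simp [Set.indicator_of_notMem hX]
    _ ≤ _ := by
        rw [lintegral_add_left (measurable_const.indicator hA), lintegral_indicator_const hA,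
          lintegral_const_mul' _ _ ENNReal.ofReal_ne_top, lintegral_eval_gaussProd θ i hm]
        refine add_le_add le_rfl ((mul_le_mul_right (lintegral_tail_le hy (θ i)) _).trans ?_)
        rw [← ENNReal.ofReal_mul (by norm_num)]
        exact ENNReal.ofReal_le_ofReal (le_of_eq (by ring))

variable [Nonempty ι]

theorem kappa_eq_avg : kappa θ = (1 / (Fintype.card ι : ℝ)) * ∑ i, (1 - Real.exp (-θ i ^ 2 / 4)) := by
  have hn := card_pos_real (ι := ι)
  rw [Finset.sum_sub_distrib, mul_sub, kappa]
  congr 1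
  simp

theorem sum_min_one_sq_le : ∑ i, min 1 (θ i ^ 2) ≤ Fintype.card ι * (5 * kappa θ) := by
  have hn := card_pos_real (ι := ι)
  refine (Finset.sum_le_sum fun i _ => min_one_sq_le (θ i)).trans (le_of_eq ?_)
  rw [← Finset.mul_sum, kappa_eq_avg]
  field_simp

theorem kappa_le_avg_rpow {q : ℝ} (hq : 0 < q) (hq2 : q ≤ 2) :
    kappa θ ≤ (1 / (Fintype.card ι : ℝ)) * ∑ i, |θ i| ^ q := by
  rw [kappa_eq_avg]
  gcongr
  exact one_sub_exp_le hq hq2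

/-- Hoeffding for the independent variables `√2 exp (-X_i²/2)`, which lie in [0, √2]. -/
theorem hoeffding_kappa {lam : ℝ} (hl : 0 ≤ lam) :
    gaussProd θ {X | kappaHat Finset.univ X ≤ kappa θ - lam} ≤
        ENNReal.ofReal (Real.exp (-(Fintype.card ι * lam ^ 2))) ∧
    gaussProd θ {X | kappa θ + lam ≤ kappaHat Finset.univ X} ≤
        ENNReal.ofReal (Real.exp (-(Fintype.card ι * lam ^ 2))) := by
  have hn := card_pos_real (ι := ι)
  set n : ℝ := (Fintype.card ι : ℝ) with hndef
  let Y : ι → ℝ → ℝ := fun i x => √2 * Real.exp (-x ^ 2 / 2) - Real.exp (-θ i ^ 2 / 4)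
  have hYm : ∀ i, Measurable (Y i) := fun i => by simp only [Y]; fun_prop
  have hind : iIndepFun (fun i (X : ι → ℝ) => Y i (X i)) (gaussProd θ) :=
    iIndepFun_pi fun i => (hYm i).aemeasurable
  have hsub : ∀ i, HasSubgaussianMGF (fun X : ι → ℝ => Y i (X i)) ((‖√2 - 0‖₊ / 2) ^ 2)
      (gaussProd θ) := fun i => by
    have hm : Measurable fun X : ι → ℝ => √2 * Real.exp (-X i ^ 2 / 2) := by fun_prop
    have h := hasSubgaussianMGF_of_mem_Icc (μ := gaussProd θ) (a := 0) (b := √2) hm.aemeasurable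
      (Eventually.of_forall fun X => ⟨by positivity, ?_⟩)
    · have e : ∫ X : ι → ℝ, √2 * Real.exp (-X i ^ 2 / 2) ∂(gaussProd θ) =
          Real.exp (-θ i ^ 2 / 4) := by
        rw [← integral_exp_gaussian]
        exact integral_eval_gaussProd θ i (g := fun x => √2 * Real.exp (-x ^ 2 / 2)) (by fun_prop)
      rw [e] at h
      exact h
    · refine mul_le_of_le_one_right (by positivity) ?_
      rw [Real.exp_le_one_iff]
      nlinarith [sq_nonneg (X i)]
  -- Each variance proxy is `(√2/2)² = 1/2`, so the exponent is exactly `-n λ²`.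
  have hc : 2 * ((∑ _i : ι, (‖√2 - 0‖₊ / 2) ^ 2 : ℝ≥0) : ℝ) = n := by
    have : (((‖√2 - 0‖₊ / 2) ^ 2 : ℝ≥0) : ℝ) = 1 / 2 := by
      push_cast
      rw [sub_zero, Real.norm_eq_abs, abs_of_nonneg (Real.sqrt_nonneg _), div_pow,
        Real.sq_sqrt zero_le_two]
      norm_num
    rw [NNReal.coe_sum, this, Finset.sum_const, Finset.card_univ, nsmul_eq_mul]
    ring
  have hexp : -(n * lam) ^ 2 / (2 * ((∑ _i : ι, (‖√2 - 0‖₊ / 2) ^ 2 : ℝ≥0) : ℝ)) =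
      -(n * lam ^ 2) := by
    rw [hc]; field_simp
  have hk : ∀ X : ι → ℝ, ∑ i, Y i (X i) = n * (kappa θ - kappaHat Finset.univ X) := fun X => by
    simp only [Y, kappa, kappaHat, Finset.card_univ]
    rw [Finset.sum_sub_distrib, ← Finset.mul_sum]
    field_simp
    ring
  have hnl : 0 ≤ n * lam := by positivity
  have h1 := HasSubgaussianMGF.measure_sum_ge_le_of_iIndepFun hind (s := Finset.univ)
    (fun i _ => hsub i) hnl
  have hind' : iIndepFun (fun i (X : ι → ℝ) => -Y i (X i)) (gaussProd θ) :=
    iIndepFun_pi (X := fun i x => -Y i x) fun i => (hYm i).neg.aemeasurable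
  have h2 := HasSubgaussianMGF.measure_sum_ge_le_of_iIndepFun hind' (s := Finset.univ)
    (fun i _ => (hsub i).neg) hnl
  rw [hexp] at h1 h2
  constructor
  · rw [← ofReal_measureReal]
    refine ENNReal.ofReal_le_ofReal (le_trans (le_of_eq ?_) h1)
    congr 1
    ext X
    simp only [Set.mem_ofPred_eq, hk]
    rw [mul_le_mul_iff_right₀ hn]
    constructor <;> intro h <;> linarith
  · rw [← ofReal_measureReal]
    refine ENNReal.ofReal_le_ofReal (le_trans (le_of_eq ?_) h2)
    congr 1
    ext X
    simp only [Set.mem_ofPred_eq, Finset.sum_neg_distrib, hk]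
    rw [← mul_neg, mul_le_mul_iff_right₀ hn]
    constructor <;> intro h <;> linarith

end Kappa

/-! ### Tuning constants in large blocks -/

/-- A block size is large for the tuning `τ` if the asymptotic relations between the bandwidth, the
truncation level and the threshold that are used in the risk bounds hold. -/
structure IsLarge (τ : Tuning) (n : ℕ) : Prop where
  nStar_le : τ.nStar ≤ n
  eight_le_log : 8 ≤ Real.log n
  le_b0 : 16 ≤ τ.b0 ^ 2 * Real.log n
  le_rho : τ.rho0 / 2 * (level n / √n) ≤ τ.rho n
  rho_le : τ.rho n ≤ 2 * τ.rho0 * (level n / √n)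
  rho_le_npdf : τ.rho n ≤ 1 / 2 * npdf 0 3
  two_div_rho0_le : 2 / τ.rho0 ≤ √n
  log_sq_le : Real.log n ^ 2 ≤ √n
  log_rpow_le : (Real.log n + 1) ^ (3 / 2 : ℝ) ≤ n
  level_exp_le : 24 * τ.rho0 * level n ^ 4 * Real.exp (2 * level n) ≤ √n
  level_sq_le : 2 * level n ^ 2 ≤ (n : ℝ) ^ (1 / 8 : ℝ)
  log_rpow_le_rpow : Real.log n ^ (3 / 2 : ℝ) ≤ (n : ℝ) ^ (1 / 8 : ℝ)

theorem eventually_mul_log_rpow_le (C s : ℝ) {r : ℝ} (hr : 0 < r) :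
    ∀ᶠ n : ℕ in atTop, C * Real.log n ^ s ≤ (n : ℝ) ^ r := by
  have h := ((isLittleO_log_rpow_rpow_atTop s hr).def (c := 1 / (|C| + 1)) (by positivity))
  have h' := tendsto_natCast_atTop_atTop (R := ℝ) |>.eventually h
  filter_upwards [h'] with n hn
  rw [Real.norm_eq_abs, Real.norm_eq_abs, abs_of_nonneg (a := (n : ℝ) ^ r) (by positivity)] at hn
  have h1 : C * Real.log n ^ s ≤ (|C| + 1) * |Real.log n ^ s| := by
    refine (le_abs_self _).trans ?_
    rw [abs_mul]
    gcongr
    linarith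
  refine h1.trans ?_
  rw [one_div, inv_mul_eq_div, le_div_iff₀ (by positivity)] at hn
  linarith

theorem tendsto_log_natCast : Tendsto (fun n : ℕ => Real.log n) atTop atTop :=
  Real.tendsto_log_atTop.comp tendsto_natCast_atTop_atTop

theorem tendsto_level : Tendsto level atTop atTop :=
  Real.tendsto_sqrt_atTop.comp (tendsto_log_natCast.const_mul_atTop two_pos)

theorem level_sq (n : ℕ) : level n ^ 2 = 2 * Real.log n :=
  Real.sq_sqrt (mul_nonneg zero_le_two (Real.log_natCast_nonneg n))

theorem exp_neg_level_sq {n : ℕ} (hn : 0 < n) : Real.exp (-level n ^ 2 / 2) = 1 / n := by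
  rw [level_sq n, neg_div, Real.exp_neg, mul_div_cancel_left₀ _ two_ne_zero,
    Real.exp_log (by exact_mod_cast hn), one_div]

theorem rho_eq (τ : Tuning) (n : ℕ) : τ.rho n = (1 + τ.eta n) * τ.rho0 * (level n / √n) := by
  rw [Tuning.rho, Real.sqrt_div (mul_nonneg zero_le_two (Real.log_natCast_nonneg n)), level]

theorem eventually_isLarge (τ : Tuning) : ∀ᶠ n in atTop, IsLarge τ n := by
  have hr := τ.rho0_pos
  have hp : 0 < npdf 0 3 := npdf_pos _ _
  have hη : Tendsto (fun n => 1 + τ.eta n) atTop (𝓝 1) := by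
    simpa using τ.eta_tendsto.const_add 1
  have e1 := hη.eventually (Icc_mem_nhds (by norm_num : (1 / 2 : ℝ) < 1) one_lt_two)
  have e2 := tendsto_log_natCast.eventually_ge_atTop 8
  have e3 := tendsto_log_natCast.eventually_ge_atTop (16 / τ.b0 ^ 2)
  have e4 := eventually_mul_log_rpow_le (8 * τ.rho0 / npdf 0 3) 1 one_half_pos
  have e5 := eventually_mul_log_rpow_le (2 / τ.rho0) 0 one_half_pos
  have e6 := eventually_mul_log_rpow_le 1 2 one_half_pos
  have e7 := eventually_mul_log_rpow_le 4 2 one_pos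
  have e8 := eventually_mul_log_rpow_le 4 1 (r := 1 / 8) (by norm_num)
  have e9 := eventually_mul_log_rpow_le 1 (3 / 2) (r := 1 / 8) (by norm_num)
  have e10 := tendsto_level.eventually_ge_atTop 12
  have e11 := tendsto_level.eventually
    ((Real.isLittleO_pow_exp_atTop (n := 4)).def (c := 1 / (24 * τ.rho0)) (by positivity))
  filter_upwards [e1, e2, e3, e4, e5, e6, e7, e8, e9, e10, e11, eventually_ge_atTop τ.nStar]
    with n h1 h2 h3 h4 h5 h6 h7 h8 h9 h10 h11 h12
  have hn : 0 < n := by have := τ.two_lt_nStar; omega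
  have hn' : (0 : ℝ) < n := by exact_mod_cast hn
  have ha : level n ^ 2 = 2 * Real.log n := level_sq n
  have haL : level n ≤ 2 * Real.log n := by nlinarith
  have hs : (0 : ℝ) < √n := by positivity
  have hq : 0 ≤ level n / √n := by positivity
  simp only [Real.rpow_one, Real.rpow_zero, mul_one, one_mul, Real.rpow_ofNat, ← Real.sqrt_eq_rpow]
    at h4 h5 h6 h7 h8 h9
  have hle : τ.rho n ≤ 2 * τ.rho0 * (level n / √n) := by
    rw [rho_eq]
    have := h1.2
    gcongr
  refine ⟨h12, h2, ?_, ?_, hle, hle.trans ?_, h5, h6, ?_, ?_, by linarith, h9⟩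
  · have := τ.b0_pos
    rw [div_le_iff₀ (by positivity)] at h3
    linarith
  · rw [rho_eq]
    have := mul_le_mul_of_nonneg_right h1.1 (mul_nonneg hr.le hq)
    linarith
  · rw [div_mul_eq_mul_div, div_le_iff₀ hp] at h4
    rw [← mul_div_assoc, div_le_iff₀ hs]
    nlinarith
  · have : (Real.log n + 1) ^ (3 / 2 : ℝ) ≤ (2 * Real.log n) ^ (2 : ℝ) :=
      (Real.rpow_le_rpow (by linarith) (by linarith) (by norm_num)).trans
        (Real.rpow_le_rpow_of_exponent_le (by linarith) (by norm_num))
    rw [Real.rpow_ofNat] at this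
    nlinarith
  -- For level at least 12 this beats `exp (3 level)`, one factor of which swallows the fourth
  -- power.
  · have h13 : √(n : ℝ) = Real.exp (level n ^ 2 / 4) := by
      rw [ha, Real.sqrt_eq_rpow, Real.rpow_def_of_pos hn']
      congr 1; ring
    rw [Real.norm_eq_abs, abs_of_nonneg (by positivity), Real.norm_eq_abs,
      abs_of_nonneg (by positivity), one_div, inv_mul_eq_div, le_div_iff₀ (by positivity)] at h11
    calc _ ≤ Real.exp (level n) * Real.exp (2 * level n) := by
          gcongr; linarith
      _ ≤ _ := by
          rw [← Real.exp_add, h13]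
          refine Real.exp_le_exp.2 ?_
          nlinarith

namespace IsLarge

variable {τ : Tuning} {n : ℕ} (h : IsLarge τ n)

include h

theorem log_pos : 0 < Real.log n := by have := h.eight_le_log; linarith

theorem pos : 0 < n := by have := h.nStar_le; have := τ.two_lt_nStar; omega

theorem cast_pos : (0 : ℝ) < n := by exact_mod_cast h.pos

theorem sqrt_pos : 0 < √(n : ℝ) := Real.sqrt_pos.2 h.cast_pos

theorem sq_sqrt : √(n : ℝ) ^ 2 = n := Real.sq_sqrt h.cast_pos.le

theorem four_le_level : 4 ≤ level n := by
  have h1 := level_sq n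
  have h2 := h.eight_le_log
  have h3 : 0 ≤ level n := Real.sqrt_nonneg _
  nlinarith

theorem log_le : Real.log n ≤ n :=
  (Real.log_le_sub_one_of_pos h.cast_pos).trans (by linarith)

theorem level_le : level n ≤ n := by
  have h1 := level_sq n
  have h2 := h.four_le_level
  have h3 := h.log_le
  nlinarith

theorem one_le_sqrt : 1 ≤ √(n : ℝ) := by
  have := h.log_sq_le
  have := h.eight_le_log
  nlinarith

theorem sqrt_le : √(n : ℝ) ≤ n := by
  have := h.sq_sqrt
  have := h.one_le_sqrt
  nlinarith

theorem rho_pos : 0 < τ.rho n := by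
  refine lt_of_lt_of_le ?_ h.le_rho
  have := τ.rho0_pos
  have := h.four_le_level
  have := h.sqrt_pos
  positivity

theorem rho_le_one : τ.rho n ≤ 1 := by
  have := h.rho_le_npdf
  have := npdf_le_one 0 3
  linarith

theorem one_div_rho_le : 1 / τ.rho n ≤ 2 / τ.rho0 * (√n / level n) := by
  have h1 := h.le_rho
  have := τ.rho0_pos
  have := h.four_le_level
  have := h.sqrt_pos
  calc _ ≤ 1 / (τ.rho0 / 2 * (level n / √n)) := one_div_le_one_div_of_le (by positivity) h1
    _ = _ := by field_simp

theorem one_div_rho_le_card : 1 / τ.rho n ≤ n := by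
  refine h.one_div_rho_le.trans ?_
  have h1 := h.two_div_rho0_le
  have h2 := h.four_le_level
  have h3 := h.sqrt_pos
  calc _ ≤ √n * (√n / 1) := by gcongr; linarith
    _ = n := by rw [div_one, ← sq, h.sq_sqrt]

theorem one_div_card_le_rho : 1 / (n : ℝ) ≤ τ.rho n := by
  have h1 := h.one_div_rho_le_card
  have h2 := h.rho_pos
  have h3 := h.cast_pos
  rw [div_le_iff₀ h2] at h1
  rw [div_le_iff₀ h3]
  linarith

theorem exp_level_le_rho : Real.exp (-level n ^ 2 / 2) ≤ τ.rho n := by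
  rw [exp_neg_level_sq h.pos]; exact h.one_div_card_le_rho

theorem log_one_div_rho_le : Real.log (1 / τ.rho n) + 1 ≤ 2 * Real.log n := by
  have h1 := Real.log_le_log (one_div_pos.2 h.rho_pos) h.one_div_rho_le_card
  have := h.eight_le_log
  linarith

theorem log_one_div_rho_nonneg : 0 ≤ Real.log (1 / τ.rho n) :=
  Real.log_nonneg (by rw [le_div_iff₀ h.rho_pos]; linarith [h.rho_le_one])

/-- This is the δ of the exchange argument: reuse of the data costs only O(1/√n). -/
theorem level_div_le : level n / (n * τ.rho n) ≤ 2 / τ.rho0 / √n := by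
  have h1 := h.one_div_rho_le
  have h2 := h.four_le_level
  have h3 := h.sqrt_pos
  calc level n / (n * τ.rho n) = level n / n * (1 / τ.rho n) := by
        have := h.rho_pos; have := h.cast_pos; field_simp
    _ ≤ level n / n * (2 / τ.rho0 * (√n / level n)) := by
        have := h.cast_pos; gcongr
    _ = _ := by
        have e := h.sq_sqrt
        have := h.cast_pos
        have := τ.rho0_pos
        field_simp
        exact e

theorem level_div_le_one : level n / (n * τ.rho n) ≤ 1 := by
  refine h.level_div_le.trans ?_
  rw [div_le_one h.sqrt_pos]
  exact h.two_div_rho0_le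

end IsLarge

/-- The constant in the bound for the excess risk of the regularised rule. -/
def scoreConst (τ : Tuning) : ℝ :=
  24 * (48 / τ.rho0 + 2048 / τ.rho0 ^ 3) + 80 / τ.rho0 ^ 2

theorem scoreConst_pos (τ : Tuning) : 0 < scoreConst τ := by
  have := τ.rho0_pos
  unfold scoreConst; positivity

/-- As ρ is of order a/√n, the variance a/n times 1/ρ is of order 1/√n, and the scores contribute
log n. The term with `ρ⁻³` is no larger because it carries a further a/n, and the squared bias `n⁻²`
over `ρ²` is negligible. -/
theorem IsLarge.scoreErr_le {τ : Tuning} {n : ℕ} (h : IsLarge τ n) :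
    scoreErr (τ.rho n) (level n) n ≤ scoreConst τ * (Real.log n / √n) := by
  have hr := τ.rho0_pos
  have hρ := h.rho_pos
  have hs := h.sqrt_pos
  have hn := h.cast_pos
  have hL := h.eight_le_log
  have ha := h.four_le_level
  have hlog := h.log_one_div_rho_le
  have hlog0 := h.log_one_div_rho_nonneg
  have hinv := h.one_div_rho_le
  have hπ : π ≤ 4 := Real.pi_le_four
  have hπ0 := Real.pi_pos
  have ess := h.sq_sqrt
  have i1 : 24 / τ.rho n ≤ 48 / τ.rho0 * (√n / level n) := by
    calc 24 / τ.rho n = 24 * (1 / τ.rho n) := by ring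
      _ ≤ 24 * (2 / τ.rho0 * (√n / level n)) := by gcongr
      _ = _ := by ring
  have i2 : 16 / τ.rho n ^ 3 * (3 * (π * level n / n) + 4 * level n ^ 2 / (n : ℝ) ^ 2) ≤
      2048 / τ.rho0 ^ 3 * (√n / level n) := by
    have j1 : 3 * (π * level n / n) + 4 * level n ^ 2 / (n : ℝ) ^ 2 ≤ 16 * (level n / n) := by
      have k1 : 4 * level n ^ 2 / (n : ℝ) ^ 2 ≤ 4 * (level n / n) := by
        have : level n / n ≤ 1 := (div_le_one hn).2 h.level_le
        have h0 : 0 ≤ level n / n := by positivity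
        calc 4 * level n ^ 2 / (n : ℝ) ^ 2 = 4 * ((level n / n) * (level n / n)) := by
              field_simp
          _ ≤ 4 * ((level n / n) * 1) := by gcongr
          _ = _ := by ring
      have k2 : 3 * (π * level n / n) ≤ 12 * (level n / n) := by
        have h0 : 0 ≤ level n / n := by positivity
        rw [mul_div_assoc]
        nlinarith
      linarith
    have j2 : (1 / τ.rho n) ^ 3 ≤ (2 / τ.rho0 * (√n / level n)) ^ 3 := by gcongr
    calc _ = 16 * (1 / τ.rho n) ^ 3 * (3 * (π * level n / n) + 4 * level n ^ 2 / (n : ℝ) ^ 2) := by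
          rw [one_div_pow]; ring
      _ ≤ 16 * (2 / τ.rho0 * (√n / level n)) ^ 3 * (16 * (level n / n)) := by gcongr
      _ = 2048 / τ.rho0 ^ 3 * (√n / level n) * (1 / level n) * (√n ^ 2 / n) := by
          field_simp; norm_num
      _ ≤ 2048 / τ.rho0 ^ 3 * (√n / level n) * 1 * (√n ^ 2 / n) := by
          gcongr
          rw [div_le_one (by linarith)]; linarith
      _ = _ := by rw [ess, div_self hn.ne']; ring
  have i3 : level n ^ 2 + 2 * (Real.log (1 / τ.rho n) + 1) ≤ 6 * Real.log n := by
    rw [level_sq n]; linarith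
  have i4 : π * level n / n * ((level n ^ 2 + 2 * (Real.log (1 / τ.rho n) + 1)) *
      (24 / τ.rho n + 16 / τ.rho n ^ 3 *
        (3 * (π * level n / n) + 4 * level n ^ 2 / (n : ℝ) ^ 2))) ≤
      24 * (48 / τ.rho0 + 2048 / τ.rho0 ^ 3) * (Real.log n / √n) := by
    calc _ ≤ 4 * level n / n * (6 * Real.log n *
          (48 / τ.rho0 * (√n / level n) + 2048 / τ.rho0 ^ 3 * (√n / level n))) := by
          have : 0 ≤ level n := by linarith
          gcongr
      _ = 24 * (48 / τ.rho0 + 2048 / τ.rho0 ^ 3) * (Real.log n / √n) * (√n ^ 2 / n) := by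
          field_simp; norm_num
      _ = _ := by rw [ess, div_self hn.ne', mul_one]
  have i5 : 4 * (1 + 2 * (Real.log (1 / τ.rho n) + 1)) * Real.exp (-level n ^ 2 / 2) ^ 2 /
      τ.rho n ^ 2 ≤ 80 / τ.rho0 ^ 2 * (Real.log n / √n) := by
    rw [exp_neg_level_sq h.pos]
    have j2 : (1 / τ.rho n) ^ 2 ≤ (2 / τ.rho0 * (√n / 1)) ^ 2 := by
      refine pow_le_pow_left₀ (by positivity) (hinv.trans ?_) 2
      gcongr; linarith
    calc _ = 4 * (1 + 2 * (Real.log (1 / τ.rho n) + 1)) * (1 / (n : ℝ)) ^ 2 *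
          (1 / τ.rho n) ^ 2 := by rw [one_div_pow (τ.rho n)]; ring
      _ ≤ 4 * (5 * Real.log n) * (1 / (n : ℝ)) ^ 2 * (2 / τ.rho0 * (√n / 1)) ^ 2 := by
          gcongr; linarith
      _ = 80 / τ.rho0 ^ 2 * (Real.log n / n) * (√n ^ 2 / n) := by field_simp; norm_num
      _ ≤ 80 / τ.rho0 ^ 2 * (Real.log n / √n) * (√n ^ 2 / n) := by
          have := h.sqrt_le
          have := h.log_pos
          gcongr
      _ = _ := by rw [ess, div_self hn.ne', mul_one]
  unfold scoreErr scoreConst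
  rw [add_mul _ (80 / τ.rho0 ^ 2)]
  exact add_le_add i4 i5

/-- The constant in the risk bound for the regularised rule. -/
def ruleConst (τ : Tuning) : ℝ :=
  2 * scoreConst τ + 2 / τ.rho0 * (12 * scoreConst τ + 58)

theorem ruleConst_pos (τ : Tuning) : 0 < ruleConst τ := by
  have := τ.rho0_pos
  have := scoreConst_pos τ
  unfold ruleConst; positivity

theorem IsLarge.excess_le {τ : Tuning} {n : ℕ} (h : IsLarge τ n) :
    2 * scoreErr (τ.rho n) (level n) n + level n / (n * τ.rho n) *
      (6 * (2 * scoreErr (τ.rho n) (level n) n + 4 * (Real.log (1 / τ.rho n) + 1)) + 2 +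
        4 * level n ^ 2) ≤ ruleConst τ * (Real.log n / √n) := by
  have h1 := h.scoreErr_le
  have hS := scoreConst_pos τ
  have hL := h.eight_le_log
  have hs := h.sqrt_pos
  have hr := τ.rho0_pos
  have h2 : scoreErr (τ.rho n) (level n) n ≤ scoreConst τ * Real.log n := by
    refine h1.trans ?_
    gcongr
    exact div_le_self (by linarith) h.one_le_sqrt
  have h3 := h.log_one_div_rho_le
  have h4 : 6 * (2 * scoreErr (τ.rho n) (level n) n + 4 * (Real.log (1 / τ.rho n) + 1)) + 2 +
        4 * level n ^ 2 ≤ (12 * scoreConst τ + 58) * Real.log n := by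
    rw [level_sq n]; nlinarith
  calc _ ≤ 2 * (scoreConst τ * (Real.log n / √n)) + 2 / τ.rho0 / √n *
        ((12 * scoreConst τ + 58) * Real.log n) := by
        have hd := h.level_div_le
        refine add_le_add (by linarith) ?_
        refine (mul_le_mul_of_nonneg_left h4 ?_).trans (mul_le_mul_of_nonneg_right hd ?_)
        · have := h.rho_pos; have := h.cast_pos; have := h.four_le_level; positivity
        · positivity
    _ = _ := by unfold ruleConst; ring

/-! ### The regularisation bias in large blocks -/

theorem card_mul_ofReal (n : ℕ) (x : ℝ) :
    (n : ℝ≥0∞) * ENNReal.ofReal x = ENNReal.ofReal (n * x) := by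
  rw [ENNReal.ofReal_mul (Nat.cast_nonneg n), ENNReal.ofReal_natCast]

theorem rpow_three_halves {x : ℝ} (hx : 0 < x) : x ^ (3 / 2 : ℝ) = x * √x := by
  rw [Real.sqrt_eq_rpow, ← Real.rpow_one_add' hx.le (by norm_num)]
  norm_num

theorem level_le_sqrt_log (n : ℕ) : level n ≤ 2 * √(Real.log n) := by
  rw [level, Real.sqrt_mul zero_le_two]
  have : √(2 : ℝ) ≤ 2 := by rw [Real.sqrt_le_left (by norm_num)]; norm_num
  gcongr

namespace IsLarge

variable {τ : Tuning} {n : ℕ} (h : IsLarge τ n)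

include h

theorem level_mul_log_le : level n * Real.log n ≤ 2 * Real.log n ^ (3 / 2 : ℝ) := by
  have h1 := level_le_sqrt_log n
  have h2 := h.log_pos
  rw [rpow_three_halves h2]
  nlinarith

theorem one_le_log_rpow : 1 ≤ Real.log n ^ (3 / 2 : ℝ) :=
  Real.one_le_rpow (by have := h.eight_le_log; linarith) (by norm_num)

theorem one_div_card_le : 1 / (n : ℝ) ≤ Real.log n ^ (3 / 2 : ℝ) / √n := by
  have := h.one_le_log_rpow
  have := h.sqrt_pos
  have := h.sqrt_le
  gcongr

theorem one_div_card_le_rpow : 1 / (n : ℝ) ≤ 1 / (Real.log n + 1) ^ (3 / 2 : ℝ) := by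
  have := h.log_rpow_le
  have := h.log_pos
  gcongr

/-- Here ρ log(1/ρ) is of order `a log n / √n`, hence `(log n)^(3/2) / √n`; truncating no earlier
than a makes the Gaussian tail at most 1/n. -/
theorem truncation_error_le {y : ℝ} (hy : level n ≤ y) :
    8 * y * τ.rho n * (Real.log (1 / τ.rho n) + 1) + 2 * y * Real.exp (-y ^ 2 / 2) ≤
      (64 * τ.rho0 + 2) * (y * (Real.log n ^ (3 / 2 : ℝ) / √n)) := by
  have ha := h.four_le_level
  have hr := τ.rho0_pos
  have hs := h.sqrt_pos
  have hρ := h.rho_pos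
  have hL := h.log_pos
  have hy0 : 0 < y := by linarith
  have h1 := h.log_one_div_rho_le
  have h2 : Real.exp (-y ^ 2 / 2) ≤ Real.log n ^ (3 / 2 : ℝ) / √n := by
    refine le_trans ?_ h.one_div_card_le
    rw [← exp_neg_level_sq h.pos]
    refine Real.exp_le_exp.2 ?_
    nlinarith
  have h3 : 8 * y * τ.rho n * (Real.log (1 / τ.rho n) + 1) ≤
      8 * y * (2 * τ.rho0 * (level n / √n)) * (2 * Real.log n) := by
    have := h.rho_le
    have := h.log_one_div_rho_nonneg
    gcongr
  have h4 : 8 * y * (2 * τ.rho0 * (level n / √n)) * (2 * Real.log n) ≤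
      64 * τ.rho0 * (y * (Real.log n ^ (3 / 2 : ℝ) / √n)) := by
    calc _ = 32 * τ.rho0 * y / √n * (level n * Real.log n) := by ring
      _ ≤ 32 * τ.rho0 * y / √n * (2 * Real.log n ^ (3 / 2 : ℝ)) := by
          have := h.level_mul_log_le
          gcongr
      _ = _ := by ring
  have h5 : 2 * y * Real.exp (-y ^ 2 / 2) ≤ 2 * (y * (Real.log n ^ (3 / 2 : ℝ) / √n)) := by
    rw [mul_assoc]; gcongr
  linarith

end IsLarge

section Large

variable {τ : Tuning} {ι : Type*} [Fintype ι] [Nonempty ι] (θ : ι → ℝ)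
  (h : IsLarge τ (Fintype.card ι))

include h

theorem IsLarge.card_mul_regBias_le_of_truncation {y q D : ℝ} (hy : level (Fintype.card ι) ≤ y)
    (hq : 0 < q) (hD : ∑ i, |θ i| ^ q ≤ Fintype.card ι * D) :
    (Fintype.card ι : ℝ≥0∞) * regBias (τ.rho (Fintype.card ι)) θ ≤
      ENNReal.ofReal (Fintype.card ι * ((64 * τ.rho0 + 2) *
        (y * (Real.log (Fintype.card ι) ^ (3 / 2 : ℝ) / √(Fintype.card ι))) + D / y ^ q)) := by
  have ha := h.four_le_level
  have hy0 : 0 < y := by linarith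
  refine (GEB.card_mul_regBias_le_of_truncation θ (y := y) h.rho_le_one h.rho_pos (by linarith)
    hq).trans ?_
  have hr := τ.rho0_pos
  have hL := h.log_pos
  have hs := h.sqrt_pos
  have hD0 : 0 ≤ Fintype.card ι * D := (Finset.sum_nonneg fun i _ => by positivity).trans hD
  rw [card_mul_ofReal, ← ENNReal.ofReal_sum_of_nonneg (fun i _ => by positivity),
    mul_add (Fintype.card ι : ℝ) ((64 * τ.rho0 + 2) * _),
    ENNReal.ofReal_add (by positivity) (by rw [← mul_div_assoc]; positivity)]
  refine add_le_add (ENNReal.ofReal_le_ofReal ?_) (ENNReal.ofReal_le_ofReal ?_)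
  · exact mul_le_mul_of_nonneg_left (h.truncation_error_le hy) (Nat.cast_nonneg _)
  · simp_rw [Real.div_rpow (abs_nonneg _) hy0.le]
    rw [← Finset.sum_div, ← mul_div_assoc]
    gcongr

/-- The point Y is where half the standard normal density equals ρ. A moment below `n^(-1/8)`
forces, by Markov, at least half of the means into [-1/a, 1/a]. -/
theorem IsLarge.card_mul_regBias_le_of_sparse {q D : ℝ} (hq : 0 < q) (hq2 : q ≤ 2)
    (hD : ∑ i, |θ i| ^ q ≤ Fintype.card ι * D)
    (hDn : D * (Fintype.card ι : ℝ) ^ (1 / 8 : ℝ) ≤ 1) :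
    (Fintype.card ι : ℝ≥0∞) * regBias (τ.rho (Fintype.card ι)) θ ≤
      ENNReal.ofReal (Fintype.card ι * (432 * τ.rho0 *
        (Real.log (Fintype.card ι) / √(Fintype.card ι)) + D)) := by
  classical
  set n := Fintype.card ι with hn
  set ρ := τ.rho n with hρdef
  set a := level n with hadef
  have ha : 4 ≤ a := h.four_le_level
  have hρ : 0 < ρ := h.rho_pos
  have hr := τ.rho0_pos
  have hL := h.log_pos
  have hs := h.sqrt_pos
  have hnc := h.cast_pos
  have h2p := two_le_sqrt_two_pi
  have h3p : √(2 * π) ≤ 3 := by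
    rw [Real.sqrt_le_left (by norm_num)]; linarith [Real.pi_le_four]
  set Y := √(-2 * Real.log (2 * √(2 * π) * ρ)) with hY
  have hnpdf : ∀ y, npdf 0 y = (√(2 * π))⁻¹ * Real.exp (-y ^ 2 / 2) := fun y => by
    rw [npdf, sub_zero]
  have hlog : Real.log (2 * √(2 * π) * ρ) ≤ -(9 / 2) := by
    have h1 := h.rho_le_npdf
    rw [hnpdf] at h1
    have h2 : 2 * √(2 * π) * ρ ≤ Real.exp (-(9 / 2)) := by
      calc _ ≤ 2 * √(2 * π) * (1 / 2 * ((√(2 * π))⁻¹ * Real.exp (-3 ^ 2 / 2))) := by gcongr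
        _ = Real.exp (-3 ^ 2 / 2) := by field_simp
        _ = _ := by norm_num
    rw [← Real.log_exp (-(9 / 2))]
    exact Real.log_le_log (by positivity) h2
  have hYsq : Y ^ 2 = -2 * Real.log (2 * √(2 * π) * ρ) := Real.sq_sqrt (by linarith)
  have hY0 : 0 ≤ Y := Real.sqrt_nonneg _
  have hY3 : 3 ≤ Y := by nlinarith
  have hexpY : Real.exp (-Y ^ 2 / 2) = 2 * √(2 * π) * ρ := by
    rw [hYsq, show -(-2 * Real.log (2 * √(2 * π) * ρ)) / 2 = Real.log (2 * √(2 * π) * ρ) by ring,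
      Real.exp_log (by positivity)]
  -- Because `ρ ≥ exp (-a²/2)`, the density falls below the level of ρ no later than at a.
  have hYa : Y ≤ a := by
    have h1 : Real.exp (-a ^ 2 / 2) ≤ Real.exp (-Y ^ 2 / 2) := by
      rw [hexpY]
      refine h.exp_level_le_rho.trans ?_
      nlinarith
    have := Real.exp_le_exp.1 h1
    nlinarith
  have hexpY6 : Real.exp (-Y ^ 2 / 2) ≤ 6 * ρ := by rw [hexpY]; nlinarith
  have hρa : ρ * a ≤ 4 * τ.rho0 * (Real.log n / √n) := by
    calc ρ * a ≤ 2 * τ.rho0 * (a / √n) * a := by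
          have := h.rho_le
          gcongr
      _ = 2 * τ.rho0 * (a ^ 2 / √n) := by ring
      _ = _ := by rw [hadef, level_sq n]; ring
  have hcount : (Fintype.card ι : ℝ) ≤ 2 * (Finset.univ.filter fun i => |θ i| ≤ 1 / a).card := by
    -- Markov for the q-th powers, with `a^q ≤ a²`.
    have h1 : ((Finset.univ.filter fun i => ¬|θ i| ≤ 1 / a).card : ℝ) ≤ a ^ 2 * (n * D) := by
      calc _ = ∑ i ∈ Finset.univ.filter fun i => ¬|θ i| ≤ 1 / a, (1 : ℝ) := by simp
        _ ≤ ∑ i ∈ Finset.univ.filter fun i => ¬|θ i| ≤ 1 / a, a ^ 2 * |θ i| ^ q := by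
            refine Finset.sum_le_sum fun i hi => ?_
            have h2 := not_le.1 (Finset.mem_filter.1 hi).2
            rw [div_lt_iff₀ (by linarith)] at h2
            calc (1 : ℝ) ≤ (a * |θ i|) ^ q := Real.one_le_rpow (by linarith) hq.le
              _ = a ^ q * |θ i| ^ q := Real.mul_rpow (by linarith) (abs_nonneg _)
              _ ≤ a ^ (2 : ℝ) * |θ i| ^ q := by
                  gcongr
                  linarith
              _ = _ := by rw [Real.rpow_ofNat]
        _ ≤ ∑ i, a ^ 2 * |θ i| ^ q :=
            Finset.sum_le_univ_sum_of_nonneg fun i => by positivity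
        _ ≤ _ := by rw [← Finset.mul_sum]; gcongr
    have h2 : a ^ 2 * D ≤ 1 / 2 := by
      have h3 := h.level_sq_le
      rcases le_or_gt D 0 with h4 | h4
      · nlinarith [sq_nonneg a]
      · nlinarith
    have h5 := Finset.card_filter_add_card_filter_not (s := Finset.univ) fun i => |θ i| ≤ 1 / a
    rw [Finset.card_univ] at h5
    have h6 : ((Finset.univ.filter fun i => |θ i| ≤ 1 / a).card : ℝ) +
        (Finset.univ.filter fun i => ¬|θ i| ≤ 1 / a).card = n := by exact_mod_cast h5
    have h7 : a ^ 2 * (n * D) ≤ n * (1 / 2) := by nlinarith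
    linarith
  refine (GEB.card_mul_regBias_le_of_sparse θ (by linarith) hcount hY3 (le_of_eq ?_) ?_ hq
    hq2).trans ?_
  · rw [hnpdf, hexpY]; field_simp
  · have e : Real.exp (-(Y - 2) ^ 2 / 2) = Real.exp (-Y ^ 2 / 2) * Real.exp (2 * Y - 2) := by
      rw [← Real.exp_add]; congr 1; ring
    rw [e]
    calc 2 * Y * (Real.exp (-Y ^ 2 / 2) * Real.exp (2 * Y - 2)) ≤
          2 * a * (6 * ρ * Real.exp (2 * a)) := by gcongr; linarith
      _ ≤ 2 * a * (6 * (2 * τ.rho0 * (a / √n)) * Real.exp (2 * a)) := by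
          have := h.rho_le
          gcongr
      _ = (24 * τ.rho0 * a ^ 4 * Real.exp (2 * a)) / √n / a ^ 2 := by field_simp; norm_num
      _ ≤ √n / √n / a ^ 2 := by have := h.level_exp_le; gcongr
      _ = _ := by rw [div_self hs.ne']
  · have hD0 : 0 ≤ n * D := (Finset.sum_nonneg fun i _ => by positivity).trans hD
    rw [card_mul_ofReal, ← ENNReal.ofReal_sum_of_nonneg (fun i _ => by positivity), mul_add,
      ENNReal.ofReal_add (by positivity) hD0]
    refine add_le_add (ENNReal.ofReal_le_ofReal ?_) (ENNReal.ofReal_le_ofReal hD)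
    refine mul_le_mul_of_nonneg_left ?_ hnc.le
    -- Moving the tail by 2/a costs only the factor e², because Y ≤ a.
    have e : Real.exp (-(Y - 2 / a) ^ 2 / 2) ≤ Real.exp (-Y ^ 2 / 2) * Real.exp 2 := by
      rw [← Real.exp_add]
      refine Real.exp_le_exp.2 ?_
      have h1 : Y * (2 / a) ≤ 2 := by
        rw [mul_div_assoc', div_le_iff₀ (by linarith)]; linarith
      nlinarith [sq_nonneg (2 / a)]
    have e2 : Real.exp 2 ≤ 9 := by
      have h1 := Real.exp_one_lt_d9
      have h2 : Real.exp 2 = Real.exp 1 ^ 2 := by rw [← Real.exp_nat_mul]; norm_num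
      rw [h2]
      nlinarith [Real.exp_pos 1]
    calc _ ≤ 2 * a * (6 * ρ * 9) := by
          refine mul_le_mul (by linarith) (e.trans ?_) (Real.exp_pos _).le (by linarith)
          gcongr
      _ = 108 * (ρ * a) := by ring
      _ ≤ 108 * (4 * τ.rho0 * (Real.log n / √n)) := by gcongr
      _ = _ := by ring

/-- The bias bound that underlies the rate `C ^ q (log n) ^ (1 - q / 2)`. -/
theorem IsLarge.card_mul_regBias_le_moment {q D : ℝ} (hq : 0 < q) (hq2 : q ≤ 2)
    (hD : ∑ i, |θ i| ^ q ≤ Fintype.card ι * D) :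
    (Fintype.card ι : ℝ≥0∞) * regBias (τ.rho (Fintype.card ι)) θ ≤
      ENNReal.ofReal (Fintype.card ι * (432 * τ.rho0 *
        (Real.log (Fintype.card ι) / √(Fintype.card ι)) + (64 * τ.rho0 + 3) * D)) := by
  set n := Fintype.card ι with hn
  have hr := τ.rho0_pos
  have hL := h.log_pos
  have hs := h.sqrt_pos
  have hnc := h.cast_pos
  have hn8 : (0 : ℝ) < (n : ℝ) ^ (1 / 8 : ℝ) := by positivity
  have hD0 : 0 ≤ D := by
    have : 0 ≤ n * D := (Finset.sum_nonneg fun i _ => by positivity).trans hD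
    exact nonneg_of_mul_nonneg_right this hnc
  rcases le_or_gt (D * (n : ℝ) ^ (1 / 8 : ℝ)) 1 with h1 | h1
  · refine (h.card_mul_regBias_le_of_sparse θ hq hq2 hD h1).trans (ENNReal.ofReal_le_ofReal ?_)
    gcongr
    nlinarith
  -- Dense case: truncate at `n^(1/4)`. The truncation error is then at most `n^(1/4 + 1/8 - 1/2) =
  -- n^(-1/8)`, which is below D.
  · have hsq : ((n : ℝ) ^ (1 / 8 : ℝ)) ^ 2 = (n : ℝ) ^ (1 / 4 : ℝ) := by
      rw [← Real.rpow_natCast, ← Real.rpow_mul hnc.le]; norm_num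
    have hsq2 : ((n : ℝ) ^ (1 / 8 : ℝ)) ^ 4 = √n := by
      rw [← Real.rpow_natCast, ← Real.rpow_mul hnc.le, Real.sqrt_eq_rpow]; norm_num
    have ha := h.four_le_level
    have hla : level n ≤ (n : ℝ) ^ (1 / 4 : ℝ) := by
      rw [← hsq]
      have := h.level_sq_le
      have h2 : level n ≤ (n : ℝ) ^ (1 / 8 : ℝ) := by nlinarith
      nlinarith
    refine (h.card_mul_regBias_le_of_truncation θ hla hq hD).trans (ENNReal.ofReal_le_ofReal ?_)
    have h2 : (n : ℝ) ^ (1 / 4 : ℝ) * (Real.log n ^ (3 / 2 : ℝ) / √n) ≤ D := by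
      calc _ ≤ (n : ℝ) ^ (1 / 4 : ℝ) * ((n : ℝ) ^ (1 / 8 : ℝ) / √n) := by
            have := h.log_rpow_le_rpow
            gcongr
        _ = 1 / (n : ℝ) ^ (1 / 8 : ℝ) := by rw [← hsq, ← hsq2]; field_simp
        _ ≤ D := by rw [div_le_iff₀ hn8]; exact h1.le
    have h3 : D / ((n : ℝ) ^ (1 / 4 : ℝ)) ^ q ≤ D :=
      div_le_self hD0 (Real.one_le_rpow (by linarith) hq.le)
    have h4 : 0 ≤ 432 * τ.rho0 * (Real.log n / √n) := by positivity
    refine mul_le_mul_of_nonneg_left ?_ hnc.le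
    nlinarith

/-- The bias bound that underlies the rate `(C (log n) ^ (3 / 2) / √n) ^ (q / (q + 1))`. -/
theorem IsLarge.card_mul_regBias_le_max {q C : ℝ} (hq : 0 < q) (hC : 0 ≤ C)
    (hD : ∑ i, |θ i| ^ q ≤ Fintype.card ι * C ^ q) :
    (Fintype.card ι : ℝ≥0∞) * regBias (τ.rho (Fintype.card ι)) θ ≤
      ENNReal.ofReal (Fintype.card ι * ((128 * τ.rho0 + 6) *
        max (Real.log (Fintype.card ι) ^ 2 / √(Fintype.card ι))
          ((C * Real.log (Fintype.card ι) ^ (3 / 2 : ℝ) / √(Fintype.card ι)) ^ (q / (q + 1))))) := by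
  set n := Fintype.card ι with hn
  have hr := τ.rho0_pos
  have hL := h.log_pos
  have hs := h.sqrt_pos
  have hnc := h.cast_pos
  set T := Real.log n ^ (3 / 2 : ℝ) / √n with hTdef
  have hT : 0 < T := by positivity
  have ha := h.four_le_level
  have hq1 : 0 < q + 1 := by linarith
  -- The balance point of the two errors: `y T = C^q / y^q` there, with common value `(C
  -- T)^(q/(q+1))`.
  set y₁ := (C ^ q / T) ^ (1 / (q + 1)) with hy₁
  have hy₁0 : 0 ≤ y₁ := by positivity
  have hy₁q : y₁ ^ (q + 1) = C ^ q / T := by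
    rw [hy₁, ← Real.rpow_mul (by positivity), one_div_mul_cancel hq1.ne', Real.rpow_one]
  have e : C * Real.log n ^ (3 / 2 : ℝ) / √n = C * T := mul_div_assoc _ _ _
  have hy₁T : y₁ * T = (C * T) ^ (q / (q + 1)) := by
    rw [hy₁, Real.mul_rpow hC hT.le, Real.div_rpow (by positivity) hT.le, ← Real.rpow_mul hC,
      mul_one_div, div_mul_eq_mul_div, div_eq_iff (by positivity), mul_assoc,
      ← Real.rpow_add hT, ← add_div, div_self hq1.ne', Real.rpow_one]
  -- Truncation below `level n` is not allowed; when the maximum is `level n`, the error is of order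
  -- `(log n)² / √n`, the other entry of the maximum.
  set y := max (level n) y₁ with hy
  have hya : level n ≤ y := le_max_left _ _
  have hy0 : 0 < y := by linarith
  refine (h.card_mul_regBias_le_of_truncation θ hya hq hD).trans (ENNReal.ofReal_le_ofReal ?_)
  rw [e]
  have h1 : C ^ q / y ^ q ≤ y * T := by
    rw [div_le_iff₀ (by positivity), mul_right_comm, ← Real.rpow_one_add' hy0.le (by linarith),
      add_comm 1 q, ← div_le_iff₀ hT, ← hy₁q]
    exact Real.rpow_le_rpow hy₁0 (le_max_right _ _) hq1.le
  have h2 : y * T ≤ 2 * max (Real.log n ^ 2 / √n) ((C * T) ^ (q / (q + 1))) := by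
    rw [hy, max_mul_of_nonneg _ _ hT.le, hy₁T]
    refine max_le ?_ ?_
    · refine le_trans ?_ (mul_le_mul_of_nonneg_left (le_max_left _ _) zero_le_two)
      rw [hTdef, ← mul_div_assoc, ← mul_div_assoc]
      refine div_le_div_of_nonneg_right ?_ hs.le
      rw [rpow_three_halves hL]
      have h3 := level_le_sqrt_log n
      have h4 := Real.sq_sqrt hL.le
      have h5 : 0 < √(Real.log n) := Real.sqrt_pos.2 hL
      calc level n * (Real.log n * √(Real.log n)) ≤
            2 * √(Real.log n) * (Real.log n * √(Real.log n)) := by gcongr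
        _ = 2 * Real.log n * (√(Real.log n) ^ 2) := by ring
        _ = _ := by rw [h4]; ring
    · have : 0 ≤ (C * T) ^ (q / (q + 1)) := by positivity
      have := le_max_right (Real.log n ^ 2 / √n) ((C * T) ^ (q / (q + 1)))
      linarith
  gcongr
  calc (64 * τ.rho0 + 2) * (y * T) + C ^ q / y ^ q ≤ (64 * τ.rho0 + 3) * (y * T) := by linarith
    _ ≤ (64 * τ.rho0 + 3) * (2 * max (Real.log n ^ 2 / √n) ((C * T) ^ (q / (q + 1)))) := by gcongr
    _ = _ := by ring

end Large

/-! ### The hybrid rule in one block -/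

section Hybrid

variable {τ : Tuning} {ι : Type*} [Fintype ι]

theorem tHat_univ (hn : τ.nStar ≤ Fintype.card ι) (X : ι → ℝ) (x : ℝ) :
    tHat Finset.univ X τ x = if τ.b (Fintype.card ι) < kappaHat Finset.univ X then
      x + score (τ.rho (Fintype.card ι)) (level (Fintype.card ι)) X x
      else softThreshold (level (Fintype.card ι)) x := by
  have e : phiHat Finset.univ X = kde (level (Fintype.card ι)) X := by
    funext z
    rw [phiHat, kde, Finset.card_univ]
  rw [tHat, Finset.card_univ, if_pos hn, e, (hasDerivAt_kde _ X x).deriv]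
  rfl

/-- The samples in which the hybrid rule uses the empirical Bayes rule. -/
def ruleSet (τ : Tuning) (ι : Type*) [Fintype ι] : Set (ι → ℝ) :=
  {X | τ.b (Fintype.card ι) < kappaHat Finset.univ X}

theorem measurableSet_ruleSet : MeasurableSet (ruleSet τ ι) :=
  measurableSet_lt measurable_const continuous_kappaHat.measurable

variable [Nonempty ι] (θ : ι → ℝ)

theorem abs_score_le {ρ : ℝ} (hρ : 0 < ρ) (a : ℝ) (X : ι → ℝ) (x : ℝ) :
    |score ρ a X x| ≤ a ^ 2 / ρ := by
  have h1 : |kdeD a X x| ≤ a ^ 2 := by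
    refine abs_avg_le_of_le fun i => ?_
    rw [abs_mul, abs_of_nonneg (sq_nonneg a)]
    refine mul_le_of_le_one_right (sq_nonneg a) ?_
    have h1 := abs_kernelDeriv_le (a * (x - X i))
    have h2 := one_div_pi_le
    linarith
  rw [score, abs_div, abs_of_pos (lt_max_of_lt_left hρ)]
  exact div_le_div₀ (sq_nonneg a) h1 hρ (le_max_left _ _)

omit [Nonempty ι] in
theorem sum_lintegral_tHat_le (hn : τ.nStar ≤ Fintype.card ι) :
    ∑ i, ∫⁻ X, ENNReal.ofReal ((tHat Finset.univ X τ (X i) - θ i) ^ 2) ∂(gaussProd θ) ≤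
      ∑ i, ∫⁻ X, (ruleSet τ ι).indicator (fun X => ENNReal.ofReal
        ((X i + score (τ.rho (Fintype.card ι)) (level (Fintype.card ι)) X (X i) - θ i) ^ 2)) X
        ∂(gaussProd θ) +
      ∑ i, ∫⁻ X, (ruleSet τ ι)ᶜ.indicator (fun X => ENNReal.ofReal
        ((softThreshold (level (Fintype.card ι)) (X i) - θ i) ^ 2)) X ∂(gaussProd θ) := by
  rw [← Finset.sum_add_distrib]
  refine Finset.sum_le_sum fun i _ => ?_
  have hs := measurable_softThreshold (l := level (Fintype.card ι)) (Real.sqrt_nonneg _)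
  rw [← lintegral_add_right]
  · refine lintegral_mono fun X => ?_
    simp only [tHat_univ hn]
    by_cases hX : X ∈ ruleSet τ ι
    · rw [Set.indicator_of_mem hX, Set.indicator_of_notMem (by simpa using hX), add_zero,
        if_pos (show _ < _ from hX)]
    · rw [Set.indicator_of_notMem hX, Set.indicator_of_mem (by simpa using hX), zero_add,
        if_neg (show ¬ _ < _ from hX)]
  · refine Measurable.indicator ?_ measurableSet_ruleSet.compl
    exact (((hs.comp (measurable_pi_apply i)).sub_const _).pow_const 2).ennreal_ofReal

/-- A bound for the risk in a block of intermediate size. -/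
theorem sum_lintegral_tHat_le_crude (hn : τ.nStar ≤ Fintype.card ι) :
    ∑ i, ∫⁻ X, ENNReal.ofReal ((tHat Finset.univ X τ (X i) - θ i) ^ 2) ∂(gaussProd θ) ≤
      ENNReal.ofReal (Fintype.card ι * (2 * (level (Fintype.card ι) ^ 2 / τ.rho (Fintype.card ι) +
        level (Fintype.card ι)) ^ 2 + 6)) := by
  set n := Fintype.card ι with hndef
  have hn2 : 1 < (n : ℝ) := by
    have := τ.two_lt_nStar
    exact_mod_cast (show 1 < n by omega)
  have hL := Real.log_pos hn2
  have hρ : 0 < τ.rho n := by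
    have := τ.one_add_eta_pos n hn
    have := τ.rho0_pos
    have : 0 < √(2 * Real.log n / n) := Real.sqrt_pos.2 (by positivity)
    unfold Tuning.rho
    positivity
  have ha : 0 ≤ level n := Real.sqrt_nonneg _
  -- Both branches stay within a fixed distance of the data, so the event may be the whole space and
  -- the noise level 1.
  have h1 := sum_lintegral_indicator_rule_le θ MeasurableSet.univ
    (r := fun X i => tHat Finset.univ X τ (X i)) (G := level n ^ 2 / τ.rho n + level n) (y := 1)
    (fun X i => by
      simp only [tHat_univ hn]
      split_ifs
      · rw [add_sub_cancel_left]
        exact (abs_score_le hρ _ X _).trans (by linarith)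
      · refine (abs_softThreshold_sub_self_le ha _).trans ?_
        have : 0 ≤ level n ^ 2 / τ.rho n := by positivity
        linarith) le_rfl
  simp only [Set.indicator_univ, gaussProd, measure_univ, mul_one] at h1
  refine h1.trans ?_
  rw [← ENNReal.ofReal_add (by positivity) (by positivity), card_mul_ofReal]
  refine ENNReal.ofReal_le_ofReal ?_
  have : Real.exp (-1 ^ 2 / 2) ≤ 1 := Real.exp_le_one_iff.2 (by norm_num)
  refine mul_le_mul_of_nonneg_left ?_ (Nat.cast_nonneg _)
  linarith

/-- The constant in the bounds for losses on events of negligible probability. -/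
def rareConst (τ : Tuning) : ℝ := 16 / τ.rho0 ^ 2 + 10

theorem rareConst_pos (τ : Tuning) : 0 < rareConst τ := by
  have := τ.rho0_pos
  unfold rareConst; positivity

variable (h : IsLarge τ (Fintype.card ι))

include h

/-- The event has probability at most `n⁻⁴`, the squared displacement is O(n²), and there are n
coordinates: in total O(1/n). -/
theorem IsLarge.sum_lintegral_rare_le {A : Set (ι → ℝ)} (hA : MeasurableSet A)
    {r : (ι → ℝ) → ι → ℝ} {G K lam : ℝ} (hr : ∀ X i, |r X i - X i| ≤ G)
    (hG : G ^ 2 ≤ K * (Fintype.card ι : ℝ) ^ 2)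
    (hlam : 4 * Real.log (Fintype.card ι) ≤ Fintype.card ι * lam ^ 2)
    (hP : gaussProd θ A ≤ ENNReal.ofReal (Real.exp (-(Fintype.card ι * lam ^ 2)))) :
    ∑ i, ∫⁻ X, A.indicator (fun X => ENNReal.ofReal ((r X i - θ i) ^ 2)) X ∂(gaussProd θ) ≤
      ENNReal.ofReal ((2 * K + 6) / Fintype.card ι) := by
  set n := Fintype.card ι with hn
  have hL := h.eight_le_log
  have hnc := h.cast_pos
  have hLn := h.log_le
  have e4 : Real.exp (-(4 * Real.log n)) = (1 / n) ^ 4 := by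
    rw [show -(4 * Real.log n) = ((4 : ℕ) : ℝ) * -Real.log n by push_cast; ring, Real.exp_nat_mul,
      Real.exp_neg, Real.exp_log hnc, one_div]
  have hP4 : gaussProd θ A ≤ ENNReal.ofReal ((1 / n) ^ 4) := by
    refine hP.trans (ENNReal.ofReal_le_ofReal ?_)
    rw [← e4]
    exact Real.exp_le_exp.2 (by linarith)
  -- Truncating the noise at log n suffices since `log n ≥ 8`.
  have hy4 : Real.exp (-Real.log n ^ 2 / 2) ≤ (1 / n) ^ 4 := by
    rw [← e4]
    refine Real.exp_le_exp.2 ?_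
    nlinarith
  refine (sum_lintegral_indicator_rule_le θ hA hr (y := Real.log n) (by linarith)).trans ?_
  calc _ ≤ (n : ℝ≥0∞) * (ENNReal.ofReal (2 * G ^ 2 + 2 * Real.log n ^ 2) *
        ENNReal.ofReal ((1 / n) ^ 4) + ENNReal.ofReal (4 * Real.log n * (1 / n) ^ 4)) := by
        gcongr
    _ = ENNReal.ofReal (n * ((2 * G ^ 2 + 2 * Real.log n ^ 2) * (1 / n) ^ 4 +
        4 * Real.log n * (1 / n) ^ 4)) := by
        rw [← ENNReal.ofReal_mul (by positivity), ← ENNReal.ofReal_add (by positivity)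
          (by positivity), card_mul_ofReal]
    _ ≤ _ := by
        refine ENNReal.ofReal_le_ofReal ?_
        have h1 : (n : ℝ) ≤ n ^ 2 := by
          have : (1 : ℝ) ≤ n := by linarith
          nlinarith
        have h2 : Real.log n ^ 2 ≤ (n : ℝ) ^ 2 := by gcongr
        calc _ = (2 * G ^ 2 + 2 * Real.log n ^ 2 + 4 * Real.log n) / (n : ℝ) ^ 3 := by
              field_simp
          _ ≤ ((2 * K + 6) * (n : ℝ) ^ 2) / (n : ℝ) ^ 3 := by
              gcongr
              nlinarith
          _ = _ := by field_simp

theorem IsLarge.sum_lintegral_rule_rare_le {A : Set (ι → ℝ)} (hA : MeasurableSet A) {lam : ℝ}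
    (hlam : 4 * Real.log (Fintype.card ι) ≤ Fintype.card ι * lam ^ 2)
    (hP : gaussProd θ A ≤ ENNReal.ofReal (Real.exp (-(Fintype.card ι * lam ^ 2)))) :
    ∑ i, ∫⁻ X, A.indicator (fun X => ENNReal.ofReal
        ((X i + score (τ.rho (Fintype.card ι)) (level (Fintype.card ι)) X (X i) - θ i) ^ 2)) X
        ∂(gaussProd θ) ≤ ENNReal.ofReal (rareConst τ / Fintype.card ι) := by
  have hr := τ.rho0_pos
  have hnc := h.cast_pos
  refine (h.sum_lintegral_rare_le θ hA (G := _) (K := 8 / τ.rho0 ^ 2)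
    (fun X i => by
      rw [add_sub_cancel_left]; exact abs_score_le h.rho_pos _ X _) ?_ hlam hP).trans ?_
  · have h1 := h.one_div_rho_le
    have h2 := h.four_le_level
    have h3 : level (Fintype.card ι) ^ 2 / τ.rho (Fintype.card ι) ≤
        level (Fintype.card ι) ^ 2 * (2 / τ.rho0 * (√(Fintype.card ι) / level (Fintype.card ι))) := by
      rw [div_eq_mul_one_div]
      gcongr
    have h4 := h.rho_pos
    calc _ ≤ _ := pow_le_pow_left₀ (by positivity) h3 2
      _ = 4 / τ.rho0 ^ 2 * level (Fintype.card ι) ^ 2 * √(Fintype.card ι) ^ 2 := by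
          field_simp; norm_num
      _ = 8 / τ.rho0 ^ 2 * Real.log (Fintype.card ι) * Fintype.card ι := by
          rw [h.sq_sqrt, level_sq]; ring
      _ ≤ 8 / τ.rho0 ^ 2 * Fintype.card ι * Fintype.card ι := by
          have := h.log_le; gcongr
      _ = _ := by ring
  · refine ENNReal.ofReal_le_ofReal ?_
    unfold rareConst
    refine div_le_div_of_nonneg_right (add_le_add (le_of_eq ?_) (by norm_num)) hnc.le
    ring

theorem IsLarge.sum_lintegral_soft_rare_le {A : Set (ι → ℝ)} (hA : MeasurableSet A) {lam : ℝ}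
    (hlam : 4 * Real.log (Fintype.card ι) ≤ Fintype.card ι * lam ^ 2)
    (hP : gaussProd θ A ≤ ENNReal.ofReal (Real.exp (-(Fintype.card ι * lam ^ 2)))) :
    ∑ i, ∫⁻ X, A.indicator (fun X => ENNReal.ofReal
        ((softThreshold (level (Fintype.card ι)) (X i) - θ i) ^ 2)) X
        ∂(gaussProd θ) ≤ ENNReal.ofReal (rareConst τ / Fintype.card ι) := by
  have hr := τ.rho0_pos
  have hnc := h.cast_pos
  refine (h.sum_lintegral_rare_le θ hA (G := _) (K := 2)
    (fun X i => abs_softThreshold_sub_self_le (Real.sqrt_nonneg _) _) ?_ hlam hP).trans ?_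
  · change level _ ^ 2 ≤ _
    rw [level_sq]
    have := h.log_le
    have := h.eight_le_log
    nlinarith
  · refine ENNReal.ofReal_le_ofReal ?_
    unfold rareConst
    refine div_le_div_of_nonneg_right ?_ hnc.le
    have : 0 ≤ 16 / τ.rho0 ^ 2 := by positivity
    linarith

theorem IsLarge.sum_lintegral_rule_le {f : ℝ → ℝ} (hf : Measurable f) :
    ∑ i, ∫⁻ X, ENNReal.ofReal
        ((X i + score (τ.rho (Fintype.card ι)) (level (Fintype.card ι)) X (X i) - θ i) ^ 2)
        ∂(gaussProd θ) ≤
      ∑ i, ∫⁻ x, ENNReal.ofReal ((f x - θ i) ^ 2) ∂(gaussianReal (θ i) 1) +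
        ENNReal.ofReal (ruleConst τ * (Fintype.card ι *
          (Real.log (Fintype.card ι) / √(Fintype.card ι)))) +
        2 * ((Fintype.card ι : ℝ≥0∞) * regBias (τ.rho (Fintype.card ι)) θ) := by
  refine (sum_lintegral_score_rule_le θ h.rho_pos h.rho_le_one
    (by have := h.four_le_level; linarith) h.exp_level_le_rho h.level_div_le_one hf).trans ?_
  rw [mul_add (Fintype.card ι : ℝ≥0∞), card_mul_ofReal, add_assoc (Finset.sum _ _), mul_left_comm _ (2 : ℝ≥0∞)]
  refine add_le_add le_rfl (add_le_add (ENNReal.ofReal_le_ofReal ?_) le_rfl)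
  rw [mul_left_comm]
  exact mul_le_mul_of_nonneg_left h.excess_le (Nat.cast_nonneg _)

omit [Nonempty ι] in
-- At this threshold the noise contributes `n exp (-a²/2) / a³ = a⁻³` up to a constant, and `a² = 2
-- log n ≥ log n + 1`. This is the origin of the additive term in the theorem.
theorem IsLarge.sum_lintegral_soft_le :
    ∑ i, ∫⁻ X, ENNReal.ofReal
        ((softThreshold (level (Fintype.card ι)) (X i) - θ i) ^ 2) ∂(gaussProd θ) ≤
      ENNReal.ofReal (32 * (1 / (Real.log (Fintype.card ι) + 1) ^ (3 / 2 : ℝ)) +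
        ∑ i, 2 * min (θ i ^ 2) (1 + level (Fintype.card ι) ^ 2)) := by
  set n := Fintype.card ι with hn
  have ha := h.four_le_level
  have hL := h.eight_le_log
  have hnc := h.cast_pos
  have hs := measurable_softThreshold (l := level n) (Real.sqrt_nonneg _)
  have h1 : ∀ i, ∫⁻ X, ENNReal.ofReal ((softThreshold (level n) (X i) - θ i) ^ 2) ∂(gaussProd θ) ≤
      ENNReal.ofReal (32 * Real.exp (-level n ^ 2 / 2) / level n ^ 3 +
        2 * min (θ i ^ 2) (1 + level n ^ 2)) := fun i => by
    rw [lintegral_eval_gaussProd θ i (g := fun x => ENNReal.ofReal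
      ((softThreshold (level n) x - θ i) ^ 2)) ((hs.sub_const _).pow_const 2).ennreal_ofReal]
    exact lintegral_soft_le (by linarith) (θ i)
  refine (Finset.sum_le_sum fun i _ => h1 i).trans ?_
  rw [← ENNReal.ofReal_sum_of_nonneg (fun i _ => by positivity), Finset.sum_add_distrib,
    Finset.sum_const, Finset.card_univ, nsmul_eq_mul, exp_neg_level_sq h.pos]
  refine ENNReal.ofReal_le_ofReal ?_
  have h2 : (Real.log n + 1) ^ (3 / 2 : ℝ) ≤ level n ^ 3 := by
    have e : level n ^ 3 = (level n ^ 2) ^ (3 / 2 : ℝ) := by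
      rw [← Real.rpow_natCast, ← Real.rpow_natCast, ← Real.rpow_mul (by linarith)]
      norm_num
    rw [e, level_sq]
    refine Real.rpow_le_rpow (by linarith) (by linarith) (by norm_num)
  have h3 : (n : ℝ) * (32 * (1 / (n : ℝ)) / level n ^ 3) ≤
      32 * (1 / (Real.log n + 1) ^ (3 / 2 : ℝ)) := by
    calc _ = 32 * (1 / level n ^ 3) := by field_simp
      _ ≤ _ := by gcongr
  gcongr

theorem IsLarge.card_mul_b_sq : Fintype.card ι * τ.b (Fintype.card ι) ^ 2 =
    τ.b0 ^ 2 * Real.log (Fintype.card ι) ^ 2 := by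
  have := h.sqrt_pos
  have e := h.sq_sqrt
  unfold Tuning.b
  rw [div_pow, e]
  have := h.cast_pos
  field_simp

theorem IsLarge.b_pos : 0 < τ.b (Fintype.card ι) := by
  have := h.log_pos
  have := h.sqrt_pos
  have := τ.b0_pos
  unfold Tuning.b; positivity

/-- The excess risk in a large block in terms of the regularisation bias. -/
theorem IsLarge.hybrid_le_regBias {f : ℝ → ℝ} (hf : Measurable f) :
    ∑ i, ∫⁻ X, ENNReal.ofReal ((tHat Finset.univ X τ (X i) - θ i) ^ 2) ∂(gaussProd θ) ≤
      ∑ i, ∫⁻ x, ENNReal.ofReal ((f x - θ i) ^ 2) ∂(gaussianReal (θ i) 1) +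
        ENNReal.ofReal ((ruleConst τ + 60 * τ.b0) * (Fintype.card ι *
            (Real.log (Fintype.card ι) ^ 2 / √(Fintype.card ι))) +
          (rareConst τ + 32) * (1 / (Real.log (Fintype.card ι) + 1) ^ (3 / 2 : ℝ))) +
        2 * ((Fintype.card ι : ℝ≥0∞) * regBias (τ.rho (Fintype.card ι)) θ) := by
  set n := Fintype.card ι with hn
  have hL := h.eight_le_log
  have hs := h.sqrt_pos
  have hnc := h.cast_pos
  have hb := h.b_pos
  have hb0 := τ.b0_pos
  have hA := ruleConst_pos τ
  have hR := rareConst_pos τ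
  have ht : 0 ≤ 1 / (Real.log n + 1) ^ (3 / 2 : ℝ) := by positivity
  have hq : 0 ≤ Real.log n ^ 2 / √n := by positivity
  have hsoft : ∑ i, ∫⁻ X, (ruleSet τ ι)ᶜ.indicator (fun X => ENNReal.ofReal
        ((softThreshold (level n) (X i) - θ i) ^ 2)) X ∂(gaussProd θ) ≤
      ENNReal.ofReal (60 * τ.b0 * (n * (Real.log n ^ 2 / √n)) +
        (rareConst τ + 32) * (1 / (Real.log n + 1) ^ (3 / 2 : ℝ))) := by
    -- For κ ≤ 2b thresholding costs at most of order `n κ log n`, hence `n (log n)² / √n`, besides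
    -- the noise term. For κ > 2b it is chosen only if `kappaHat` falls short of its mean by b.
    rcases le_or_gt (kappa θ) (2 * τ.b n) with hk | hk
    · calc _ ≤ ∑ i, ∫⁻ X, ENNReal.ofReal ((softThreshold (level n) (X i) - θ i) ^ 2)
            ∂(gaussProd θ) :=
            Finset.sum_le_sum fun i _ => lintegral_mono fun X => Set.indicator_le_self _ _ X
        _ ≤ _ := h.sum_lintegral_soft_le θ
        _ ≤ _ := by
            refine ENNReal.ofReal_le_ofReal ?_
            have h1 : ∑ i, 2 * min (θ i ^ 2) (1 + level n ^ 2) ≤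
                60 * τ.b0 * (n * (Real.log n ^ 2 / √n)) := by
              calc _ ≤ ∑ i, 6 * Real.log n * min 1 (θ i ^ 2) := by
                    refine Finset.sum_le_sum fun i _ => ?_
                    rw [level_sq]
                    have h0 := sq_nonneg (θ i)
                    rcases le_total 1 (θ i ^ 2) with h2 | h2
                    · rw [min_eq_left h2]
                      have := min_le_right (θ i ^ 2) (1 + 2 * Real.log n)
                      linarith
                    · rw [min_eq_right h2]
                      have := min_le_left (θ i ^ 2) (1 + 2 * Real.log n)
                      nlinarith
                _ ≤ 6 * Real.log n * (n * (5 * (2 * τ.b n))) := by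
                    rw [← Finset.mul_sum]
                    have := sum_min_one_sq_le θ
                    rw [← hn] at this
                    refine mul_le_mul_of_nonneg_left (this.trans ?_) (by linarith)
                    gcongr
                _ = _ := by unfold Tuning.b; ring
            have : 0 ≤ rareConst τ * (1 / (Real.log n + 1) ^ (3 / 2 : ℝ)) := by positivity
            linarith
    · have hP : gaussProd θ (ruleSet τ ι)ᶜ ≤ ENNReal.ofReal (Real.exp (-(n * τ.b n ^ 2))) := by
        refine (measure_mono fun X hX => ?_).trans (hoeffding_kappa θ hb.le).1
        have hX' : ¬ τ.b n < kappaHat Finset.univ X := hX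
        simp only [Set.mem_ofPred_eq]
        linarith
      refine (h.sum_lintegral_soft_rare_le θ measurableSet_ruleSet.compl ?_ hP).trans
        (ENNReal.ofReal_le_ofReal ?_)
      · rw [h.card_mul_b_sq]
        have := h.le_b0
        nlinarith
      · have h1 := mul_le_mul_of_nonneg_left h.one_div_card_le_rpow hR.le
        rw [mul_one_div] at h1
        have h2 : 0 ≤ 60 * τ.b0 * (n * (Real.log n ^ 2 / √n)) := by positivity
        linarith
  have hrule : ∑ i, ∫⁻ X, (ruleSet τ ι).indicator (fun X => ENNReal.ofReal
        ((X i + score (τ.rho n) (level n) X (X i) - θ i) ^ 2)) X ∂(gaussProd θ) ≤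
      ∑ i, ∫⁻ x, ENNReal.ofReal ((f x - θ i) ^ 2) ∂(gaussianReal (θ i) 1) +
        ENNReal.ofReal (ruleConst τ * (n * (Real.log n ^ 2 / √n))) +
        2 * ((n : ℝ≥0∞) * regBias (τ.rho n) θ) := by
    refine (Finset.sum_le_sum fun i _ => lintegral_mono fun X =>
      Set.indicator_le_self _ _ X).trans ((h.sum_lintegral_rule_le θ hf).trans ?_)
    gcongr
    nlinarith
  refine (sum_lintegral_tHat_le θ h.nStar_le).trans ((add_le_add hrule hsoft).trans (le_of_eq ?_))
  rw [add_right_comm, add_assoc (∑ i, _), ← ENNReal.ofReal_add (by positivity) (by positivity)]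
  congr 3
  ring

/-- The excess risk in a large block in terms of the moments of the means. -/
theorem IsLarge.hybrid_le_moment {f : ℝ → ℝ} (hf : Measurable f) {q D : ℝ} (hq : 0 < q)
    (hq2 : q ≤ 2) (hD : ∑ i, |θ i| ^ q ≤ Fintype.card ι * D) :
    ∑ i, ∫⁻ X, ENNReal.ofReal ((tHat Finset.univ X τ (X i) - θ i) ^ 2) ∂(gaussProd θ) ≤
      ∑ i, ∫⁻ x, ENNReal.ofReal ((f x - θ i) ^ 2) ∂(gaussianReal (θ i) 1) +
        ENNReal.ofReal ((2 / τ.b0 * (ruleConst τ + 864 * τ.rho0) + 128 * τ.rho0 + 12) *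
            (Fintype.card ι * (D * Real.log (Fintype.card ι) ^ (1 - q / 2))) +
          (rareConst τ + 32) * (1 / (Real.log (Fintype.card ι) + 1) ^ (3 / 2 : ℝ))) := by
  set n := Fintype.card ι with hn
  have hL := h.eight_le_log
  have hs := h.sqrt_pos
  have hnc := h.cast_pos
  have hb := h.b_pos
  have hb0 := τ.b0_pos
  have hr := τ.rho0_pos
  have hA := ruleConst_pos τ
  have hR := rareConst_pos τ
  have ht : 0 ≤ 1 / (Real.log n + 1) ^ (3 / 2 : ℝ) := by positivity
  have hD0 : 0 ≤ D := by
    have : 0 ≤ n * D := (Finset.sum_nonneg fun i _ => by positivity).trans hD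
    exact nonneg_of_mul_nonneg_right this hnc
  have hDL : D ≤ D * Real.log n ^ (1 - q / 2) :=
    le_mul_of_one_le_right hD0 (Real.one_le_rpow (by linarith) (by linarith))
  have hsoft : ∑ i, ∫⁻ X, (ruleSet τ ι)ᶜ.indicator (fun X => ENNReal.ofReal
        ((softThreshold (level n) (X i) - θ i) ^ 2)) X ∂(gaussProd θ) ≤
      ENNReal.ofReal (6 * (n * (D * Real.log n ^ (1 - q / 2))) +
        32 * (1 / (Real.log n + 1) ^ (3 / 2 : ℝ))) := by
    refine (Finset.sum_le_sum fun i _ => lintegral_mono fun X =>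
      Set.indicator_le_self _ _ X).trans ((h.sum_lintegral_soft_le θ).trans
        (ENNReal.ofReal_le_ofReal ?_))
    have h1 : ∀ i, 2 * min (θ i ^ 2) (1 + level n ^ 2) ≤
        6 * Real.log n ^ (1 - q / 2) * |θ i| ^ q := fun i => by
      set v := 1 + level n ^ 2 with hv
      have hv0 : 0 < v := by positivity
      have hv3 : v ≤ 3 * Real.log n := by rw [hv, level_sq]; linarith
      have hm : 0 ≤ min (θ i ^ 2) v := by positivity
      -- Interpolation: split the minimum m as `m^(q/2) m^(1 - q/2)` and bound each factor by a
      -- different entry.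
      have h2 : min (θ i ^ 2) v ≤ (θ i ^ 2) ^ (q / 2) * v ^ (1 - q / 2) := by
        calc min (θ i ^ 2) v = (min (θ i ^ 2) v) ^ (q / 2) * (min (θ i ^ 2) v) ^ (1 - q / 2) := by
              rw [← Real.rpow_add' hm (by norm_num)]; norm_num
          _ ≤ _ := by
              have := min_le_left (θ i ^ 2) v
              have := min_le_right (θ i ^ 2) v
              have : 0 ≤ 1 - q / 2 := by linarith
              gcongr
      have h3 : (θ i ^ 2) ^ (q / 2) = |θ i| ^ q := by
        rw [← sq_abs, ← Real.rpow_ofNat, ← Real.rpow_mul (abs_nonneg _)]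
        congr 1; ring
      have h4 : v ^ (1 - q / 2) ≤ 3 * Real.log n ^ (1 - q / 2) := by
        calc _ ≤ (3 * Real.log n) ^ (1 - q / 2) := by
              have : 0 ≤ 1 - q / 2 := by linarith
              gcongr
          _ = 3 ^ (1 - q / 2) * Real.log n ^ (1 - q / 2) :=
              Real.mul_rpow (by norm_num) (by linarith)
          _ ≤ (3 : ℝ) ^ (1 : ℝ) * Real.log n ^ (1 - q / 2) := by
              gcongr
              · norm_num
              · linarith
          _ = _ := by rw [Real.rpow_one]
      rw [h3] at h2
      have h5 : 0 ≤ |θ i| ^ q := by positivity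
      nlinarith
    have h2 : ∑ i, 2 * min (θ i ^ 2) (1 + level n ^ 2) ≤
        6 * (n * (D * Real.log n ^ (1 - q / 2))) := by
      refine (Finset.sum_le_sum fun i _ => h1 i).trans ?_
      rw [← Finset.mul_sum]
      calc _ ≤ 6 * Real.log n ^ (1 - q / 2) * (n * D) := by gcongr
        _ = _ := by ring
    linarith
  have hrule : ∑ i, ∫⁻ X, (ruleSet τ ι).indicator (fun X => ENNReal.ofReal
        ((X i + score (τ.rho n) (level n) X (X i) - θ i) ^ 2)) X ∂(gaussProd θ) ≤
      ∑ i, ∫⁻ x, ENNReal.ofReal ((f x - θ i) ^ 2) ∂(gaussianReal (θ i) 1) +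
        ENNReal.ofReal ((2 / τ.b0 * (ruleConst τ + 864 * τ.rho0) + 128 * τ.rho0 + 6) *
            (n * (D * Real.log n ^ (1 - q / 2))) +
          rareConst τ * (1 / (Real.log n + 1) ^ (3 / 2 : ℝ))) := by
    -- The term `log n / √n` must be charged to D. If κ ≥ b/2 this works since κ ≤ D; if κ < b/2 the
    -- Bayes rule is used only when `kappaHat` exceeds its mean by b/2.
    rcases le_or_gt (τ.b n / 2) (kappa θ) with hk | hk
    · refine (Finset.sum_le_sum fun i _ => lintegral_mono fun X =>
        Set.indicator_le_self _ _ X).trans ((h.sum_lintegral_rule_le θ hf).trans ?_)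
      rw [add_assoc]
      refine add_le_add le_rfl ?_
      have hbias := h.card_mul_regBias_le_moment θ hq hq2 hD
      have hLD : Real.log n / √n ≤ 2 / τ.b0 * D := by
        have h1 : τ.b n / 2 ≤ D := by
          refine hk.trans ((kappa_le_avg_rpow θ hq hq2).trans ?_)
          rw [one_div, inv_mul_le_iff₀ hnc]
          exact hD
        have h2 : Real.log n / √n = 2 / τ.b0 * (τ.b n / 2) := by unfold Tuning.b; field_simp
        rw [h2]
        gcongr
      calc _ ≤ ENNReal.ofReal (ruleConst τ * (n * (Real.log n / √n))) + ENNReal.ofReal 2 *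
            ENNReal.ofReal (n * (432 * τ.rho0 * (Real.log n / √n) + (64 * τ.rho0 + 3) * D)) := by
            rw [ENNReal.ofReal_ofNat]
            gcongr
        _ = ENNReal.ofReal (ruleConst τ * (n * (Real.log n / √n)) +
            2 * (n * (432 * τ.rho0 * (Real.log n / √n) + (64 * τ.rho0 + 3) * D))) := by
            rw [← ENNReal.ofReal_mul (by norm_num), ← ENNReal.ofReal_add (by positivity)
              (by positivity)]
        _ ≤ _ := by
            refine ENNReal.ofReal_le_ofReal ?_
            have h3 : 0 ≤ rareConst τ * (1 / (Real.log n + 1) ^ (3 / 2 : ℝ)) := by positivity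
            calc _ = n * ((ruleConst τ + 864 * τ.rho0) * (Real.log n / √n) +
                  (128 * τ.rho0 + 6) * D) := by ring
              _ ≤ n * ((ruleConst τ + 864 * τ.rho0) * (2 / τ.b0 * D) +
                  (128 * τ.rho0 + 6) * D) := by gcongr
              _ = (2 / τ.b0 * (ruleConst τ + 864 * τ.rho0) + 128 * τ.rho0 + 6) * (n * D) := by ring
              _ ≤ (2 / τ.b0 * (ruleConst τ + 864 * τ.rho0) + 128 * τ.rho0 + 6) *
                  (n * (D * Real.log n ^ (1 - q / 2))) := by gcongr
              _ ≤ _ := by linarith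
    · have hP : gaussProd θ (ruleSet τ ι) ≤
          ENNReal.ofReal (Real.exp (-(n * (τ.b n / 2) ^ 2))) := by
        refine (measure_mono fun X hX => ?_).trans (hoeffding_kappa θ (by linarith)).2
        have hX' : τ.b n < kappaHat Finset.univ X := hX
        simp only [Set.mem_ofPred_eq]
        linarith
      refine le_add_of_le_right ((h.sum_lintegral_rule_rare_le θ measurableSet_ruleSet ?_ hP).trans
        (ENNReal.ofReal_le_ofReal ?_))
      -- The deviation is only b/2, so the exponent is `b₀² (log n)² / 4`; this is why 16 appears in
      -- `le_b0`.
      · have e := h.card_mul_b_sq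
        have := h.le_b0
        rw [← hn] at e ⊢
        nlinarith
      · have h1 := mul_le_mul_of_nonneg_left h.one_div_card_le_rpow hR.le
        rw [mul_one_div] at h1
        have h2 : 0 ≤ (2 / τ.b0 * (ruleConst τ + 864 * τ.rho0) + 128 * τ.rho0 + 6) *
            (n * (D * Real.log n ^ (1 - q / 2))) := by positivity
        linarith
  refine (sum_lintegral_tHat_le θ h.nStar_le).trans ((add_le_add hrule hsoft).trans (le_of_eq ?_))
  rw [add_assoc, ← ENNReal.ofReal_add (by positivity) (by positivity)]
  congr 2
  ring

end Hybrid

/-! ### Small blocks -/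

/-- Near 0 the density is at most 1 and the singularity is integrable because u < 1; elsewhere the
power is at most 1. -/
theorem lintegral_rpow_neg_le {u : ℝ} (hu : 0 ≤ u) (hu1 : u < 1) (t : ℝ) :
    ∫⁻ x, ENNReal.ofReal (|x| ^ (-u)) ∂(gaussianReal t 1) ≤ ENNReal.ofReal (1 + 2 / (1 - u)) := by
  have hu' : 0 < 1 - u := by linarith
  set f : ℝ → ℝ := (Set.Ioo 0 1).indicator fun x => x ^ (-u) with hf
  have hf0 : ∀ x, 0 ≤ f x :=
    fun x => Set.indicator_nonneg (fun y hy => Real.rpow_nonneg hy.1.le _) x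
  have hf2 : ∫ x, f |x| = 2 / (1 - u) := by
    rw [integral_comp_abs, hf, setIntegral_indicator measurableSet_Ioo,
      Set.inter_eq_right.2 (fun x hx => hx.1), ← integral_Ioc_eq_integral_Ioo,
      ← intervalIntegral.integral_of_le zero_le_one, integral_rpow (Or.inl (by linarith)),
      Real.one_rpow, Real.zero_rpow (by linarith), neg_add_eq_sub]
    ring
  have hfi : Integrable fun x => f |x| := by
    by_contra h
    rw [integral_undef h] at hf2
    have : 0 < 2 / (1 - u) := by positivity
    linarith
  rw [lintegral_gaussian]
  calc _ ≤ ∫⁻ x, ENNReal.ofReal (npdf t x) + ENNReal.ofReal (f |x|) := by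
        refine lintegral_mono fun x => ?_
        simp only []
        rw [← ENNReal.ofReal_mul (npdf_pos _ _).le, ← ENNReal.ofReal_add (npdf_pos _ _).le (hf0 _)]
        refine ENNReal.ofReal_le_ofReal ?_
        have hp := npdf_pos t x
        by_cases hx : |x| ∈ Set.Ioo (0 : ℝ) 1
        · rw [hf, Set.indicator_of_mem hx]
          have := npdf_le_one t x
          have h0 : 0 ≤ |x| ^ (-u) := by positivity
          nlinarith
        · have h1 : |x| ^ (-u) ≤ 1 := by
            rcases eq_or_lt_of_le (abs_nonneg x) with h0 | h0
            · rw [← h0]; exact Real.zero_rpow_le_one _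
            · exact Real.rpow_le_one_of_one_le_of_nonpos
                (not_lt.1 fun h => hx ⟨h0, h⟩) (by linarith)
          have := hf0 |x|
          nlinarith
    _ = _ := by
        rw [lintegral_add_left (continuous_npdf t).measurable.ennreal_ofReal, lintegral_npdf,
          ← ofReal_integral_eq_lintegral_ofReal hfi (Eventually.of_forall fun x => hf0 _), hf2,
          ENNReal.ofReal_add zero_le_one (by positivity), ENNReal.ofReal_one]

section Small

variable {ι : Type*} [Fintype ι] (θ : ι → ℝ)

theorem sum_lintegral_self :
    ∑ i, ∫⁻ X, ENNReal.ofReal ((X i - θ i) ^ 2) ∂(gaussProd θ) = Fintype.card ι := by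
  have : ∀ i, ∫⁻ X, ENNReal.ofReal ((X i - θ i) ^ 2) ∂(gaussProd θ) = 1 := fun i => by
    rw [lintegral_eval_gaussProd θ i (g := fun x => ENNReal.ofReal ((x - θ i) ^ 2)) (by fun_prop),
      lintegral_sq_sub_gaussian]
  simp [this]

theorem ae_gaussProd_ne_zero : ∀ᵐ X ∂(gaussProd θ), ∀ i, X i ≠ 0 :=
  ae_all_iff.2 fun i => by
    have : NullSingletonClass (gaussianReal (θ i) 1) :=
      nullSingletonClass_gaussianReal one_ne_zero
    exact Measure.ae_eval_ne (μ := fun i => gaussianReal (θ i) 1) i 0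

theorem lintegral_prod_gaussProd {g : ℝ → ℝ≥0∞} (hg : Measurable g) :
    ∫⁻ X, ∏ i, g (X i) ∂(gaussProd θ) = ∏ i, ∫⁻ x, g x ∂(gaussianReal (θ i) 1) := by
  have h := lintegral_prod_eq_prod_lintegral_of_indepFun (μ := gaussProd θ) Finset.univ
    (fun i X => g (X i)) (iIndepFun_pi (X := fun _ => g) fun i => hg.aemeasurable)
    fun i => hg.comp (measurable_pi_apply i)
  exact h.trans (Finset.prod_congr rfl fun i _ => lintegral_eval_gaussProd θ i hg)

/-- The inverse of the squared norm has a finite mean in dimension at least three. -/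
theorem lintegral_one_div_sum_sq_le (hn : 3 ≤ Fintype.card ι) :
    ∫⁻ X, ENNReal.ofReal (1 / ∑ i, X i ^ 2) ∂(gaussProd θ) ≤
      ENNReal.ofReal ((1 + 2 / (1 - 2 / (Fintype.card ι : ℝ))) ^ Fintype.card ι) := by
  have hn3 : (3 : ℝ) ≤ (Fintype.card ι : ℝ) := by exact_mod_cast hn
  set n : ℝ := (Fintype.card ι : ℝ) with hndef
  have hu : 0 ≤ 2 / n := by positivity
  have hu1 : 2 / n < 1 := by rw [div_lt_one (by linarith)]; linarith
  have hm : Measurable fun x : ℝ => ENNReal.ofReal (|x| ^ (-(2 / n))) := by fun_prop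
  calc _ ≤ ∫⁻ X, ∏ i, ENNReal.ofReal (|X i| ^ (-(2 / n))) ∂(gaussProd θ) := by
        -- The geometric mean must be nonzero to be inverted, which holds almost surely.
        refine lintegral_mono_ae ((ae_gaussProd_ne_zero θ).mono fun X hX => ?_)
        rw [← ENNReal.ofReal_prod_of_nonneg fun i _ => by positivity]
        refine ENNReal.ofReal_le_ofReal ?_
        have h1 := Real.geom_mean_le_arith_mean_weighted Finset.univ (fun _ : ι => 1 / n)
          (fun i => X i ^ 2) (fun i _ => by positivity)
          (by
            rw [Finset.sum_const, Finset.card_univ, nsmul_eq_mul, ← hndef]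
            field_simp)
          (fun i _ => sq_nonneg _)
        have h2 : ∀ i, (X i ^ 2) ^ (1 / n) = |X i| ^ (2 / n) := fun i => by
          rw [← sq_abs, ← Real.rpow_ofNat, ← Real.rpow_mul (abs_nonneg _), mul_one_div]
        simp only [h2] at h1
        rw [← Finset.mul_sum] at h1
        -- AM-GM decouples the coordinates; the exponent 2/n is below 1 exactly in dimension at
        -- least 3.
        have h3 : ∏ i, |X i| ^ (2 / n) ≤ ∑ i, X i ^ 2 := by
          refine h1.trans (mul_le_of_le_one_left (Finset.sum_nonneg fun i _ => sq_nonneg _) ?_)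
          rw [div_le_one (by linarith)]; linarith
        have h4 : 0 < ∏ i, |X i| ^ (2 / n) :=
          Finset.prod_pos fun i _ => Real.rpow_pos_of_pos (abs_pos.2 (hX i)) _
        simp_rw [Real.rpow_neg (abs_nonneg _)]
        rw [Finset.prod_inv_distrib, ← one_div]
        exact one_div_le_one_div_of_le h4 h3
    _ = ∏ i, ∫⁻ x, ENNReal.ofReal (|x| ^ (-(2 / n))) ∂(gaussianReal (θ i) 1) :=
        lintegral_prod_gaussProd θ hm
    _ ≤ ∏ _i : ι, ENNReal.ofReal (1 + 2 / (1 - 2 / n)) := by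
        exact Finset.prod_le_prod' fun i _ => lintegral_rpow_neg_le hu hu1 (θ i)
    _ = _ := by
        rw [Finset.prod_const, Finset.card_univ, ENNReal.ofReal_pow]
        have : 0 < 1 - 2 / n := by linarith
        positivity

/-- With S the squared norm, the shrinkage term sums to `m²/S`, whose mean is finite. No sharp risk
comparison is needed, because only finitely many block sizes use this rule. -/
theorem sum_lintegral_jamesStein_le (hn : 3 ≤ Fintype.card ι) (m : ℝ) :
    ∑ i, ∫⁻ X, ENNReal.ofReal (((1 - m / ∑ k, X k ^ 2) * X i - θ i) ^ 2) ∂(gaussProd θ) ≤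
      ENNReal.ofReal (2 * Fintype.card ι + 2 * m ^ 2 *
        (1 + 2 / (1 - 2 / (Fintype.card ι : ℝ))) ^ Fintype.card ι) := by
  have hn3 : (3 : ℝ) ≤ Fintype.card ι := by exact_mod_cast hn
  have hc : 0 ≤ (1 + 2 / (1 - 2 / (Fintype.card ι : ℝ))) ^ Fintype.card ι := by
    have : 2 / (Fintype.card ι : ℝ) < 1 := by rw [div_lt_one (by linarith)]; linarith
    have : 0 < 1 - 2 / (Fintype.card ι : ℝ) := by linarith
    positivity
  rw [← lintegral_finsetSum _ fun i _ => by fun_prop]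
  calc _ ≤ ∫⁻ X, (2 * ∑ i, ENNReal.ofReal ((X i - θ i) ^ 2) +
        ENNReal.ofReal (2 * m ^ 2) * ENNReal.ofReal (1 / ∑ k, X k ^ 2)) ∂(gaussProd θ) := by
        refine lintegral_mono fun X => ?_
        simp only []
        set S := ∑ k, X k ^ 2 with hS
        have hS0 : 0 ≤ S := Finset.sum_nonneg fun i _ => sq_nonneg _
        have e2 : (2 : ℝ≥0∞) = ENNReal.ofReal 2 := (ENNReal.ofReal_ofNat 2).symm
        have h0 : 0 ≤ ∑ i, (X i - θ i) ^ 2 := Finset.sum_nonneg fun i _ => sq_nonneg _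
        rw [← ENNReal.ofReal_sum_of_nonneg fun i _ => sq_nonneg _,
          ← ENNReal.ofReal_sum_of_nonneg fun i _ => sq_nonneg _, e2,
          ← ENNReal.ofReal_mul (by norm_num), ← ENNReal.ofReal_mul (by positivity),
          ← ENNReal.ofReal_add (by positivity) (by positivity)]
        refine ENNReal.ofReal_le_ofReal ?_
        calc ∑ i, ((1 - m / S) * X i - θ i) ^ 2 ≤
              ∑ i, (2 * (X i - θ i) ^ 2 + 2 * (m / S) ^ 2 * X i ^ 2) :=
              Finset.sum_le_sum fun i _ => by
                nlinarith [sq_nonneg ((X i - θ i) + m / S * X i)]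
          _ = 2 * ∑ i, (X i - θ i) ^ 2 + 2 * (m / S) ^ 2 * S := by
              rw [Finset.sum_add_distrib, Finset.mul_sum, hS, Finset.mul_sum]
          _ = _ := by
              -- For S = 0 both sides agree because division by zero gives 0.
              rcases eq_or_lt_of_le hS0 with h | h
              · simp [← h]
              · field_simp
    _ = 2 * ∑ i, ∫⁻ X, ENNReal.ofReal ((X i - θ i) ^ 2) ∂(gaussProd θ) +
        ENNReal.ofReal (2 * m ^ 2) * ∫⁻ X, ENNReal.ofReal (1 / ∑ k, X k ^ 2) ∂(gaussProd θ) := by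
        rw [lintegral_add_left (by fun_prop), lintegral_const_mul _ (by fun_prop),
          lintegral_finsetSum _ (fun i _ => by fun_prop),
          lintegral_const_mul' _ _ ENNReal.ofReal_ne_top]
    _ ≤ 2 * Fintype.card ι + ENNReal.ofReal (2 * m ^ 2) *
        ENNReal.ofReal ((1 + 2 / (1 - 2 / (Fintype.card ι : ℝ))) ^ Fintype.card ι) := by
        rw [sum_lintegral_self]
        gcongr
        exact lintegral_one_div_sum_sq_le θ hn
    _ = _ := by
        rw [ENNReal.ofReal_add (by positivity) (by positivity),
          ENNReal.ofReal_mul (p := 2 * m ^ 2) (by positivity),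
          ENNReal.ofReal_mul (q := (Fintype.card ι : ℝ)) zero_le_two, ENNReal.ofReal_natCast,
          ENNReal.ofReal_ofNat]

end Small

/-- For every block size the risk is bounded uniformly in the means. -/
theorem exists_sum_lintegral_tHat_le (τ : Tuning) (n : ℕ) :
    ∃ R : ℝ, 0 ≤ R ∧ ∀ (ι : Type) [Fintype ι] [Nonempty ι] (θ : ι → ℝ), Fintype.card ι = n →
      ∑ i, ∫⁻ X, ENNReal.ofReal ((tHat Finset.univ X τ (X i) - θ i) ^ 2) ∂(gaussProd θ) ≤
        ENNReal.ofReal R := by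
  rcases le_or_gt τ.nStar n with hn | hn
  · refine ⟨n * (2 * (level n ^ 2 / τ.rho n + level n) ^ 2 + 6), by positivity,
      fun ι _ _ θ h => ?_⟩
    subst h
    exact sum_lintegral_tHat_le_crude θ hn
  have hself : ∀ (ι : Type) [Fintype ι] [Nonempty ι] (θ : ι → ℝ), Fintype.card ι = n →
      (∀ X x, τ.smallRule.apply (Finset.univ : Finset ι) X x = x) →
      ∑ i, ∫⁻ X, ENNReal.ofReal ((tHat Finset.univ X τ (X i) - θ i) ^ 2) ∂(gaussProd θ) ≤
        ENNReal.ofReal n := by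
    intro ι _ _ θ h hx
    simp only [tHat, Finset.card_univ, h, not_le.2 hn, if_false, hx]
    rw [sum_lintegral_self, h, ENNReal.ofReal_natCast]
  cases hrule : τ.smallRule with
  | mle =>
    exact ⟨n, Nat.cast_nonneg n, fun ι _ _ θ h => hself ι θ h fun X x => by
      rw [hrule, SmallBlockRule.apply]⟩
  | jamesStein =>
    rcases le_or_gt n 2 with h2 | h2
    · refine ⟨n, Nat.cast_nonneg n, fun ι _ _ θ h => hself ι θ h fun X x => ?_⟩
      rw [hrule, SmallBlockRule.apply, Finset.card_univ, h, Nat.sub_eq_zero_of_le h2]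
      simp
    · refine ⟨2 * n + 2 * ((n - 2 : ℕ) : ℝ) ^ 2 * (1 + 2 / (1 - 2 / (n : ℝ))) ^ n, ?_,
        fun ι _ _ θ h => ?_⟩
      · have h3 : (2 : ℝ) < n := by exact_mod_cast h2
        have : 2 / (n : ℝ) < 1 := by rw [div_lt_one (by linarith)]; linarith
        have : 0 < 1 - 2 / (n : ℝ) := by linarith
        positivity
      · subst h
        simp only [tHat, Finset.card_univ, not_le.2 hn, if_false, hrule, SmallBlockRule.apply]
        exact sum_lintegral_jamesStein_le θ h2 _

/-! ### The risk bound for one block -/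

theorem rate_nonneg {q C : ℝ} (hC : 0 ≤ C) (n : ℕ) : 0 ≤ rate q n C := by
  have hL := Real.log_natCast_nonneg n
  unfold rate
  refine le_min zero_le_one (le_min (by positivity) (le_max_of_le_left (by positivity)))

/-- The rate is one of its three entries. For 1 and for the maximum the regularisation bias is
bounded directly; for `C^q / (log n)^(q/2 - 1)` the adaptive argument with κ is needed, since that
entry may be far below `log n / √n`. -/
theorem IsLarge.hybrid_le_rate {τ : Tuning} {ι : Type*} [Fintype ι] [Nonempty ι] (θ : ι → ℝ)
    (h : IsLarge τ (Fintype.card ι)) {f : ℝ → ℝ} (hf : Measurable f) {q C : ℝ} (hq : 0 < q)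
    (hq2 : q ≤ 2) (hC : 0 ≤ C) (hD : ∑ i, |θ i| ^ q ≤ Fintype.card ι * C ^ q) {M : ℝ}
    (hM1 : ruleConst τ + 60 * τ.b0 + 256 * τ.rho0 + 14 ≤ M)
    (hM2 : 2 / τ.b0 * (ruleConst τ + 864 * τ.rho0) + 128 * τ.rho0 + 12 ≤ M)
    (hM3 : rareConst τ + 32 ≤ M) :
    ∑ i, ∫⁻ X, ENNReal.ofReal ((tHat Finset.univ X τ (X i) - θ i) ^ 2) ∂(gaussProd θ) ≤
      ∑ i, ∫⁻ x, ENNReal.ofReal ((f x - θ i) ^ 2) ∂(gaussianReal (θ i) 1) +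
        ENNReal.ofReal (M * (Fintype.card ι * rate q (Fintype.card ι) C +
          1 / (Real.log (Fintype.card ι) + 1) ^ (3 / 2 : ℝ))) := by
  have hL := h.eight_le_log
  have hnc := h.cast_pos
  have hs := h.sqrt_pos
  have hb0 := τ.b0_pos
  have hr0 := τ.rho0_pos
  have hA := ruleConst_pos τ
  set n := Fintype.card ι with hn
  set t := 1 / (Real.log n + 1) ^ (3 / 2 : ℝ) with ht
  have ht0 : 0 ≤ t := by positivity
  have hM0 : 0 ≤ M := by linarith
  -- Common to the entries that dominate `(log n)² / √n`, the cost of thresholding.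
  have hbias : ∀ r : ℝ, 0 ≤ r → Real.log n ^ 2 / √n ≤ r →
      (n : ℝ≥0∞) * regBias (τ.rho n) θ ≤ ENNReal.ofReal (n * ((128 * τ.rho0 + 6) * r)) →
      ∑ i, ∫⁻ X, ENNReal.ofReal ((tHat Finset.univ X τ (X i) - θ i) ^ 2) ∂(gaussProd θ) ≤
        ∑ i, ∫⁻ x, ENNReal.ofReal ((f x - θ i) ^ 2) ∂(gaussianReal (θ i) 1) +
          ENNReal.ofReal (M * (n * r + t)) := by
    intro r hr hr1 hr2
    refine (h.hybrid_le_regBias θ hf).trans ?_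
    rw [add_assoc]
    refine add_le_add le_rfl ?_
    calc _ ≤ ENNReal.ofReal ((ruleConst τ + 60 * τ.b0) * (n * r) + (rareConst τ + 32) * t) +
          ENNReal.ofReal 2 * ENNReal.ofReal (n * ((128 * τ.rho0 + 6) * r)) := by
          rw [ENNReal.ofReal_ofNat]
          gcongr
      _ = ENNReal.ofReal ((ruleConst τ + 60 * τ.b0) * (n * r) + (rareConst τ + 32) * t +
          2 * (n * ((128 * τ.rho0 + 6) * r))) := by
          have := rareConst_pos τ
          rw [← ENNReal.ofReal_mul zero_le_two, ← ENNReal.ofReal_add (by positivity)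
            (by positivity)]
      _ ≤ _ := by
          refine ENNReal.ofReal_le_ofReal ?_
          have h1 : 0 ≤ n * r := by positivity
          have h2 := mul_le_mul_of_nonneg_right hM1 h1
          have h3 := mul_le_mul_of_nonneg_right hM3 ht0
          nlinarith
  unfold rate
  rcases min_choice (1 : ℝ) (min (C ^ q / Real.log n ^ (q / 2 - 1))
    (max (Real.log n ^ 2 / √n) ((C * Real.log n ^ (3 / 2 : ℝ) / √n) ^ (q / (q + 1))))) with h1 | h1
  · rw [h1]
    refine hbias 1 zero_le_one ((div_le_one hs).2 h.log_sq_le) ((card_mul_regBias_le θ _).trans ?_)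
    rw [← ENNReal.ofReal_natCast]
    refine ENNReal.ofReal_le_ofReal (le_mul_of_one_le_right hnc.le ?_)
    linarith
  rw [h1]
  rcases min_choice (C ^ q / Real.log n ^ (q / 2 - 1))
    (max (Real.log n ^ 2 / √n) ((C * Real.log n ^ (3 / 2 : ℝ) / √n) ^ (q / (q + 1)))) with h2 | h2
  · rw [h2]
    refine (h.hybrid_le_moment θ hf hq hq2 hD).trans (add_le_add le_rfl
      (ENNReal.ofReal_le_ofReal ?_))
    have e : C ^ q / Real.log n ^ (q / 2 - 1) = C ^ q * Real.log n ^ (1 - q / 2) := by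
      rw [div_eq_mul_inv, ← Real.rpow_neg (by linarith), neg_sub]
    rw [e, mul_add M]
    refine add_le_add (mul_le_mul_of_nonneg_right hM2 (by positivity))
      (mul_le_mul_of_nonneg_right hM3 ht0)
  · rw [h2]
    exact hbias _ (le_max_of_le_left (by positivity)) (le_max_left _ _)
      (h.card_mul_regBias_le_max θ hq hC hD)

/-- Beyond n₀ the asymptotic bound holds. The finitely many smaller sizes have bounded risk, and
multiplying the bound by `(log n + 1)^(3/2)` lets the last summand absorb it, without using the
competitor or the rate. -/
theorem exists_block_risk_le (τ : Tuning) :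
    ∃ M : ℝ, 0 ≤ M ∧ ∀ (ι : Type) [Fintype ι] [Nonempty ι] (θ : ι → ℝ) (f : ℝ → ℝ) (q C : ℝ),
      Measurable f → 0 < q → q ≤ 2 → 0 ≤ C → ∑ i, |θ i| ^ q ≤ Fintype.card ι * C ^ q →
      ∑ i, ∫⁻ X, ENNReal.ofReal ((tHat Finset.univ X τ (X i) - θ i) ^ 2) ∂(gaussProd θ) ≤
        ∑ i, ∫⁻ x, ENNReal.ofReal ((f x - θ i) ^ 2) ∂(gaussianReal (θ i) 1) +
          ENNReal.ofReal (M * (Fintype.card ι * rate q (Fintype.card ι) C +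
            1 / (Real.log (Fintype.card ι) + 1) ^ (3 / 2 : ℝ))) := by
  obtain ⟨n₀, hn₀⟩ := eventually_atTop.1 (eventually_isLarge τ)
  choose R hR0 hR using exists_sum_lintegral_tHat_le τ
  have hb0 := τ.b0_pos
  have hr0 := τ.rho0_pos
  have hA := ruleConst_pos τ
  have hB := rareConst_pos τ
  have hpos : ∀ n : ℕ, 0 < (Real.log n + 1) ^ (3 / 2 : ℝ) := fun n => by
    have := Real.log_natCast_nonneg n
    positivity
  set M₁ := ruleConst τ + 60 * τ.b0 + 256 * τ.rho0 + 14 with hM₁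
  set M₂ := 2 / τ.b0 * (ruleConst τ + 864 * τ.rho0) + 128 * τ.rho0 + 12 with hM₂
  set M₃ := rareConst τ + 32 with hM₃
  set M₄ := ∑ n ∈ Finset.range n₀, R n * (Real.log n + 1) ^ (3 / 2 : ℝ) with hM₄
  have hM₁0 : 0 ≤ M₁ := by positivity
  have hM₂0 : 0 ≤ M₂ := by positivity
  have hM₃0 : 0 ≤ M₃ := by positivity
  have hterm : ∀ n : ℕ, 0 ≤ R n * (Real.log n + 1) ^ (3 / 2 : ℝ) :=
    fun n => mul_nonneg (hR0 n) (hpos n).le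
  have hM₄0 : 0 ≤ M₄ := Finset.sum_nonneg fun n _ => hterm n
  refine ⟨M₁ + M₂ + M₃ + M₄, by positivity, fun ι _ _ θ f q C hf hq hq2 hC hD => ?_⟩
  rcases le_or_gt n₀ (Fintype.card ι) with hn | hn
  · exact (hn₀ _ hn).hybrid_le_rate θ hf hq hq2 hC hD (by linarith) (by linarith) (by linarith)
  · refine le_add_of_le_right ((hR _ ι θ rfl).trans (ENNReal.ofReal_le_ofReal ?_))
    have h1 : R (Fintype.card ι) * (Real.log (Fintype.card ι) + 1) ^ (3 / 2 : ℝ) ≤ M₄ :=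
      Finset.single_le_sum (f := fun n : ℕ => R n * (Real.log n + 1) ^ (3 / 2 : ℝ))
        (fun n _ => hterm n) (Finset.mem_range.2 hn)
    have h2 := rate_nonneg (q := q) hC (Fintype.card ι)
    calc R (Fintype.card ι) ≤ M₄ * (1 / (Real.log (Fintype.card ι) + 1) ^ (3 / 2 : ℝ)) := by
          rw [mul_one_div, le_div_iff₀ (hpos _)]; exact h1
      _ ≤ _ := by
          have := hpos (Fintype.card ι)
          refine mul_le_mul (by linarith) ?_ (by positivity) (by positivity)
          have : 0 ≤ Fintype.card ι * rate q (Fintype.card ι) C := by positivity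
          linarith

/-! ### Restriction to one block -/

theorem tHat_restrict {κ : Type*} (s : Finset κ) (X : κ → ℝ) (τ : Tuning) (x : ℝ) :
    tHat s X τ x = tHat (Finset.univ : Finset s) (s.restrict X) τ x := by
  have h1 : (Finset.univ : Finset s).card = s.card := by rw [Finset.card_univ, Fintype.card_coe]
  have h2 : phiHat s X = phiHat (Finset.univ : Finset s) (s.restrict X) := by
    funext z
    rw [phiHat, phiHat, h1,
      ← Finset.sum_coe_sort s fun k => level s.card * kernel (level s.card * (z - X k))]
    rfl
  have h3 : kappaHat s X = kappaHat (Finset.univ : Finset s) (s.restrict X) := by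
    rw [kappaHat, kappaHat, h1, ← Finset.sum_coe_sort s fun k => Real.exp (-(X k) ^ 2 / 2)]
    rfl
  have h4 : ∀ r : SmallBlockRule, r.apply s X x = r.apply (Finset.univ : Finset s) (s.restrict X) x
    | .mle => rfl
    | .jamesStein => by
      rw [SmallBlockRule.apply, SmallBlockRule.apply, h1,
        ← Finset.sum_coe_sort s fun k => (X k) ^ 2]
      rfl
  rw [tHat, tHat, h1, h2, h3, h4]

theorem measurable_tHat (τ : Tuning) {ι : Type*} [Fintype ι] (i : ι) :
    Measurable fun X : ι → ℝ => tHat Finset.univ X τ (X i) := by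
  rcases le_or_gt τ.nStar (Fintype.card ι) with hn | hn
  · simp only [tHat_univ hn]
    have hs : Measurable fun X : ι → ℝ =>
        score (τ.rho (Fintype.card ι)) (level (Fintype.card ι)) X (X i) := by
      have h1 := continuous_kernel.measurable
      have h2 := continuous_kernelDeriv.measurable
      unfold score kde kdeD
      fun_prop
    exact Measurable.ite measurableSet_ruleSet ((measurable_pi_apply i).add hs)
      ((measurable_softThreshold (Real.sqrt_nonneg _)).comp (measurable_pi_apply i))
  · simp only [tHat, Finset.card_univ, not_le.2 hn, if_false]
    cases τ.smallRule <;> simp only [SmallBlockRule.apply] <;> fun_prop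

/-! ### Standardisation -/

theorem gaussianReal_map_div {ε : ℝ} (hε : 0 < ε) (t : ℝ) :
    (gaussianReal t (Real.toNNReal (ε ^ 2))).map (fun x => x / ε) = gaussianReal (t / ε) 1 := by
  rw [gaussianReal_map_div_const]
  congr 1
  ext
  have : ε ^ 2 ≠ 0 := by positivity
  simp [Real.toNNReal_of_nonneg (sq_nonneg ε), this]

theorem law_map_div {N : ℕ∞} {ε : ℝ} (hε : 0 < ε) (β : Coord N → ℝ) :
    (law ε β).map (fun y k => y k / ε) = Measure.infinitePi fun k => gaussianReal (β k / ε) 1 := by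
  have h := Measure.infinitePi_map_pi (μ := fun k => gaussianReal (β k) (Real.toNNReal (ε ^ 2)))
    (f := fun _ x => x / ε) fun _ => by fun_prop
  rw [law, h]
  simp_rw [gaussianReal_map_div hε]

/-- The block rule sees only its own coordinates, so a possibly infinite product law is replaced by
its finite-dimensional marginal. -/
theorem lintegral_law_block {N : ℕ∞} {ε : ℝ} (hε : 0 < ε) (β : Coord N → ℝ) (s : Finset (Coord N))
    {F : (s → ℝ) → ℝ≥0∞} (hF : Measurable F) :
    ∫⁻ y, F (s.restrict fun k => y k / ε) ∂(law ε β) =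
      ∫⁻ X, F X ∂(gaussProd fun k : s => β k / ε) := by
  have h1 : Measurable fun x : Coord N → ℝ => F (s.restrict x) :=
    hF.comp (Finset.measurable_restrict s)
  have h2 := lintegral_map (μ := law ε β) (g := fun y k => y k / ε) h1 (by fun_prop)
  rw [← h2, law_map_div hε]
  exact lintegral_restrict_infinitePi
    (μ := fun k : Coord N => gaussianReal (β k / ε) 1) hF

theorem lintegral_law_eval {N : ℕ∞} {ε : ℝ} (hε : 0 < ε) (β : Coord N → ℝ) (k : Coord N)
    {F : ℝ → ℝ≥0∞} (hF : Measurable F) :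
    ∫⁻ y, F (y k) ∂(law ε β) = ∫⁻ x, F (ε * x) ∂(gaussianReal (β k / ε) 1) := by
  rw [law, (measurePreserving_eval_infinitePi
    (fun k => gaussianReal (β k) (Real.toNNReal (ε ^ 2))) k).lintegral_comp hF,
    ← gaussianReal_map_div hε, lintegral_map (by fun_prop) (by fun_prop)]
  simp_rw [mul_div_cancel₀ _ hε.ne']

/-! ### Summation over blocks -/

namespace BlockPartition

variable {N : ℕ∞} (P : BlockPartition N)

theorem tsum_eq_tsum_block (F : Coord N → ℝ≥0∞) : ∑' k, F k = ∑' j, ∑ k ∈ P.block j, F k := by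
  rw [← (Equiv.sigmaFiberEquiv P.blockOf).tsum_eq, ENNReal.tsum_sigma']
  refine tsum_congr fun j => ?_
  rw [← Finset.tsum_subtype]
  exact (Equiv.subtypeEquivRight fun k => (P.mem_block_iff (j := j) (k := k)).symm).tsum_eq
    fun k : {k // k ∈ P.block j} => F k

theorem size_pos (j : P.Index) : 0 < P.size j := by
  rw [P.size_eq]
  have := P.endpoint_lt j j.2
  omega

end BlockPartition

/-- The power mean inequality. -/
theorem sum_rpow_le_card_mul {ι : Type*} [Fintype ι] [Nonempty ι] (θ : ι → ℝ) {p q : ℝ}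
    (hq : 0 < q) (hqp : q ≤ p) :
    ∑ i, |θ i| ^ q ≤
      Fintype.card ι * (((1 / (Fintype.card ι : ℝ)) * ∑ i, |θ i| ^ p) ^ (1 / p)) ^ q := by
  have hn := card_pos_real (ι := ι)
  have hp : 0 < p := hq.trans_le hqp
  have h := Real.arith_mean_le_rpow_mean Finset.univ (fun _ : ι => 1 / (Fintype.card ι : ℝ))
    (fun i => |θ i| ^ q) (fun i _ => by positivity)
    (by
      rw [Finset.sum_const, Finset.card_univ, nsmul_eq_mul]
      field_simp)
    (fun i _ => by positivity) ((one_le_div hq).2 hqp)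
  have e : ∀ i, (|θ i| ^ q) ^ (p / q) = |θ i| ^ p := fun i => by
    rw [← Real.rpow_mul (abs_nonneg _), mul_div_cancel₀ _ hq.ne']
  simp only [e, ← Finset.mul_sum] at h
  rw [one_div_div, one_div, inv_mul_le_iff₀ hn] at h
  rwa [← Real.rpow_mul (by positivity), one_div, one_div, inv_mul_eq_div p q]

/-- The standardised ℓ_p moment is a power mean, which increases with the exponent; it therefore
also controls the moment of order p ∧ 2. -/
theorem sum_rpow_le_blockMoment {N : ℕ∞} (P : BlockPartition N) {ε : ℝ} (hε : 0 < ε)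
    (β : Coord N → ℝ) (j : P.Index) {p : ℝ} (hp : 0 < p) :
    0 ≤ blockMoment P p ε β j ∧ ∑ k : P.block j, |β k / ε| ^ (min p 2) ≤
      P.size j * blockMoment P p ε β j ^ (min p 2) := by
  have hn : (0 : ℝ) < P.size j := by exact_mod_cast P.size_pos j
  have hcard : Fintype.card (P.block j) = P.size j := Fintype.card_coe _
  have : Nonempty (P.block j) := Fintype.card_pos_iff.1 (hcard ▸ P.size_pos j)
  have hS : 0 ≤ ∑ k ∈ P.block j, |β k| ^ p := Finset.sum_nonneg fun k _ => by positivity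
  refine ⟨by unfold blockMoment; positivity, ?_⟩
  have h := sum_rpow_le_card_mul (fun k : P.block j => β k / ε) (lt_min hp two_pos)
    (min_le_left p 2)
  have e : ((1 / (P.size j : ℝ)) * ∑ k : P.block j, |β k / ε| ^ p) ^ (1 / p) =
      blockMoment P p ε β j := by
    simp_rw [abs_div, abs_of_pos hε, Real.div_rpow (abs_nonneg _) hε.le]
    rw [← Finset.sum_div, Finset.sum_coe_sort (P.block j) fun k => |β k| ^ p, blockMoment,
      one_div_mul_eq_div, div_div, Real.div_rpow hS (by positivity),
      Real.mul_rpow (by positivity) hn.le, ← Real.rpow_mul hε.le, mul_one_div_cancel hp.ne',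
      Real.rpow_one]
  rwa [hcard, e] at h

theorem ofReal_sq_mul (ε x t : ℝ) (hε : 0 < ε) :
    ENNReal.ofReal ((ε * x - t) ^ 2) =
      ENNReal.ofReal (ε ^ 2) * ENNReal.ofReal ((x - t / ε) ^ 2) := by
  rw [← ENNReal.ofReal_mul (sq_nonneg ε), ← mul_pow, mul_sub, mul_div_cancel₀ _ hε.ne']

theorem sum_block_estimator {N : ℕ∞} (P : BlockPartition N) (τ : Tuning) {ε : ℝ} (hε : 0 < ε)
    (β : Coord N → ℝ) (j : P.Index) :
    ∑ k ∈ P.block j, ∫⁻ y, ENNReal.ofReal ((estimator P τ ε y k - β k) ^ 2) ∂(law ε β) =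
      ENNReal.ofReal (ε ^ 2) * ∑ k : P.block j, ∫⁻ X, ENNReal.ofReal
        ((tHat Finset.univ X τ (X k) - β k / ε) ^ 2) ∂(gaussProd fun k : P.block j => β k / ε) := by
  rw [← Finset.sum_coe_sort (P.block j), Finset.mul_sum]
  refine Finset.sum_congr rfl fun k _ => ?_
  have hm := (((measurable_tHat τ k).sub_const (β k / ε)).pow_const 2).ennreal_ofReal
  rw [← lintegral_law_block hε β (P.block j) hm, ← lintegral_const_mul' _ _ ENNReal.ofReal_ne_top]
  refine lintegral_congr fun y => ?_
  rw [estimator, P.mem_block_iff.1 k.2, tHat_restrict, ofReal_sq_mul _ _ _ hε]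
  rfl

theorem sum_block_separable {N : ℕ∞} (P : BlockPartition N) {ε : ℝ} (hε : 0 < ε)
    (β : Coord N → ℝ) (j : P.Index) {h : P.Index → ℝ → ℝ} (hh : Measurable (h j)) :
    ∑ k ∈ P.block j, ∫⁻ y, ENNReal.ofReal ((h (P.blockOf k) (y k) - β k) ^ 2) ∂(law ε β) =
      ENNReal.ofReal (ε ^ 2) * ∑ k : P.block j, ∫⁻ x, ENNReal.ofReal
        ((h j (ε * x) / ε - β k / ε) ^ 2) ∂(gaussianReal (β k / ε) 1) := by
  rw [← Finset.sum_coe_sort (P.block j), Finset.mul_sum]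
  refine Finset.sum_congr rfl fun k _ => ?_
  rw [P.mem_block_iff.1 k.2, lintegral_law_eval hε β k
    (F := fun x => ENNReal.ofReal ((h j x - β k) ^ 2)) (by fun_prop),
    ← lintegral_const_mul' _ _ ENNReal.ofReal_ne_top]
  refine lintegral_congr fun x => ?_
  rw [← ofReal_sq_mul _ _ _ hε, mul_div_cancel₀ _ hε.ne']

end

end GEB

theorem theorem3p1 (τ : GEB.Tuning) :
    ∃ M : ℝ≥0, ∀ (N : ℕ∞) (P : GEB.BlockPartition N) (ε : ℝ) (_ : 0 < ε)
      (β : GEB.Coord N → ℝ) (p : ℝ) (_ : 0 < p),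
      GEB.risk ε (GEB.estimator P τ ε) β ≤
        GEB.idealRisk P ε β +
          (M : ℝ≥0∞) * ENNReal.ofReal (ε ^ 2) *
            ∑' j : P.Index, ENNReal.ofReal
              ((P.size j : ℝ) * GEB.rate (min p 2) (P.size j) (GEB.blockMoment P p ε β j)
                + 1 / (Real.log (P.size j) + 1) ^ (3 / 2 : ℝ)) := by
  obtain ⟨M, hM, hblock⟩ := GEB.exists_block_risk_le τ
  refine ⟨M.toNNReal, fun N P ε hε β p hp => ?_⟩
  change _ ≤ _ + ENNReal.ofReal M * _ * _
  unfold GEB.idealRisk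
  simp only [ENNReal.iInf_add]
  -- M does not depend on the competitor, so one may be fixed before the comparison block by block.
  refine le_iInf₂ fun h hh => ?_
  rw [GEB.risk, GEB.risk, P.tsum_eq_tsum_block, P.tsum_eq_tsum_block, ← ENNReal.tsum_mul_left,
    ← ENNReal.tsum_add]
  refine ENNReal.tsum_le_tsum fun j => ?_
  obtain ⟨hC, hD⟩ := GEB.sum_rpow_le_blockMoment P hε β j hp
  have hcard : Fintype.card (P.block j) = P.size j := Fintype.card_coe _
  have : Nonempty (P.block j) := Fintype.card_pos_iff.1 (hcard ▸ P.size_pos j)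
  -- In the standardised block the competitor is `x ↦ h_j(ε x)/ε`.
  have hb := hblock (P.block j) (fun k => β k / ε) (fun x => h j (ε * x) / ε) (min p 2)
    (GEB.blockMoment P p ε β j) (((hh j).comp (measurable_const_mul ε)).div_const ε)
    (lt_min hp two_pos) (min_le_right _ _) hC (by rwa [hcard])
  rw [GEB.sum_block_estimator P τ hε β j, GEB.sum_block_separable P hε β j (hh j),
    mul_comm (ENNReal.ofReal M), mul_assoc, ← ENNReal.ofReal_mul hM, ← mul_add]
  rw [hcard] at hb
  gcongr
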